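/- Let $\Delta=\{\xi\in\mathbb R^2 : l_i(\xi)>0,\ 1\le i\le d\}$, $l_i(\xi)=\langle \xi,v_i\rangle-\lambda_i$ with $v_i\in\mathbb Z^2$, $\lambda_i\in\mathbb R$, be a Delzant polygon: $\Delta$ is non-empty and bounded, each $\ell_i=\bar\Delta\cap\{l_i=0\}$ is a genuine edge, and the normals $v_i,v_j$ of any two edges meeting in a vertex form a basis of $\mathbb Z^2$. Let $\ell_i^\circ$ be the edge $\ell_i$ without its end points. Put $v=\sum_i l_i\log l_i$ (with $0\log 0=0$), and let $\mathcal C^\infty(\Delta,v)$ be the set of functions $u=v+\psi$ on $\bar\Delta$ with $\psi\in C^\infty(\bar\Delta)$ whose Hessian $(\partial^2_{ij}u)$ is positive definite in $\Delta$. For such $u$ put $$\mathcal S(u)=-\sum_{i,j}U^{ij}\,\partial^2_{ij}w,\qquad w=\det(\partial^2_{ij}u)^{-1},$$ where $(U^{ij})$ is the cofactor matrix of $(\partial^2_{ij}u)$, and let $\mathcal C^\infty(\Delta,v;K_o)=\{u\in \mathcal C^\infty(\Delta,v): |\mathcal S(u)|\le K_o \text{ in } \Delta\}$. Proposition. Let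 $K_o,\mathcal C_1$ be constants and let $u_k\in\mathcal C^\infty(\Delta,v;K_o)$, $k\ge 0$, be a sequence with $\mathcal S(u_k)=K_k$ in $\Delta$ and $\max_{\bar\Delta}u_k-\min_{\bar\Delta}u_k\le \mathcal C_1$ for all $k$. Suppose that $K_k,K\in C^3(\bar\Delta)$ and that $K_k$ converges to $K$ uniformly in $C^3$ on $\bar\Delta$, and that $u_k$ converges locally uniformly in $C^6$ in $\Delta$ to a strictly convex function $u_\infty$. Then $u_\infty$ extends to a continuous function on $\bar\Delta$, again denoted by $u_\infty$, and for every edge $\ell$ the restrictions $u_k|_{\ell^\circ}$ converge locally uniformly on $\ell^\circ$ to a convex function $h$, with $$u_\infty(q)=h(q)\qquad\text{for all } q\in\ell^\circ .$$ -/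

import Mathlib

open Set Filter Topology
open scoped ContDiff

noncomputable section

namespace ToricSurface

/-- The plane `𝔱* ≅ ℝ²` with its Euclidean norm. -/
abbrev Plane : Type := EuclideanSpace ℝ (Fin 2)

/-! ### Delzant polygons -/

/-- `d` affine functions `l_i(ξ) = ⟨ξ, v_i⟩ - λ_i` on the plane with integral linear part:
`normal i` is the lattice vector `v_i` and `offset i` the real number `λ_i`. -/
structure Polygon (d : ℕ) where
  normal : Fin d → Fin 2 → ℤ
  offset : Fin d → ℝ

namespace Polygon

variable {d : ℕ} (P : Polygon d)

/-- The affine function `l_i(ξ) = ⟨ξ, v_i⟩ - λ_i`. -/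
def l (i : Fin d) (ξ : Plane) : ℝ :=
  (∑ j, ξ j * (P.normal i j : ℝ)) - P.offset i

/-- The open polygon `Δ = {ξ | l_i(ξ) > 0 for all i}`. -/
def interior : Set Plane := {ξ | ∀ i, 0 < P.l i ξ}

/-- The closed polygon, the closure of `Δ`. -/
def closed : Set Plane := closure P.interior

/-- The closed edge `ℓ_i`: the points of the closed polygon on the line `l_i = 0`. -/
def edge (i : Fin d) : Set Plane := {ξ | ξ ∈ P.closed ∧ P.l i ξ = 0}

/-- The interior `ℓ_i°` of the edge `ℓ_i`: its points that lie on no other edge. -/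
def openEdge (i : Fin d) : Set Plane := {ξ | ξ ∈ P.edge i ∧ ∀ j, j ≠ i → ξ ∉ P.edge j}

/-- `Δ` is a Delzant polygon with inward normals `v_i`: a non-empty bounded open polygon, each
`l_i` cuts out a genuine edge, and the normals of two edges that meet in a vertex generate the
lattice `ℤ²` (so in particular the `v_i` are primitive and distinct). -/
structure IsDelzant : Prop where
  nonempty : P.interior.Nonempty
  bounded : Bornology.IsBounded P.interior
  edge_nontrivial : ∀ i, (P.edge i).Nontrivial
  unimodular : ∀ i j, i ≠ j → (P.edge i ∩ P.edge j).Nonempty →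
    IsUnit (P.normal i 0 * P.normal j 1 - P.normal i 1 * P.normal j 0)

/-- The Guillemin function `v = ∑ l_i log l_i`, with the value `0 log 0 = 0` on the edges. -/
def guillemin (ξ : Plane) : ℝ := ∑ i, P.l i ξ * Real.log (P.l i ξ)

end Polygon

/-! ### The scalar curvature operator -/

/-- The partial derivative `∂u/∂ξ_i`. -/
def pderiv (i : Fin 2) (u : Plane → ℝ) (ξ : Plane) : ℝ :=
  fderiv ℝ u ξ (EuclideanSpace.single i 1)

/-- The Hessian matrix `(∂²_{ij} u)`. -/
def hessian (u : Plane → ℝ) (ξ : Plane) : Matrix (Fin 2) (Fin 2) ℝ :=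
  Matrix.of fun i j => pderiv i (pderiv j u) ξ

/-- `𝓢(u) = -∑ U^{ij} ∂²_{ij} w`, where `(U^{ij})` is the cofactor matrix of the Hessian of `u`
and `w = (det (∂²_{ij} u))⁻¹`. -/
def scalarCurvature (u : Plane → ℝ) (ξ : Plane) : ℝ :=
  -∑ i, ∑ j, (hessian u ξ).adjugate i j * hessian (fun η => ((hessian u η).det)⁻¹) ξ i j

/-! ### Spaces of potentials -/

namespace Polygon

variable {d : ℕ} (P : Polygon d)

/-- `C^∞(Δ, v)`: the functions `u = v + ψ` on the closed polygon, with `ψ` smooth up to the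
boundary, that are strictly convex in `Δ`, in the sense that the Hessian is positive definite. -/
def potentials : Set (Plane → ℝ) :=
  {u | (∃ ψ : Plane → ℝ, ContDiffOn ℝ ∞ ψ P.closed ∧
      ∀ ξ ∈ P.closed, u ξ = P.guillemin ξ + ψ ξ) ∧
    ∀ ξ ∈ P.interior, (hessian u ξ).PosDef}

/-- `C^∞(Δ, v; K_o)`: the functions of `C^∞(Δ, v)` with `|𝓢(u)| ≤ K_o` in `Δ`. -/
def potentialsBdd (Ko : ℝ) : Set (Plane → ℝ) :=
  {u | u ∈ P.potentials ∧ ∀ ξ ∈ P.interior, |scalarCurvature u ξ| ≤ Ko}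

end Polygon

/-! ### Modes of convergence -/

/-- `f_k → F` uniformly in `C^m` on `s`: all are `C^m` on `s`, and the derivatives up to order `m`
converge uniformly on `s` (for a closed polygon `s` these are the derivatives up to the
boundary). -/
def UniformCm (m : ℕ) (f : ℕ → Plane → ℝ) (F : Plane → ℝ) (s : Set Plane) : Prop :=
  (∀ k, ContDiffOn ℝ m (f k) s) ∧ ContDiffOn ℝ m F s ∧
    ∀ r ≤ m, TendstoUniformlyOn (fun k => iteratedFDerivWithin ℝ r (f k) s)
      (iteratedFDerivWithin ℝ r F s) atTop s

/-- `f_k → F` locally uniformly in `C^m` on the open set `s`. -/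
def LocallyUniformCm (m : ℕ) (f : ℕ → Plane → ℝ) (F : Plane → ℝ) (s : Set Plane) : Prop :=
  (∀ k, ContDiffOn ℝ m (f k) s) ∧ ContDiffOn ℝ m F s ∧
    ∀ r ≤ m, TendstoLocallyUniformlyOn (fun k => iteratedFDeriv ℝ r (f k))
      (iteratedFDeriv ℝ r F) atTop s

end ToricSurface

end

/-!
The point is that the boundary values of the `u_k` cannot jump in the limit. Convexity alone rules out
a jump downwards (`eventually_gt_of_closed`), gives equicontinuity along compact parts of the open
edges (`exists_equicontinuous`), and makes the limit function continuous up to the boundary, since a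
bounded convex function on an open polygon has limits at all boundary points
(`exists_tendsto_of_convexOn`). Convexity does allow `u_k` to be much larger on an edge than at nearby
interior points; this is excluded by the bound on the scalar curvature, in an integral form
(`eventually_lt_of_openEdge`).

**Integration by parts.** For `f ≤ u` smooth up to the boundary, integrate `𝓢(u) (u - f)` by parts
twice. Formally this gives a positive multiple of the integral of `u - f` over the boundary plus the
integral of `tr ((∂²u)⁻¹ ∂²(u - f))` with a negative sign, and `tr ((∂²u)⁻¹ ∂²u) = 2`. Hence
`c ∫_{∂Δ} (u - f) ≤ ∫_Δ (2 - tr ((∂²u)⁻¹ ∂²f) + K_o (u - f))` (`exists_boundary_estimate`), with `c`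
independent of `u`. To justify it, `u - f` is multiplied by the cutoff function
`Θ(1 + (log ∏ l_i) / R)`, `Θ(y) = max(0, y)³`, and `R` tends to infinity. In the term
`-Θ' / R · ∑ (∂²u)⁻¹(v_i, v_i) / l_i²` the integral of `1 / l_i` over a strip on which `Θ'` is bounded
below is proportional to `R`, so this term produces the boundary integral; the others are dominated
by the integrable functions `1 / (l_i (1 + log² l_i))` and vanish in the limit.

**Non-degeneracy.** The estimate needs `(∂²u)⁻¹(v_i, v_i) = O(l_i)`, so `l_i det (∂²u)` must not vanish
on the open edge `ℓ_i`. The definition of the space of potentials only asks for convexity in the open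
polygon. But on the edge, `k = (l_i det (∂²u))⁻¹` satisfies a linear second order differential
inequality along the edge, with coefficients bounded on its compact parts, because `𝓢(u)` is bounded
(`edge_inequality`). Near the end points of the edge `k` is finite, and by Grönwall's inequality it
stays finite on all of it (`edgeDet_pos`). With the behaviour at the vertices this gives
`det (∂²u) ∏ l_i ≥ c > 0` (`exists_le_det_mul_prod`) and the bounds `exists_cometric_le` and
`exists_abs_cometric_grad_le` on the inverse Hessian.

**The comparison function.** Take for `f` the function `u_k ∘ σ_t`, `σ_t` the contraction with factor
`t < 1` towards an interior point, plus a small multiple of `|ξ|²` minus a small constant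
(`competitor`). It is smooth up to the boundary and lies below `u_k`. By the arithmetic-geometric mean
inequality the integrand of the estimate is at most a bounded function of `u_k` and its Hessian at
`ξ` and at `σ_t(ξ)` (`excess`). By dominated convergence its integral converges as `k → ∞` to the same
expression for `u_∞`, which tends to zero as `t → 1` (`exists_eventually_integral_excess_lt`). So for
`t` close to `1` and `k` large, `u_k` cannot exceed `f`, hence `u_k ∘ σ_t`, by a fixed amount along a
fixed segment of an edge; and `u_k ∘ σ_t` is uniformly close to the values of the extension of `u_∞`
on such a segment.
-/

open Set Filter Topology
open scoped ContDiff

namespace ToricSurface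

/-! ### The geometry of a Delzant polygon -/

namespace Polygon

variable {d : ℕ} (P : Polygon d)

/-- The linear part `⟨·, v_i⟩` of the affine function `l_i`. -/
noncomputable def lin (i : Fin d) : Plane →L[ℝ] ℝ :=
  ∑ j, (P.normal i j : ℝ) • EuclideanSpace.proj j

theorem lin_apply (i : Fin d) (e : Plane) :
    P.lin i e = e 0 * (P.normal i 0 : ℝ) + e 1 * (P.normal i 1 : ℝ) := by
  simp [lin, Fin.sum_univ_two, mul_comm]

theorem l_eq (i : Fin d) (ξ : Plane) : P.l i ξ = P.lin i ξ - P.offset i := by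
  simp [l, lin_apply, Fin.sum_univ_two]

theorem l_add (i : Fin d) (ξ e : Plane) : P.l i (ξ + e) = P.l i ξ + P.lin i e := by
  simp [l_eq]; ring

theorem l_combo (i : Fin d) (ξ η : Plane) {a b : ℝ} (h : a + b = 1) :
    P.l i (a • ξ + b • η) = a * P.l i ξ + b * P.l i η := by
  simp only [l_eq, map_add, map_smul, smul_eq_mul]
  linear_combination P.offset i * h

theorem contDiff_l (i : Fin d) {n : WithTop ℕ∞} : ContDiff ℝ n (P.l i) := by
  have : P.l i = fun ξ => P.lin i ξ - P.offset i := funext (P.l_eq i)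
  rw [this]
  exact (P.lin i).contDiff.sub contDiff_const

theorem continuous_l (i : Fin d) : Continuous (P.l i) := (P.contDiff_l i (n := 0)).continuous

theorem hasFDerivAt_l (i : Fin d) (ξ : Plane) : HasFDerivAt (P.l i) (P.lin i) ξ := by
  have : P.l i = fun ξ => P.lin i ξ - P.offset i := funext (P.l_eq i)
  rw [this]
  exact (P.lin i).hasFDerivAt.sub_const _

theorem isOpen_interior : IsOpen P.interior := by
  simp only [interior, Set.ofPred_forall]
  exact isOpen_iInter_of_finite fun i => isOpen_lt continuous_const (P.continuous_l i)

theorem convex_interior : Convex ℝ P.interior := by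
  intro ξ hξ η hη a b ha hb hab i
  rw [P.l_combo i ξ η hab]
  rcases ha.eq_or_lt with rfl | ha
  · have : b = 1 := by linarith
    simp [this, hη i]
  · have h1 := mul_pos ha (hξ i)
    have h2 := mul_nonneg hb (hη i).le
    linarith

theorem interior_subset_closed : P.interior ⊆ P.closed := subset_closure

theorem convex_closed : Convex ℝ P.closed := P.convex_interior.closure

theorem interior_interior : _root_.interior P.interior = P.interior :=
  P.isOpen_interior.interior_eq

theorem measurableSet_interior : MeasurableSet P.interior := P.isOpen_interior.measurableSet

variable {P}

/-- The points of a half-open segment from a point of `Δ` to a point where all `l_i` are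
non-negative lie in `Δ`. -/
theorem contract_mem_of_nonneg {p ξ : Plane} (hp : p ∈ P.interior) (hξ : ∀ i, 0 ≤ P.l i ξ)
    {t : ℝ} (ht0 : 0 ≤ t) (ht1 : t < 1) : (1 - t) • p + t • ξ ∈ P.interior := by
  intro i
  rw [P.l_combo i p ξ (by ring)]
  have h1 := mul_pos (sub_pos.2 ht1) (hp i)
  have h2 := mul_nonneg ht0 (hξ i)
  linarith

theorem mem_closed_iff (hne : P.interior.Nonempty) {ξ : Plane} :
    ξ ∈ P.closed ↔ ∀ i, 0 ≤ P.l i ξ := by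
  constructor
  · intro h i
    have : P.closed ⊆ {η | 0 ≤ P.l i η} :=
      closure_minimal (fun η hη => (hη i).le) (isClosed_le continuous_const (P.continuous_l i))
    exact this h
  · intro h
    obtain ⟨p, hp⟩ := hne
    have hc : Continuous fun t : ℝ => (1 - t) • p + t • ξ := by fun_prop
    have h1 : Tendsto (fun t : ℝ => (1 - t) • p + t • ξ) (𝓝[<] 1) (𝓝 ξ) := by
      have := (hc.tendsto 1).mono_left (nhdsWithin_le_nhds (s := Iio 1))
      simpa using this
    refine mem_closure_of_tendsto h1 ?_
    filter_upwards [self_mem_nhdsWithin, nhdsWithin_le_nhds (Ioi_mem_nhds one_pos)] with t ht ht0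
    exact contract_mem_of_nonneg hp h (le_of_lt ht0) ht

namespace IsDelzant

variable (hP : P.IsDelzant)
include hP

theorem l_nonneg {ξ : Plane} (h : ξ ∈ P.closed) (i : Fin d) : 0 ≤ P.l i ξ :=
  (mem_closed_iff hP.nonempty).1 h i

theorem contract_mem {p ξ : Plane} (hp : p ∈ P.interior) (hξ : ξ ∈ P.closed)
    {t : ℝ} (ht0 : 0 ≤ t) (ht1 : t < 1) : (1 - t) • p + t • ξ ∈ P.interior :=
  contract_mem_of_nonneg hp (hP.l_nonneg hξ) ht0 ht1

theorem isCompact_closed : IsCompact P.closed := hP.bounded.isCompact_closure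

theorem lin_ne_zero (i : Fin d) : P.lin i ≠ 0 := by
  intro h
  obtain ⟨p, hp⟩ := hP.nonempty
  obtain ⟨ξ, hξ⟩ := (hP.edge_nontrivial i).nonempty
  have h1 := hp i
  have h2 := hξ.2
  rw [l_eq, h] at h1 h2
  simp at h1 h2
  linarith

theorem normSq_pos (i : Fin d) :
    0 < (P.normal i 0 : ℝ) ^ 2 + (P.normal i 1 : ℝ) ^ 2 := by
  by_contra hcon
  have h0 : (P.normal i 0 : ℝ) = 0 := by nlinarith [sq_nonneg (P.normal i 0 : ℝ), sq_nonneg (P.normal i 1 : ℝ)]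
  have h1 : (P.normal i 1 : ℝ) = 0 := by nlinarith [sq_nonneg (P.normal i 0 : ℝ), sq_nonneg (P.normal i 1 : ℝ)]
  refine hP.lin_ne_zero i (ContinuousLinearMap.ext fun e => ?_)
  simp [lin_apply, h0, h1]

theorem mem_openEdge_iff {i : Fin d} {ξ : Plane} :
    ξ ∈ P.openEdge i ↔ P.l i ξ = 0 ∧ ∀ j, j ≠ i → 0 < P.l j ξ := by
  constructor
  · rintro ⟨⟨h1, h2⟩, h3⟩
    refine ⟨h2, fun j hj => lt_of_le_of_ne (hP.l_nonneg h1 j) fun h => h3 j hj ⟨h1, h.symm⟩⟩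
  · rintro ⟨h1, h2⟩
    have hc : ξ ∈ P.closed := (mem_closed_iff hP.nonempty).2 fun j => by
      by_cases hj : j = i
      · rw [hj, h1]
      · exact (h2 j hj).le
    exact ⟨⟨hc, h1⟩, fun j hj h => (h2 j hj).ne' h.2⟩

theorem convex_openEdge (i : Fin d) : Convex ℝ (P.openEdge i) := by
  intro ξ hξ η hη a b ha hb hab
  rw [hP.mem_openEdge_iff] at *
  refine ⟨by rw [P.l_combo i ξ η hab, hξ.1, hη.1]; simp, fun j hj => ?_⟩
  rw [P.l_combo j ξ η hab]
  rcases ha.eq_or_lt with rfl | ha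
  · have : b = 1 := by linarith
    simp [this, hη.2 j hj]
  · have h1 := mul_pos ha (hξ.2 j hj)
    have h2 := mul_nonneg hb (hη.2 j hj).le
    linarith

theorem det_sq_pos {i j : Fin d} (hij : i ≠ j) {ξ : Plane} (hξ : ξ ∈ P.closed)
    (hi : P.l i ξ = 0) (hj : P.l j ξ = 0) :
    0 < ((P.normal i 0 : ℝ) * P.normal j 1 - P.normal i 1 * P.normal j 0) ^ 2 := by
  have h := (hP.unimodular i j hij ⟨ξ, ⟨hξ, hi⟩, ⟨hξ, hj⟩⟩).ne_zero
  have h' : ((P.normal i 0 : ℝ) * P.normal j 1 - P.normal i 1 * P.normal j 0) ≠ 0 := by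
    exact_mod_cast h
  positivity

/-- If the lines `l_i = 0` and `l_j = 0` meet at a vertex together with `l_m = 0`, then `v_j` and
`v_m` lie on the same side of the line spanned by `v_i`, because the edge `ℓ_i` contains a second
point. -/
theorem det_mul_det_pos {i j m : Fin d} (hij : i ≠ j) (him : i ≠ m) {ξ : Plane}
    (hξ : ξ ∈ P.closed) (hi : P.l i ξ = 0) (hj : P.l j ξ = 0) (hm : P.l m ξ = 0) :
    0 < ((P.normal i 0 : ℝ) * P.normal j 1 - P.normal i 1 * P.normal j 0) *
      ((P.normal i 0 : ℝ) * P.normal m 1 - P.normal i 1 * P.normal m 0) := by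
  obtain ⟨η, hη, hne⟩ := (hP.edge_nontrivial i).exists_ne ξ
  have hD := hP.det_sq_pos hij hξ hi hj
  have hE := hP.det_sq_pos him hξ hi hm
  have hv := hP.normSq_pos i
  have e1 := hη.2
  have e2 := hP.l_nonneg hη.1 j
  have e3 := hP.l_nonneg hη.1 m
  have hsub : η = ξ + (η - ξ) := by abel
  rw [hsub, l_add, lin_apply] at e1 e2 e3
  rw [hi, zero_add] at e1
  rw [hj, zero_add] at e2
  rw [hm, zero_add] at e3
  set x := (η - ξ) 0 with hx
  set y := (η - ξ) 1 with hy
  have hxy : ¬ (x = 0 ∧ y = 0) := by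
    rintro ⟨h0, h1⟩
    refine hne (sub_eq_zero.1 ?_)
    ext k
    fin_cases k
    · exact h0
    · exact h1
  set a := (P.normal i 0 : ℝ)
  set b := (P.normal i 1 : ℝ)
  set c := (P.normal j 0 : ℝ)
  set c' := (P.normal j 1 : ℝ)
  set f := (P.normal m 0 : ℝ)
  set f' := (P.normal m 1 : ℝ)
  -- `(x, y) = s (-b, a)` for some `s ≠ 0`
  set s := (a * y - b * x) / (a ^ 2 + b ^ 2) with hs
  have hx' : x = -s * b := by
    rw [hs]; field_simp; linear_combination a * e1
  have hy' : y = s * a := by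
    rw [hs]; field_simp; linear_combination b * e1
  have hs0 : s ≠ 0 := by
    intro h
    exact hxy ⟨by rw [hx', h]; ring, by rw [hy', h]; ring⟩
  have f2 : 0 ≤ s * (a * c' - b * c) := by
    have : x * c + y * c' = s * (a * c' - b * c) := by rw [hx', hy']; ring
    rwa [this] at e2
  have f3 : 0 ≤ s * (a * f' - b * f) := by
    have : x * f + y * f' = s * (a * f' - b * f) := by rw [hx', hy']; ring
    rwa [this] at e3
  have hnn : 0 ≤ (a * c' - b * c) * (a * f' - b * f) := by
    have h1 := mul_nonneg f2 f3
    have h2 : s * (a * c' - b * c) * (s * (a * f' - b * f)) =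
      s ^ 2 * ((a * c' - b * c) * (a * f' - b * f)) := by ring
    rw [h2] at h1
    exact nonneg_of_mul_nonneg_right h1 (by positivity)
  refine lt_of_le_of_ne hnn fun h => ?_
  rcases mul_eq_zero.1 h.symm with h | h
  · rw [h] at hD; simp at hD
  · rw [h] at hE; simp at hE

/-- No three edges of a Delzant polygon meet in a point. -/
theorem not_three_active {i j m : Fin d} (hij : i ≠ j) (him : i ≠ m) (hjm : j ≠ m) {ξ : Plane}
    (hξ : ξ ∈ P.closed) (hi : P.l i ξ = 0) (hj : P.l j ξ = 0) (hm : P.l m ξ = 0) : False := by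
  have h1 := hP.det_mul_det_pos hij him hξ hi hj hm
  have h2 := hP.det_mul_det_pos hij.symm hjm hξ hj hi hm
  have h3 := hP.det_mul_det_pos him.symm hjm.symm hξ hm hi hj
  have h := mul_pos (mul_pos h1 h2) h3
  set x := (P.normal i 0 : ℝ) * P.normal j 1 - P.normal i 1 * P.normal j 0
  set y := (P.normal i 0 : ℝ) * P.normal m 1 - P.normal i 1 * P.normal m 0
  set z := (P.normal j 0 : ℝ) * P.normal m 1 - P.normal j 1 * P.normal m 0
  have : x * y * (((P.normal j 0 : ℝ) * P.normal i 1 - P.normal j 1 * P.normal i 0) * z) *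
      (((P.normal m 0 : ℝ) * P.normal i 1 - P.normal m 1 * P.normal i 0) *
        ((P.normal m 0 : ℝ) * P.normal j 1 - P.normal m 1 * P.normal j 0)) =
      -(x * y * z) ^ 2 := by
    simp only [x, y, z]; ring
  rw [this] at h
  nlinarith [sq_nonneg (x * y * z)]

theorem exists_l_le : ∃ B : ℝ, 1 ≤ B ∧ ∀ i, ∀ ξ ∈ P.closed, P.l i ξ ≤ B := by
  have h : ∀ i, ∃ B : ℝ, ∀ ξ ∈ P.closed, P.l i ξ ≤ B := fun i => by
    obtain ⟨B, hB⟩ := hP.isCompact_closed.bddAbove_image (P.continuous_l i).continuousOn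
    exact ⟨B, fun ξ hξ => hB (mem_image_of_mem _ hξ)⟩
  choose B hB using h
  refine ⟨1 + ∑ i, |B i|, by simpa using Finset.sum_nonneg fun i _ => abs_nonneg (B i), ?_⟩
  intro i ξ hξ
  have := Finset.single_le_sum (f := fun i => |B i|) (fun i _ => abs_nonneg _) (Finset.mem_univ i)
  have h2 := hB i ξ hξ
  have h3 := le_abs_self (B i)
  linarith

end IsDelzant

end Polygon

/-! ### Directional derivatives up to the boundary -/

/-- The derivative of `f` in the direction `e`, taken within `S`. -/
noncomputable def derivAlong (S : Set Plane) (e : Plane) (f : Plane → ℝ) (ξ : Plane) : ℝ :=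
  fderivWithin ℝ f S ξ e

/-- The second derivative `∂_e ∂_{e'} f`. -/
noncomputable def secondDeriv (e e' : Plane) (f : Plane → ℝ) (ξ : Plane) : ℝ :=
  fderiv ℝ (fun η => fderiv ℝ f η e') ξ e

theorem derivAlong_contDiffOn {S : Set Plane} (hS : UniqueDiffOn ℝ S) {f : Plane → ℝ}
    (hf : ContDiffOn ℝ ∞ f S) (e : Plane) : ContDiffOn ℝ ∞ (derivAlong S e f) S :=
  (hf.fderivWithin hS (m := ∞) le_rfl).clm_apply contDiffOn_const

theorem hessian_apply (f : Plane → ℝ) (ξ : Plane) (i j : Fin 2) :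
    hessian f ξ i j =
      secondDeriv (EuclideanSpace.single i 1) (EuclideanSpace.single j 1) f ξ := rfl

theorem plane_eq_sum (e : Plane) :
    e = e 0 • EuclideanSpace.single (0 : Fin 2) (1 : ℝ) +
      e 1 • EuclideanSpace.single (1 : Fin 2) (1 : ℝ) := by
  ext k; fin_cases k <;> simp

theorem differentiableAt_fderiv_apply {f : Plane → ℝ} {ξ : Plane} (hf : ContDiffAt ℝ 2 f ξ)
    (e : Plane) : DifferentiableAt ℝ (fun η => fderiv ℝ f η e) ξ := by
  have h : ContDiffAt ℝ 1 (fderiv ℝ f) ξ := hf.fderiv_right (by norm_num)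
  exact ((h.differentiableAt one_ne_zero).clm_apply (differentiableAt_const e))

theorem secondDeriv_eq {f : Plane → ℝ} {ξ : Plane} (hf : ContDiffAt ℝ 2 f ξ) (e e' : Plane) :
    secondDeriv e e' f ξ = fderiv ℝ (fderiv ℝ f) ξ e e' := by
  have h : ContDiffAt ℝ 1 (fderiv ℝ f) ξ := hf.fderiv_right (by norm_num)
  have := (h.differentiableAt one_ne_zero).hasFDerivAt.clm_apply (hasFDerivAt_const e' ξ)
  simp [secondDeriv, this.fderiv]

theorem secondDeriv_expand {f : Plane → ℝ} {ξ : Plane} (hf : ContDiffAt ℝ 2 f ξ)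
    (e e' : Plane) : secondDeriv e e' f ξ =
      e 0 * e' 0 * hessian f ξ 0 0 + e 0 * e' 1 * hessian f ξ 0 1 +
      e 1 * e' 0 * hessian f ξ 1 0 + e 1 * e' 1 * hessian f ξ 1 1 := by
  simp only [hessian_apply, secondDeriv_eq hf]
  conv_lhs => rw [plane_eq_sum e, plane_eq_sum e']
  simp
  ring

theorem hessian_symm {f : Plane → ℝ} {ξ : Plane} (hf : ContDiffAt ℝ 2 f ξ) (i j : Fin 2) :
    hessian f ξ i j = hessian f ξ j i := by
  simp only [hessian_apply, secondDeriv_eq hf]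
  exact (hf.isSymmSndFDerivAt (by simp)).eq _ _

/-- The second derivative from a formula for the first one near the point. -/
theorem secondDeriv_of_eventually {f g : Plane → ℝ} {ξ e' : Plane} {L : Plane →L[ℝ] ℝ}
    (h : ∀ᶠ η in 𝓝 ξ, fderiv ℝ f η e' = g η) (hg : HasFDerivAt g L ξ) (e : Plane) :
    secondDeriv e e' f ξ = L e := by
  have : (fun η => fderiv ℝ f η e') =ᶠ[𝓝 ξ] g := h
  rw [secondDeriv, this.fderiv_eq, hg.fderiv]

namespace Polygon

variable {d : ℕ} {P : Polygon d}

theorem uniqueDiffOn_between {S : Set Plane} (hne : P.interior.Nonempty)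
    (h1 : P.interior ⊆ S) (h2 : S ⊆ P.closed) : UniqueDiffOn ℝ S := fun ξ hξ =>
  (uniqueDiffWithinAt_convex P.convex_interior (by rwa [P.interior_interior])
    (h2 hξ)).mono h1

theorem hasFDerivAt_of_contDiffOn {S : Set Plane} (h1 : P.interior ⊆ S) {f : Plane → ℝ}
    (hf : ContDiffOn ℝ ∞ f S) {ξ : Plane} (hξ : ξ ∈ P.interior) :
    HasFDerivAt f (fderivWithin ℝ f S ξ) ξ := by
  have hS : S ∈ 𝓝 ξ := mem_of_superset (P.isOpen_interior.mem_nhds hξ) h1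
  exact ((hf.differentiableOn (by simp) ξ (h1 hξ)).hasFDerivWithinAt).hasFDerivAt hS

theorem eventually_mem_interior {ξ : Plane} (hξ : ξ ∈ P.interior) :
    ∀ᶠ η in 𝓝 ξ, η ∈ P.interior := P.isOpen_interior.mem_nhds hξ

/-- `P.hessGuillemin e e' = ∑ ⟨v_i, e⟩ ⟨v_i, e'⟩ / l_i`, the Hessian of the Guillemin function. -/
noncomputable def hessGuillemin (P : Polygon d) (e e' : Plane) (ξ : Plane) : ℝ :=
  ∑ i, P.lin i e * P.lin i e' / P.l i ξ

theorem hasFDerivAt_potential {u ψ : Plane → ℝ} (hψ : ContDiffOn ℝ ∞ ψ P.closed)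
    (hu : ∀ ξ ∈ P.closed, u ξ = P.guillemin ξ + ψ ξ) {ξ : Plane} (hξ : ξ ∈ P.interior) :
    HasFDerivAt u ((∑ i, (Real.log (P.l i ξ) + 1) • P.lin i) + fderivWithin ℝ ψ P.closed ξ) ξ := by
  have h1 : HasFDerivAt P.guillemin (∑ i, (Real.log (P.l i ξ) + 1) • P.lin i) ξ := by
    have : ∀ i ∈ Finset.univ, HasFDerivAt (fun η => P.l i η * Real.log (P.l i η))
        ((Real.log (P.l i ξ) + 1) • P.lin i) ξ := fun i _ =>
      (Real.hasDerivAt_mul_log (hξ i).ne').comp_hasFDerivAt ξ (P.hasFDerivAt_l i ξ)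
    exact HasFDerivAt.fun_sum this
  have h2 := hasFDerivAt_of_contDiffOn P.interior_subset_closed hψ hξ
  refine (h1.add h2).congr_of_eventuallyEq ?_
  filter_upwards [eventually_mem_interior hξ] with η hη
  exact hu η (P.interior_subset_closed hη)

theorem secondDeriv_potential (hne : P.interior.Nonempty) {u ψ : Plane → ℝ}
    (hψ : ContDiffOn ℝ ∞ ψ P.closed)
    (hu : ∀ ξ ∈ P.closed, u ξ = P.guillemin ξ + ψ ξ) {ξ : Plane} (hξ : ξ ∈ P.interior)
    (e e' : Plane) : secondDeriv e e' u ξ =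
      P.hessGuillemin e e' ξ + derivAlong P.closed e (derivAlong P.closed e' ψ) ξ := by
  have hU := uniqueDiffOn_between hne P.interior_subset_closed le_rfl
  have h1 : HasFDerivAt (fun η => (∑ i, (Real.log (P.l i η) + 1) * P.lin i e') +
      derivAlong P.closed e' ψ η)
      ((∑ i, (P.lin i e' / P.l i ξ) • P.lin i) +
        fderivWithin ℝ (derivAlong P.closed e' ψ) P.closed ξ) ξ := by
    refine HasFDerivAt.add ?_ (hasFDerivAt_of_contDiffOn P.interior_subset_closed
      (derivAlong_contDiffOn hU hψ e') hξ)
    refine HasFDerivAt.fun_sum fun i _ => ?_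
    have := (((Real.hasDerivAt_log (hξ i).ne').comp_hasFDerivAt ξ
      (P.hasFDerivAt_l i ξ)).add_const 1).mul_const (P.lin i e')
    rw [div_eq_mul_inv, mul_smul]
    exact this
  rw [secondDeriv_of_eventually (g := fun η => (∑ i, (Real.log (P.l i η) + 1) * P.lin i e') +
      derivAlong P.closed e' ψ η) ?_ h1 e]
  · simp [hessGuillemin, derivAlong]
    refine Finset.sum_congr rfl fun i _ => by ring
  · filter_upwards [eventually_mem_interior hξ] with η hη
    rw [(hasFDerivAt_potential hψ hu hη).fderiv]
    simp [derivAlong]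

theorem contDiffOn_potential {u ψ : Plane → ℝ} (hψ : ContDiffOn ℝ ∞ ψ P.closed)
    (hu : ∀ ξ ∈ P.closed, u ξ = P.guillemin ξ + ψ ξ) : ContDiffOn ℝ ∞ u P.interior := by
  have h : ContDiffOn ℝ ∞ (fun ξ => P.guillemin ξ + ψ ξ) P.interior := by
    refine ContDiffOn.add ?_ (hψ.mono P.interior_subset_closed)
    refine ContDiffOn.sum fun i _ => ?_
    exact (P.contDiff_l i).contDiffOn.mul
      ((P.contDiff_l i).contDiffOn.log fun ξ hξ => (hξ i).ne')
  exact h.congr fun ξ hξ => hu ξ (P.interior_subset_closed hξ)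

theorem continuousOn_potential {u ψ : Plane → ℝ} (hψ : ContDiffOn ℝ ∞ ψ P.closed)
    (hu : ∀ ξ ∈ P.closed, u ξ = P.guillemin ξ + ψ ξ) : ContinuousOn u P.closed := by
  have h : ContinuousOn (fun ξ => P.guillemin ξ + ψ ξ) P.closed := by
    refine ContinuousOn.add (Continuous.continuousOn ?_) hψ.continuousOn
    exact continuous_finsetSum _ fun i _ => Real.continuous_mul_log.comp (P.continuous_l i)
  exact h.congr hu

theorem contDiffAt_of_interior {n : WithTop ℕ∞} {f : Plane → ℝ} (hf : ContDiffOn ℝ n f P.interior) {ξ : Plane}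
    (hξ : ξ ∈ P.interior) : ContDiffAt ℝ n f ξ :=
  hf.contDiffAt (P.isOpen_interior.mem_nhds hξ)

theorem contDiffAt_potential {u ψ : Plane → ℝ} (hψ : ContDiffOn ℝ ∞ ψ P.closed)
    (hu : ∀ ξ ∈ P.closed, u ξ = P.guillemin ξ + ψ ξ) {ξ : Plane} (hξ : ξ ∈ P.interior) :
    ContDiffAt ℝ 2 u ξ :=
  (contDiffAt_of_interior (contDiffOn_potential hψ hu) hξ).of_le
    (WithTop.coe_le_coe.2 (le_top : (2 : ℕ∞) ≤ ⊤))

theorem contDiffOn_pderiv {f : Plane → ℝ} (hf : ContDiffOn ℝ ∞ f P.interior) (i : Fin 2) :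
    ContDiffOn ℝ ∞ (pderiv i f) P.interior :=
  (hf.fderiv_of_isOpen P.isOpen_interior (m := ∞) le_rfl).clm_apply contDiffOn_const

theorem contDiffOn_hessian {f : Plane → ℝ} (hf : ContDiffOn ℝ ∞ f P.interior) (i j : Fin 2) :
    ContDiffOn ℝ ∞ (fun ξ => hessian f ξ i j) P.interior :=
  contDiffOn_pderiv (contDiffOn_pderiv hf j) i

theorem contDiffOn_det_hessian {f : Plane → ℝ} (hf : ContDiffOn ℝ ∞ f P.interior) :
    ContDiffOn ℝ ∞ (fun ξ => (hessian f ξ).det) P.interior := by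
  simp only [Matrix.det_fin_two]
  exact ((contDiffOn_hessian hf 0 0).mul (contDiffOn_hessian hf 1 1)).sub
    ((contDiffOn_hessian hf 0 1).mul (contDiffOn_hessian hf 1 0))

theorem contDiffOn_inv_det_hessian {f : Plane → ℝ} (hf : ContDiffOn ℝ ∞ f P.interior)
    (hpos : ∀ ξ ∈ P.interior, (hessian f ξ).PosDef) :
    ContDiffOn ℝ ∞ (fun ξ => ((hessian f ξ).det)⁻¹) P.interior :=
  (contDiffOn_det_hessian hf).inv fun ξ hξ => (hpos ξ hξ).det_pos.ne'

end Polygon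

/-! ### Non-degeneracy along the edges -/

/-- A positive function `G` whose inverse satisfies a linear second order differential inequality
as long as `G > 0` cannot reach zero: by Grönwall's inequality `1 / G` stays bounded. -/
theorem pos_of_second_order_inequality {G B₁ B₂ : ℝ → ℝ} {a c M : ℝ} (hac : a ≤ c) (hM : 0 ≤ M)
    (hG : ContinuousOn G (Icc a c)) (h0 : 0 < G a)
    (hd : ∀ s ∈ Icc a c, 0 < G s → HasDerivAt (fun s => (G s)⁻¹) (B₁ s) s ∧
      HasDerivAt B₁ (B₂ s) s ∧ |B₂ s| ≤ M * (1 + |B₁ s| + (G s)⁻¹)) : 0 < G c := by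
  by_contra hcon
  set Z := {s | s ∈ Icc a c ∧ G s ≤ 0} with hZ
  have hZc : IsClosed Z := by
    have := hG.preimage_isClosed_of_isClosed isClosed_Icc (isClosed_Iic (a := (0 : ℝ)))
    exact this
  have hZne : Z.Nonempty := ⟨c, ⟨hac, le_rfl⟩, not_lt.1 hcon⟩
  have hZb : BddBelow Z := ⟨a, fun s hs => hs.1.1⟩
  set T := sInf Z with hT
  have hTZ : T ∈ Z := hZc.csInf_mem hZne hZb
  have haT : a < T := lt_of_le_of_ne hTZ.1.1 fun h => by
    have := hTZ.2
    rw [← h] at this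
    exact absurd h0 (not_lt.2 this)
  have hpos : ∀ s, a ≤ s → s < T → 0 < G s := fun s h1 h2 => by
    by_contra h
    exact absurd (csInf_le hZb (show s ∈ Z from ⟨⟨h1, h2.le.trans hTZ.1.2⟩, not_lt.1 h⟩))
      (not_le.2 h2)
  set f : ℝ → ℝ × ℝ := fun s => ((G s)⁻¹, B₁ s) with hf
  set K := 2 * M + 1 with hK
  have hK0 : 0 ≤ K := by positivity
  have hbound : ∀ y, a ≤ y → y < T → (G y)⁻¹ ≤ gronwallBound ‖f a‖ K M (T - a) := by
    intro y h1 h2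
    have hsub : ∀ s ∈ Icc a y, s ∈ Icc a c ∧ 0 < G s := fun s hs =>
      ⟨⟨hs.1, hs.2.trans (h2.le.trans hTZ.1.2)⟩, hpos s hs.1 (hs.2.trans_lt h2)⟩
    have hder : ∀ s ∈ Icc a y, HasDerivAt f (B₁ s, B₂ s) s := fun s hs => by
      obtain ⟨d1, d2, -⟩ := hd s (hsub s hs).1 (hsub s hs).2
      exact d1.prodMk d2
    have hgr := norm_le_gronwallBound_of_norm_deriv_right_le (f := f)
      (f' := fun s => (B₁ s, B₂ s)) (δ := ‖f a‖) (K := K) (ε := M) (a := a) (b := y)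
      (fun s hs => (hder s hs).continuousAt.continuousWithinAt)
      (fun s hs => (hder s (Ico_subset_Icc_self hs)).hasDerivWithinAt) le_rfl
      (fun s hs => by
        have hs' := Ico_subset_Icc_self hs
        obtain ⟨-, -, d3⟩ := hd s (hsub s hs').1 (hsub s hs').2
        have n1 : (G s)⁻¹ ≤ ‖f s‖ := (le_abs_self _).trans (norm_fst_le (f s))
        have n2 : |B₁ s| ≤ ‖f s‖ := norm_snd_le (f s)
        rw [Prod.norm_def]
        refine max_le ?_ ?_
        · simp only [Real.norm_eq_abs]
          nlinarith [norm_nonneg (f s)]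
        · simp only [Real.norm_eq_abs]
          nlinarith [norm_nonneg (f s), mul_le_mul_of_nonneg_left n1 hM,
            mul_le_mul_of_nonneg_left n2 hM]) y ⟨h1, le_rfl⟩
    have hmono := gronwallBound_mono (norm_nonneg (f a)) hM hK0 (sub_le_sub_right h2.le a)
    exact ((le_abs_self _).trans (norm_fst_le (f y))).trans (hgr.trans hmono)
  set B := gronwallBound ‖f a‖ K M (T - a) with hB
  have hBpos : 0 < B := (inv_pos.2 h0).trans_le (hbound a le_rfl haT)
  have hlow : ∀ y ∈ Ico a T, B⁻¹ ≤ G y := fun y hy =>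
    inv_le_of_inv_le₀ (hpos y hy.1 hy.2) (hbound y hy.1 hy.2)
  have htend : Tendsto G (𝓝[Ico a T] T) (𝓝 (G T)) :=
    (hG T hTZ.1).mono fun s hs => ⟨hs.1, hs.2.le.trans hTZ.1.2⟩
  have hne : (𝓝[Ico a T] T).NeBot := by
    rw [← mem_closure_iff_nhdsWithin_neBot, closure_Ico haT.ne]
    exact ⟨haT.le, le_rfl⟩
  have := ge_of_tendsto htend (eventually_mem_nhdsWithin.mono hlow)
  exact absurd hTZ.2 (not_le.2 ((inv_pos.2 hBpos).trans_le this))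

/-- The pairing of the cofactor matrix with another matrix, in a basis of determinant one. -/
theorem adjugate_pairing (H W : Matrix (Fin 2) (Fin 2) ℝ) (n τ : Plane)
    (hdet : n 0 * τ 1 - n 1 * τ 0 = 1) (h w : Plane → Plane → ℝ)
    (hh : ∀ e e', h e e' = e 0 * e' 0 * H 0 0 + e 0 * e' 1 * H 0 1 + e 1 * e' 0 * H 1 0 +
      e 1 * e' 1 * H 1 1)
    (hw : ∀ e e', w e e' = e 0 * e' 0 * W 0 0 + e 0 * e' 1 * W 0 1 + e 1 * e' 0 * W 1 0 +
      e 1 * e' 1 * W 1 1) :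
    ∑ i, ∑ j, H.adjugate i j * W i j =
      h τ τ * w n n - h n τ * w n τ - h τ n * w τ n + h n n * w τ τ := by
  have key : h τ τ * w n n - h n τ * w n τ - h τ n * w τ n + h n n * w τ τ =
      (∑ i, ∑ j, H.adjugate i j * W i j) * (n 0 * τ 1 - n 1 * τ 0) ^ 2 := by
    simp [hh, hw, Matrix.adjugate_fin_two, Fin.sum_univ_two]
    ring
  rw [key, hdet]; ring

theorem det_eq_of_basis (H : Matrix (Fin 2) (Fin 2) ℝ) (n τ : Plane)
    (hdet : n 0 * τ 1 - n 1 * τ 0 = 1) (h : Plane → Plane → ℝ)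
    (hh : ∀ e e', h e e' = e 0 * e' 0 * H 0 0 + e 0 * e' 1 * H 0 1 + e 1 * e' 0 * H 1 0 +
      e 1 * e' 1 * H 1 1) :
    H.det = h n n * h τ τ - h n τ * h τ n := by
  have key : h n n * h τ τ - h n τ * h τ n = H.det * (n 0 * τ 1 - n 1 * τ 0) ^ 2 := by
    simp [hh, Matrix.det_fin_two]
    ring
  rw [key, hdet]; ring

namespace Polygon

variable {d : ℕ} {P : Polygon d}

/-- The tangent vector of the edge `ℓ_i`: the normal `v_i` rotated by a quarter turn. -/
noncomputable def tangent (P : Polygon d) (i : Fin d) : Plane :=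
  !₂[-(P.normal i 1 : ℝ), (P.normal i 0 : ℝ)]

/-- The normal `v_i` scaled so that `l_i` grows at unit speed along it. -/
noncomputable def unitNormal (P : Polygon d) (i : Fin d) : Plane :=
  !₂[(P.normal i 0 : ℝ) / ((P.normal i 0 : ℝ) ^ 2 + (P.normal i 1 : ℝ) ^ 2),
    (P.normal i 1 : ℝ) / ((P.normal i 0 : ℝ) ^ 2 + (P.normal i 1 : ℝ) ^ 2)]

theorem lin_tangent (i j : Fin d) : P.lin j (P.tangent i) =
    (P.normal i 0 : ℝ) * P.normal j 1 - P.normal i 1 * P.normal j 0 := by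
  simp [lin_apply, tangent]; ring

theorem lin_tangent_self (i : Fin d) : P.lin i (P.tangent i) = 0 := by
  rw [lin_tangent]; ring

theorem IsDelzant.lin_unitNormal (hP : P.IsDelzant) (i : Fin d) :
    P.lin i (P.unitNormal i) = 1 := by
  have := (hP.normSq_pos i).ne'
  simp [lin_apply, unitNormal]
  field_simp

theorem IsDelzant.det_unitNormal_tangent (hP : P.IsDelzant) (i : Fin d) :
    P.unitNormal i 0 * P.tangent i 1 - P.unitNormal i 1 * P.tangent i 0 = 1 := by
  have := (hP.normSq_pos i).ne'
  simp [tangent, unitNormal]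
  field_simp

/-- The Hessian of `u - l_i log l_i` for `u = v + ψ`; it stays smooth across the interior of the
edge `ℓ_i`. -/
noncomputable def restHessian (P : Polygon d) (i : Fin d) (ψ : Plane → ℝ) (e e' : Plane)
    (ξ : Plane) : ℝ :=
  (∑ j ∈ Finset.univ.erase i, P.lin j e * P.lin j e' / P.l j ξ) +
    derivAlong P.closed e (derivAlong P.closed e' ψ) ξ

/-- `l_i det (∂²u)`, written as a function that stays smooth across the interior of `ℓ_i`. -/
noncomputable def edgeDet (P : Polygon d) (i : Fin d) (ψ : Plane → ℝ) (ξ : Plane) : ℝ :=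
  P.restHessian i ψ (P.tangent i) (P.tangent i) ξ + P.l i ξ *
    (P.restHessian i ψ (P.unitNormal i) (P.unitNormal i) ξ *
      P.restHessian i ψ (P.tangent i) (P.tangent i) ξ -
      P.restHessian i ψ (P.unitNormal i) (P.tangent i) ξ *
      P.restHessian i ψ (P.tangent i) (P.unitNormal i) ξ)

/-- The open polygon together with the interior of the edge `ℓ_i`. -/
def withEdge (P : Polygon d) (i : Fin d) : Set Plane := P.interior ∪ P.openEdge i

theorem interior_subset_withEdge (i : Fin d) : P.interior ⊆ P.withEdge i := subset_union_left

theorem withEdge_subset_closed (i : Fin d) : P.withEdge i ⊆ P.closed :=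
  union_subset P.interior_subset_closed fun _ h => h.1.1

theorem IsDelzant.l_pos_of_withEdge (hP : P.IsDelzant) {i j : Fin d} (hj : j ≠ i) {ξ : Plane}
    (hξ : ξ ∈ P.withEdge i) : 0 < P.l j ξ := by
  rcases hξ with h | h
  · exact h j
  · exact (hP.mem_openEdge_iff.1 h).2 j hj

section

variable {ψ : Plane → ℝ} (hP : P.IsDelzant) (hψ : ContDiffOn ℝ ∞ ψ P.closed) (i : Fin d)
include hP hψ

theorem IsDelzant.contDiffOn_restHessian (e e' : Plane) :
    ContDiffOn ℝ ∞ (P.restHessian i ψ e e') (P.withEdge i) := by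
  have hU := uniqueDiffOn_between hP.nonempty P.interior_subset_closed le_rfl
  refine ContDiffOn.add ?_ ((derivAlong_contDiffOn hU (derivAlong_contDiffOn hU hψ e') e).mono
    (withEdge_subset_closed i))
  refine ContDiffOn.sum fun j hj => ?_
  exact contDiffOn_const.div (P.contDiff_l j).contDiffOn fun ξ hξ =>
    (hP.l_pos_of_withEdge (Finset.ne_of_mem_erase hj) hξ).ne'

theorem IsDelzant.contDiffOn_edgeDet : ContDiffOn ℝ ∞ (P.edgeDet i ψ) (P.withEdge i) := by
  have h := hP.contDiffOn_restHessian hψ i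
  exact (h _ _).add ((P.contDiff_l i).contDiffOn.mul (((h _ _).mul (h _ _)).sub
    ((h _ _).mul (h _ _))))

variable {u : Plane → ℝ} (hu : ∀ ξ ∈ P.closed, u ξ = P.guillemin ξ + ψ ξ)
include hu

theorem IsDelzant.secondDeriv_eq_restHessian {ξ : Plane} (hξ : ξ ∈ P.interior) (e e' : Plane) :
    secondDeriv e e' u ξ = P.lin i e * P.lin i e' / P.l i ξ + P.restHessian i ψ e e' ξ := by
  rw [secondDeriv_potential hP.nonempty hψ hu hξ, hessGuillemin, restHessian,
    ← Finset.add_sum_erase _ _ (Finset.mem_univ i)]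
  ring

theorem IsDelzant.edgeDet_eq {ξ : Plane} (hξ : ξ ∈ P.interior) :
    P.edgeDet i ψ ξ = P.l i ξ * (hessian u ξ).det := by
  have hx := (hξ i).ne'
  rw [det_eq_of_basis _ _ _ (hP.det_unitNormal_tangent i) (fun e e' => secondDeriv e e' u ξ)
    (secondDeriv_expand (contDiffAt_potential hψ hu hξ))]
  simp only [hP.secondDeriv_eq_restHessian hψ i hu hξ, lin_tangent_self, hP.lin_unitNormal,
    edgeDet]
  field_simp
  ring

end

/-- The second derivatives of `l_i k`. -/
theorem secondDeriv_l_mul {S : Set Plane} (hne : P.interior.Nonempty) (h1 : P.interior ⊆ S)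
    (h2 : S ⊆ P.closed) (i : Fin d) {k w : Plane → ℝ} (hk : ContDiffOn ℝ ∞ k S)
    (hw : ∀ ξ ∈ P.interior, w ξ = P.l i ξ * k ξ) {ξ : Plane} (hξ : ξ ∈ P.interior)
    (e e' : Plane) : secondDeriv e e' w ξ =
      P.l i ξ * derivAlong S e (derivAlong S e' k) ξ + P.lin i e * derivAlong S e' k ξ +
        P.lin i e' * derivAlong S e k ξ := by
  have hU := uniqueDiffOn_between hne h1 h2
  have hd : ∀ η ∈ P.interior, HasFDerivAt w
      (P.l i η • fderivWithin ℝ k S η + k η • P.lin i) η := fun η hη => by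
    refine ((P.hasFDerivAt_l i η).mul (hasFDerivAt_of_contDiffOn h1 hk hη)).congr_of_eventuallyEq ?_
    filter_upwards [eventually_mem_interior hη] with ζ hζ
    exact hw ζ hζ
  have h3 : HasFDerivAt (fun η => P.l i η * derivAlong S e' k η + k η * P.lin i e')
      (P.l i ξ • fderivWithin ℝ (derivAlong S e' k) S ξ + derivAlong S e' k ξ • P.lin i +
        P.lin i e' • fderivWithin ℝ k S ξ) ξ :=
    ((P.hasFDerivAt_l i ξ).mul
      (hasFDerivAt_of_contDiffOn h1 (derivAlong_contDiffOn hU hk e') hξ)).add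
      ((hasFDerivAt_of_contDiffOn h1 hk hξ).mul_const _)
  rw [secondDeriv_of_eventually (g := fun η => P.l i η * derivAlong S e' k η + k η * P.lin i e')
    ?_ h3 e]
  · simp [derivAlong]; ring
  · filter_upwards [eventually_mem_interior hξ] with η hη
    rw [(hd η hη).fderiv]
    simp [derivAlong]

end Polygon

namespace Polygon

variable {d : ℕ} {P : Polygon d}

/-- The part of `Δ ∪ ℓ_i°` where `l_i det (∂²u)` is positive. -/
def nondegenerate (P : Polygon d) (i : Fin d) (ψ : Plane → ℝ) : Set Plane :=
  {ξ | ξ ∈ P.withEdge i ∧ 0 < P.edgeDet i ψ ξ}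

theorem nondegenerate_subset_closed (i : Fin d) (ψ : Plane → ℝ) :
    P.nondegenerate i ψ ⊆ P.closed := fun _ h => withEdge_subset_closed i h.1

section

variable {ψ : Plane → ℝ} (hP : P.IsDelzant) (hψ : ContDiffOn ℝ ∞ ψ P.closed) (i : Fin d)
  {u : Plane → ℝ} (hu : ∀ ξ ∈ P.closed, u ξ = P.guillemin ξ + ψ ξ)
  (hpos : ∀ ξ ∈ P.interior, (hessian u ξ).PosDef)
include hP hψ

theorem IsDelzant.contDiffOn_inv_edgeDet :
    ContDiffOn ℝ ∞ (fun ξ => (P.edgeDet i ψ ξ)⁻¹) (P.nondegenerate i ψ) :=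
  ((hP.contDiffOn_edgeDet hψ i).mono fun _ h => h.1).inv fun _ h => h.2.ne'

include hu hpos

theorem IsDelzant.interior_subset_nondegenerate : P.interior ⊆ P.nondegenerate i ψ := by
  intro ξ hξ
  refine ⟨interior_subset_withEdge i hξ, ?_⟩
  rw [hP.edgeDet_eq hψ i hu hξ]
  exact mul_pos (hξ i) (hpos ξ hξ).det_pos

/-- With `k = (l_i det (∂²u))⁻¹`, so that `w = l_i k`, the scalar curvature is an expression in
`k` and its derivatives that stays continuous across the interior of `ℓ_i`. -/
theorem IsDelzant.scalarCurvature_eq {ξ : Plane} (hξ : ξ ∈ P.interior) {S : Set Plane}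
    (hS : S = P.nondegenerate i ψ) {n τ : Plane} (hn : n = P.unitNormal i)
    (hτ : τ = P.tangent i) {k : Plane → ℝ} (hk : k = fun ξ => (P.edgeDet i ψ ξ)⁻¹) :
    -scalarCurvature u ξ =
      P.restHessian i ψ τ τ ξ *
        (2 * derivAlong S n k ξ + P.l i ξ * derivAlong S n (derivAlong S n k) ξ) -
      P.restHessian i ψ n τ ξ *
        (derivAlong S τ k ξ + P.l i ξ * derivAlong S n (derivAlong S τ k) ξ) -
      P.restHessian i ψ τ n ξ *
        (derivAlong S τ k ξ + P.l i ξ * derivAlong S τ (derivAlong S n k) ξ) +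
      (1 + P.l i ξ * P.restHessian i ψ n n ξ) * derivAlong S τ (derivAlong S τ k) ξ := by
  subst hS hn hτ hk
  have hx := (hξ i).ne'
  set w : Plane → ℝ := fun η => ((hessian u η).det)⁻¹ with hw
  have hwC : ContDiffAt ℝ 2 w ξ :=
    (contDiffAt_of_interior (contDiffOn_inv_det_hessian (contDiffOn_potential hψ hu) hpos) hξ).of_le
      (WithTop.coe_le_coe.2 (le_top : (2 : ℕ∞) ≤ ⊤))
  have hwk : ∀ η ∈ P.interior, w η = P.l i η * (P.edgeDet i ψ η)⁻¹ := fun η hη => by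
    rw [hP.edgeDet_eq hψ i hu hη, hw]
    have := (hη i).ne'
    field_simp
  have hsd := secondDeriv_l_mul hP.nonempty (hP.interior_subset_nondegenerate hψ i hu hpos)
    (nondegenerate_subset_closed i ψ) i (hP.contDiffOn_inv_edgeDet hψ i) hwk hξ
  rw [scalarCurvature, neg_neg, adjugate_pairing _ (hessian w ξ) _ _ (hP.det_unitNormal_tangent i)
    (fun e e' => secondDeriv e e' u ξ) (fun e e' => secondDeriv e e' w ξ)
    (secondDeriv_expand (contDiffAt_potential hψ hu hξ)) (secondDeriv_expand hwC)]
  simp only [hP.secondDeriv_eq_restHessian hψ i hu hξ, hsd, lin_tangent_self, hP.lin_unitNormal]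
  field_simp
  ring

/-- On the edge itself, bounded scalar curvature becomes a linear second order differential
inequality for `k = (l_i det (∂²u))⁻¹` in the direction of the edge. -/
theorem IsDelzant.edge_inequality {Ko : ℝ}
    (hS : ∀ ξ ∈ P.interior, |scalarCurvature u ξ| ≤ Ko) {S : Set Plane}
    (hSe : S = P.nondegenerate i ψ) {τ : Plane}
    (hτ : τ = P.tangent i) {k : Plane → ℝ} (hk : k = fun ξ => (P.edgeDet i ψ ξ)⁻¹)
    {ξ : Plane} (hξ : ξ ∈ S) (hl : P.l i ξ = 0) :
    |derivAlong S τ (derivAlong S τ k) ξ -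
      (P.restHessian i ψ (P.unitNormal i) τ ξ + P.restHessian i ψ τ (P.unitNormal i) ξ) *
        derivAlong S τ k ξ -
      2 * derivAlong (P.withEdge i) (P.unitNormal i) (P.edgeDet i ψ) ξ * k ξ| ≤ Ko := by
  have hIS : P.interior ⊆ S := hSe ▸ hP.interior_subset_nondegenerate hψ i hu hpos
  have hSW : S ⊆ P.withEdge i := fun η hη => by rw [hSe] at hη; exact hη.1
  have hSC : S ⊆ P.closed := hSW.trans (withEdge_subset_closed i)
  have hU := uniqueDiffOn_between hP.nonempty hIS hSC
  have hkC : ContDiffOn ℝ ∞ k S := by rw [hk, hSe]; exact hP.contDiffOn_inv_edgeDet hψ i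
  set n := P.unitNormal i with hn
  have hd1 : ∀ e, ContinuousOn (derivAlong S e k) S := fun e =>
    (derivAlong_contDiffOn hU hkC e).continuousOn
  have hd2 : ∀ e e', ContinuousOn (derivAlong S e (derivAlong S e' k)) S := fun e e' =>
    (derivAlong_contDiffOn hU (derivAlong_contDiffOn hU hkC e') e).continuousOn
  have hr : ∀ e e', ContinuousOn (P.restHessian i ψ e e') S := fun e e' =>
    (hP.contDiffOn_restHessian hψ i e e').continuousOn.mono hSW
  have hlc : ContinuousOn (P.l i) S := (P.continuous_l i).continuousOn
  have hΦ : ContinuousOn (fun ξ => P.restHessian i ψ τ τ ξ *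
        (2 * derivAlong S n k ξ + P.l i ξ * derivAlong S n (derivAlong S n k) ξ) -
      P.restHessian i ψ n τ ξ *
        (derivAlong S τ k ξ + P.l i ξ * derivAlong S n (derivAlong S τ k) ξ) -
      P.restHessian i ψ τ n ξ *
        (derivAlong S τ k ξ + P.l i ξ * derivAlong S τ (derivAlong S n k) ξ) +
      (1 + P.l i ξ * P.restHessian i ψ n n ξ) * derivAlong S τ (derivAlong S τ k) ξ) S :=
    ((((hr _ _).mul ((continuousOn_const.mul (hd1 n)).add (hlc.mul (hd2 _ _)))).sub
      ((hr _ _).mul ((hd1 τ).add (hlc.mul (hd2 _ _))))).sub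
      ((hr _ _).mul ((hd1 τ).add (hlc.mul (hd2 _ _))))).add
      ((continuousOn_const.add (hlc.mul (hr _ _))).mul (hd2 _ _))
  have htend := ((hΦ ξ hξ).mono hIS).abs
  have hne : (𝓝[P.interior] ξ).NeBot := mem_closure_iff_nhdsWithin_neBot.1 (hSC hξ)
  have hle := le_of_tendsto htend (eventually_mem_nhdsWithin.mono fun η hη => by
    rw [← hP.scalarCurvature_eq hψ i hu hpos hη hSe hn hτ hk, abs_neg]
    exact hS η hη)
  -- the normal derivative of `k` in terms of that of `l_i det (∂²u)`
  have hgpos : 0 < P.edgeDet i ψ ξ := by rw [hSe] at hξ; exact hξ.2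
  have hkn : derivAlong S n k ξ =
      -(derivAlong (P.withEdge i) n (P.edgeDet i ψ) ξ) / (P.edgeDet i ψ ξ) ^ 2 := by
    have h1 : HasFDerivWithinAt (P.edgeDet i ψ)
        (fderivWithin ℝ (P.edgeDet i ψ) (P.withEdge i) ξ) S ξ :=
      (((hP.contDiffOn_edgeDet hψ i).differentiableOn (by simp) ξ
        (hSW hξ)).hasFDerivWithinAt).mono hSW
    have h2 : HasFDerivWithinAt k (-(P.edgeDet i ψ ξ ^ 2)⁻¹ •
        fderivWithin ℝ (P.edgeDet i ψ) (P.withEdge i) ξ) S ξ := by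
      rw [hk]
      exact (hasDerivAt_inv hgpos.ne').comp_hasFDerivWithinAt ξ h1
    rw [derivAlong, h2.fderivWithin (hU ξ hξ)]
    simp [derivAlong]
    field_simp
  have hg : P.restHessian i ψ τ τ ξ = P.edgeDet i ψ ξ := by
    rw [edgeDet, hl, hτ]; ring
  have hkξ : k ξ = (P.edgeDet i ψ ξ)⁻¹ := by rw [hk]
  refine le_trans (le_of_eq ?_) hle
  congr 1
  rw [hl, hkn, hg, hkξ]
  field_simp
  ring

/-- Positivity of `l_i det (∂²u)` propagates along the interior of an edge. -/
theorem IsDelzant.edgeDet_pos_of_le {Ko : ℝ}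
    (hS : ∀ ξ ∈ P.interior, |scalarCurvature u ξ| ≤ Ko) {ξ : Plane} (hξ : ξ ∈ P.openEdge i)
    (hg : 0 < P.edgeDet i ψ ξ) {c : ℝ} (hc : 0 ≤ c)
    (hξc : ξ + c • P.tangent i ∈ P.openEdge i) : 0 < P.edgeDet i ψ (ξ + c • P.tangent i) := by
  set τ := P.tangent i with hτ
  set n := P.unitNormal i with hn
  set S := P.nondegenerate i ψ with hSe
  set k : Plane → ℝ := fun ξ => (P.edgeDet i ψ ξ)⁻¹ with hk
  set γ : ℝ → Plane := fun s => ξ + s • τ with hγ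
  have hIS : P.interior ⊆ S := hP.interior_subset_nondegenerate hψ i hu hpos
  have hSW : S ⊆ P.withEdge i := fun η hη => hη.1
  have hSC : S ⊆ P.closed := hSW.trans (withEdge_subset_closed i)
  have hU := uniqueDiffOn_between hP.nonempty hIS hSC
  have hUW := uniqueDiffOn_between hP.nonempty (interior_subset_withEdge i)
    (withEdge_subset_closed i)
  have hkC : ContDiffOn ℝ ∞ k S := hP.contDiffOn_inv_edgeDet hψ i
  have hγc : Continuous γ := by fun_prop
  have hγe : ∀ s ∈ Icc 0 c, γ s ∈ P.openEdge i := by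
    intro s hs
    rcases hc.eq_or_lt with h0 | h0
    · have : s = 0 := le_antisymm (h0 ▸ hs.2) hs.1
      simpa [hγ, this] using hξ
    · have := hP.convex_openEdge i hξ hξc (a := 1 - s / c) (b := s / c)
        (sub_nonneg.2 ((div_le_one h0).2 hs.2)) (div_nonneg hs.1 hc) (by ring)
      convert this using 1
      rw [hγ]
      ext j
      simp
      field_simp
      ring
  have hmaps : MapsTo γ (Icc 0 c) (P.withEdge i) := fun s hs => Or.inr (hγe s hs)
  have hGc : ContinuousOn (fun s => P.edgeDet i ψ (γ s)) (Icc 0 c) :=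
    (hP.contDiffOn_edgeDet hψ i).continuousOn.comp hγc.continuousOn hmaps
  have hbd : ∀ f : Plane → ℝ, ContinuousOn f (P.withEdge i) →
      ∃ M, 0 ≤ M ∧ ∀ s ∈ Icc 0 c, |f (γ s)| ≤ M := fun f hf => by
    obtain ⟨M, hM⟩ := isCompact_Icc.exists_bound_of_continuousOn
      (hf.comp hγc.continuousOn hmaps)
    exact ⟨M, (abs_nonneg _).trans (hM 0 ⟨le_rfl, hc⟩), hM⟩
  obtain ⟨M₁, h10, h1⟩ := hbd _ (hP.contDiffOn_restHessian hψ i n τ).continuousOn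
  obtain ⟨M₂, h20, h2⟩ := hbd _ (hP.contDiffOn_restHessian hψ i τ n).continuousOn
  obtain ⟨M₃, h30, h3⟩ := hbd _
    (derivAlong_contDiffOn hUW (hP.contDiffOn_edgeDet hψ i) n).continuousOn
  have hKo : 0 ≤ Ko := by
    obtain ⟨p, hp⟩ := hP.nonempty
    exact (abs_nonneg _).trans (hS p hp)
  refine pos_of_second_order_inequality (G := fun s => P.edgeDet i ψ (γ s))
    (B₁ := fun s => derivAlong S τ k (γ s))
    (B₂ := fun s => derivAlong S τ (derivAlong S τ k) (γ s))
    (M := Ko + M₁ + M₂ + 2 * M₃) hc (by positivity) hGc (by simpa [hγ] using hg) ?_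
  intro s hs hgs
  have hsS : γ s ∈ S := ⟨hmaps hs, hgs⟩
  have hl : P.l i (γ s) = 0 := (hP.mem_openEdge_iff.1 (hγe s hs)).1
  have hγd : HasDerivAt γ τ s := by
    have := ((hasDerivAt_id s).smul_const τ).const_add ξ
    rwa [one_smul] at this
  -- near `s` the line stays in the set where the inverse is smooth
  have hev : ∀ᶠ s' in 𝓝 s, γ s' ∈ S := by
    have hW : ∀ᶠ s' in 𝓝 s, γ s' ∈ P.withEdge i := by
      have : ∀ j, ∀ᶠ s' in 𝓝 s, j ≠ i → 0 < P.l j (γ s') := fun j => by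
        by_cases hj : j = i
        · exact Eventually.of_forall fun _ h => absurd hj h
        · have := ((P.continuous_l j).comp hγc).continuousAt.eventually
            (lt_mem_nhds ((hP.mem_openEdge_iff.1 (hγe s hs)).2 j hj))
          exact this.mono fun _ h _ => h
      filter_upwards [eventually_all.2 this] with s' hs'
      refine Or.inr (hP.mem_openEdge_iff.2 ⟨?_, hs'⟩)
      have h0 : P.l i ξ = 0 := (hP.mem_openEdge_iff.1 hξ).1
      simp [hγ, l_add, h0, hτ, lin_tangent_self]
    have hg' : Tendsto (fun s' => P.edgeDet i ψ (γ s')) (𝓝 s) (𝓝 (P.edgeDet i ψ (γ s))) :=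
      ((hP.contDiffOn_edgeDet hψ i).continuousOn (γ s) (hmaps hs)).tendsto.comp
        (tendsto_nhdsWithin_iff.2 ⟨hγc.continuousAt, hW⟩)
    filter_upwards [hW, hg'.eventually (lt_mem_nhds hgs)] with s' a b
    exact ⟨a, b⟩
  have hderiv : ∀ f : Plane → ℝ, ContDiffOn ℝ ∞ f S →
      HasDerivAt (fun s => f (γ s)) (derivAlong S τ f (γ s)) s := fun f hf =>
    ((hf.differentiableOn (by simp) _ hsS).hasFDerivWithinAt).comp_hasDerivAt s hγd hev
  refine ⟨hderiv k hkC, hderiv _ (derivAlong_contDiffOn hU hkC τ), ?_⟩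
  have hineq := hP.edge_inequality hψ i hu hpos hS hSe hτ hk hsS hl
  have b1 := h1 s hs
  have b2 := h2 s hs
  have b3 := h3 s hs
  have hkpos : 0 ≤ k (γ s) := (inv_pos.2 hgs).le
  change _ ≤ (Ko + M₁ + M₂ + 2 * M₃) * (1 + |derivAlong S τ k (γ s)| + k (γ s))
  set B₁ := derivAlong S τ k (γ s)
  set B₂ := derivAlong S τ (derivAlong S τ k) (γ s)
  set q₁ := P.restHessian i ψ n τ (γ s)
  set q₂ := P.restHessian i ψ τ n (γ s)
  set g' := derivAlong (P.withEdge i) n (P.edgeDet i ψ) (γ s)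
  have e1 : B₂ = (B₂ - (q₁ + q₂) * B₁ - 2 * g' * k (γ s)) + ((q₁ + q₂) * B₁ + 2 * g' * k (γ s)) := by
    ring
  have e2 : |(q₁ + q₂) * B₁ + 2 * g' * k (γ s)| ≤ (M₁ + M₂) * |B₁| + 2 * M₃ * k (γ s) := by
    refine (abs_add_le _ _).trans (add_le_add ?_ ?_)
    · rw [abs_mul]
      exact mul_le_mul_of_nonneg_right ((abs_add_le _ _).trans (add_le_add b1 b2)) (abs_nonneg _)
    · rw [abs_mul, abs_mul, abs_two, abs_of_nonneg hkpos]
      exact mul_le_mul_of_nonneg_right (by linarith) hkpos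
  have e3 : |B₂| ≤ Ko + ((M₁ + M₂) * |B₁| + 2 * M₃ * k (γ s)) := by
    rw [e1]
    exact (abs_add_le _ _).trans (add_le_add hineq e2)
  have h0 := abs_nonneg B₁
  nlinarith [mul_nonneg hKo h0, mul_nonneg hKo hkpos, mul_nonneg h10 hkpos, mul_nonneg h20 hkpos,
    mul_nonneg h30 h0]

omit hu hpos in
/-- Following the edge backwards one comes to points where `l_i det (∂²u)` is positive, because
it tends to infinity at the end point of the edge. -/
theorem IsDelzant.exists_edgeDet_pos {ξ : Plane} (hξ : ξ ∈ P.openEdge i) :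
    ∃ c : ℝ, 0 ≤ c ∧ ξ - c • P.tangent i ∈ P.openEdge i ∧
      0 < P.edgeDet i ψ (ξ - c • P.tangent i) := by
  set τ := P.tangent i with hτ
  have hU := uniqueDiffOn_between hP.nonempty P.interior_subset_closed le_rfl
  obtain ⟨M, hM⟩ := hP.isCompact_closed.exists_bound_of_continuousOn
    (derivAlong_contDiffOn hU (derivAlong_contDiffOn hU hψ τ) τ).continuousOn
  obtain ⟨hξ0, hξj⟩ := hP.mem_openEdge_iff.1 hξ
  have hl : ∀ j (s : ℝ), P.l j (ξ - s • τ) = P.l j ξ - s * P.lin j τ := fun j s => by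
    rw [sub_eq_add_neg, l_add]; simp; ring
  set J := Finset.univ.filter fun j => 0 < P.lin j τ with hJ
  have hJi : ∀ j ∈ J, j ≠ i := by
    rintro j hj rfl
    have := (Finset.mem_filter.1 hj).2
    rw [hτ, lin_tangent_self] at this
    exact lt_irrefl _ this
  have hJne : J.Nonempty := by
    by_contra h
    rw [Finset.not_nonempty_iff_eq_empty, Finset.filter_eq_empty_iff] at h
    have hmem : ∀ s : ℝ, 0 ≤ s → ξ - s • τ ∈ P.closed := fun s hs =>
      (mem_closed_iff hP.nonempty).2 fun j => by
        rw [hl]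
        have h1 := hP.l_nonneg hξ.1.1 j
        have h2 := mul_nonneg hs (sub_nonneg.2 (not_lt.1 (h (Finset.mem_univ j))))
        linarith
    have hτ0 : 0 < ‖τ‖ := by
      rw [norm_pos_iff]
      intro h0
      have := hP.det_unitNormal_tangent i
      rw [← hτ, h0] at this
      simp at this
    obtain ⟨B, hB⟩ := hP.isCompact_closed.isBounded.exists_norm_le
    have hs0 : 0 ≤ (B + ‖ξ‖ + 1) / ‖τ‖ := by
      have := (norm_nonneg ξ).trans (hB ξ hξ.1.1)
      positivity
    have h1 := hB _ (hmem _ hs0)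
    have h2 := norm_sub_norm_le (((B + ‖ξ‖ + 1) / ‖τ‖) • τ) ξ
    rw [norm_sub_rev, norm_smul, Real.norm_of_nonneg hs0, div_mul_cancel₀ _ hτ0.ne'] at h2
    linarith
  obtain ⟨m, hmJ, hmin⟩ := J.exists_min_image (fun j => P.l j ξ / P.lin j τ) hJne
  have hcm : 0 < P.lin m τ := (Finset.mem_filter.1 hmJ).2
  have hmi := hJi m hmJ
  set T := P.l m ξ / P.lin m τ with hT
  have hT0 : 0 < T := div_pos (hξj m hmi) hcm
  have hin : ∀ s : ℝ, 0 ≤ s → s < T → ξ - s • τ ∈ P.openEdge i := by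
    intro s hs0 hsT
    refine hP.mem_openEdge_iff.2 ⟨by rw [hl, hξ0, hτ, lin_tangent_self]; ring, fun j hj => ?_⟩
    rw [hl]
    by_cases hjJ : j ∈ J
    · have hcj : 0 < P.lin j τ := (Finset.mem_filter.1 hjJ).2
      have := hsT.trans_le (hmin j hjJ)
      rw [lt_div_iff₀ hcj] at this
      linarith
    · have hcj : P.lin j τ ≤ 0 := not_lt.1 fun h => hjJ (Finset.mem_filter.2 ⟨Finset.mem_univ _, h⟩)
      have h1 := hξj j hj
      have h2 := mul_nonneg hs0 (sub_nonneg.2 hcj)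
      linarith
  -- the distance `δ` to the end point of the edge
  set δ := min T (P.lin m τ / (|M| + 1)) with hδ
  have hM1 : 0 < |M| + 1 := by positivity
  have hδ0 : 0 < δ := lt_min hT0 (div_pos hcm hM1)
  have hmem := hin (T - δ) (sub_nonneg.2 (min_le_left _ _)) (by linarith)
  refine ⟨T - δ, sub_nonneg.2 (min_le_left _ _), hmem, ?_⟩
  set η := ξ - (T - δ) • τ with hη
  have hg : P.edgeDet i ψ η = P.restHessian i ψ τ τ η := by
    rw [edgeDet, (hP.mem_openEdge_iff.1 hmem).1]; ring
  have hlm : P.l m η = P.lin m τ * δ := by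
    rw [hη, hl, hT]; field_simp; ring
  have hterm : P.lin m τ * P.lin m τ / P.l m η ≤
      ∑ j ∈ Finset.univ.erase i, P.lin j τ * P.lin j τ / P.l j η := by
    refine Finset.single_le_sum (f := fun j => P.lin j τ * P.lin j τ / P.l j η) (fun j hj => ?_)
      (Finset.mem_erase.2 ⟨hmi, Finset.mem_univ m⟩)
    exact div_nonneg (mul_self_nonneg _) ((hP.mem_openEdge_iff.1 hmem).2 j
      (Finset.ne_of_mem_erase hj)).le
  have hbig : |M| + 1 ≤ P.lin m τ * P.lin m τ / P.l m η := by
    rw [hlm, mul_div_mul_left _ _ hcm.ne', le_div_iff₀ hδ0]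
    have := min_le_right T (P.lin m τ / (|M| + 1))
    rw [← hδ, le_div_iff₀ hM1] at this
    linarith
  have hψb := (abs_le.1 (hM η hmem.1.1)).1
  rw [hg, restHessian]
  have := le_abs_self M
  linarith

/-- Bounded scalar curvature makes the boundary behaviour along the interior of each edge
non-degenerate, although membership in `C^∞(Δ, v)` only asks for convexity in `Δ`. -/
theorem IsDelzant.edgeDet_pos {Ko : ℝ}
    (hS : ∀ ξ ∈ P.interior, |scalarCurvature u ξ| ≤ Ko) {ξ : Plane} (hξ : ξ ∈ P.openEdge i) :
    0 < P.edgeDet i ψ ξ := by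
  obtain ⟨c, hc, hmem, hg⟩ := hP.exists_edgeDet_pos hψ i hξ
  have := hP.edgeDet_pos_of_le hψ i hu hpos hS hmem hg hc (by simpa using hξ)
  simpa using this

end

end Polygon

namespace Polygon

variable {d : ℕ} {P : Polygon d}

/-! ### The determinant of the Hessian up to the boundary -/

section

variable {ψ : Plane → ℝ} (hP : P.IsDelzant) (hψ : ContDiffOn ℝ ∞ ψ P.closed)
  {u : Plane → ℝ} (hu : ∀ ξ ∈ P.closed, u ξ = P.guillemin ξ + ψ ξ)
include hP hψ hu

/-- At a vertex, `l_i l_j det (∂²u)` tends to the square of the determinant of the two normals. -/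
theorem IsDelzant.tendsto_det_vertex {i j : Fin d} (hij : i ≠ j) {ξ₀ : Plane}
    (hξ₀ : ξ₀ ∈ P.closed) (hi : P.l i ξ₀ = 0) (hj : P.l j ξ₀ = 0) :
    Tendsto (fun ξ => P.l i ξ * P.l j ξ * (hessian u ξ).det) (𝓝[P.interior] ξ₀)
      (𝓝 (((P.normal i 0 : ℝ) * P.normal j 1 - P.normal i 1 * P.normal j 0) ^ 2)) := by
  have hU := uniqueDiffOn_between hP.nonempty P.interior_subset_closed le_rfl
  set e : Fin 2 → Plane := fun a => EuclideanSpace.single a 1 with he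
  set B : Fin 2 → Fin 2 → Plane → ℝ := fun a b ξ =>
    (∑ m ∈ (Finset.univ.erase i).erase j, P.lin m (e a) * P.lin m (e b) / P.l m ξ) +
      derivAlong P.closed (e a) (derivAlong P.closed (e b) ψ) ξ with hB
  have hothers : ∀ m ∈ (Finset.univ.erase i).erase j, P.l m ξ₀ ≠ 0 := by
    intro m hm h0
    have h1 := Finset.ne_of_mem_erase hm
    have h2 := Finset.ne_of_mem_erase (Finset.mem_of_mem_erase hm)
    exact hP.not_three_active hij h2.symm h1.symm hξ₀ hi hj h0
  have hBt : ∀ a b, Tendsto (B a b) (𝓝[P.interior] ξ₀) (𝓝 (B a b ξ₀)) := fun a b => by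
    refine Tendsto.add ?_ ((((derivAlong_contDiffOn hU (derivAlong_contDiffOn hU hψ (e b))
      (e a)).continuousOn ξ₀ hξ₀).mono P.interior_subset_closed))
    refine tendsto_finsetSum _ fun m hm => ?_
    exact (tendsto_const_nhds.div ((P.continuous_l m).tendsto ξ₀) (hothers m hm)).mono_left
      nhdsWithin_le_nhds
  have hlt : ∀ m, Tendsto (P.l m) (𝓝[P.interior] ξ₀) (𝓝 (P.l m ξ₀)) := fun m =>
    ((P.continuous_l m).tendsto ξ₀).mono_left nhdsWithin_le_nhds
  set x : Plane → ℝ := P.l i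
  set y : Plane → ℝ := P.l j
  set a₀ := (P.normal i 0 : ℝ)
  set a₁ := (P.normal i 1 : ℝ)
  set b₀ := (P.normal j 0 : ℝ)
  set b₁ := (P.normal j 1 : ℝ)
  have hlim : Tendsto (fun ξ => (a₀ * b₁ - a₁ * b₀) ^ 2 +
      y ξ * (a₀ * a₀ * B 1 1 ξ + a₁ * a₁ * B 0 0 ξ - a₀ * a₁ * (B 0 1 ξ + B 1 0 ξ)) +
      x ξ * (b₀ * b₀ * B 1 1 ξ + b₁ * b₁ * B 0 0 ξ - b₀ * b₁ * (B 0 1 ξ + B 1 0 ξ)) +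
      x ξ * y ξ * (B 0 0 ξ * B 1 1 ξ - B 0 1 ξ * B 1 0 ξ)) (𝓝[P.interior] ξ₀)
      (𝓝 ((a₀ * b₁ - a₁ * b₀) ^ 2 +
      y ξ₀ * (a₀ * a₀ * B 1 1 ξ₀ + a₁ * a₁ * B 0 0 ξ₀ - a₀ * a₁ * (B 0 1 ξ₀ + B 1 0 ξ₀)) +
      x ξ₀ * (b₀ * b₀ * B 1 1 ξ₀ + b₁ * b₁ * B 0 0 ξ₀ - b₀ * b₁ * (B 0 1 ξ₀ + B 1 0 ξ₀)) +
      x ξ₀ * y ξ₀ * (B 0 0 ξ₀ * B 1 1 ξ₀ - B 0 1 ξ₀ * B 1 0 ξ₀))) := by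
    have hc : ∀ r : ℝ, Tendsto (fun _ : Plane => r) (𝓝[P.interior] ξ₀) (𝓝 r) :=
      fun r => tendsto_const_nhds
    refine (((hc _).add ((hlt j).mul ((((hc _).mul (hBt 1 1)).add ((hc _).mul (hBt 0 0))).sub
      ((hc _).mul ((hBt 0 1).add (hBt 1 0)))))).add ((hlt i).mul ((((hc _).mul (hBt 1 1)).add
      ((hc _).mul (hBt 0 0))).sub ((hc _).mul ((hBt 0 1).add (hBt 1 0)))))).add
      (((hlt i).mul (hlt j)).mul (((hBt 0 0).mul (hBt 1 1)).sub ((hBt 0 1).mul (hBt 1 0))))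
  have hx0 : x ξ₀ = 0 := hi
  have hy0 : y ξ₀ = 0 := hj
  rw [hx0, hy0] at hlim
  have hval : ∀ z₁ z₂ z₃ z₄ : ℝ, z₁ + 0 * z₂ + 0 * z₃ + 0 * 0 * z₄ = z₁ := fun _ _ _ _ => by ring
  rw [hval] at hlim
  refine hlim.congr' (eventually_mem_nhdsWithin.mono fun ξ hξ => ?_)
  have hxp : x ξ ≠ 0 := (hξ i).ne'
  have hyp : y ξ ≠ 0 := (hξ j).ne'
  have hH : ∀ a b, hessian u ξ a b = P.lin i (e a) * P.lin i (e b) / x ξ +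
      P.lin j (e a) * P.lin j (e b) / y ξ + B a b ξ := fun a b => by
    rw [hessian_apply, hP.secondDeriv_eq_restHessian hψ i hu hξ, restHessian,
      ← Finset.add_sum_erase _ _ (Finset.mem_erase.2 ⟨hij.symm, Finset.mem_univ j⟩)]
    simp only [hB]
    ring
  have l0 : P.lin i (e 0) = a₀ := by simp [lin_apply, he, a₀]
  have l1 : P.lin i (e 1) = a₁ := by simp [lin_apply, he, a₁]
  have m0 : P.lin j (e 0) = b₀ := by simp [lin_apply, he, b₀]
  have m1 : P.lin j (e 1) = b₁ := by simp [lin_apply, he, b₁]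
  simp only [Matrix.det_fin_two, hH, l0, l1, m0, m1]
  field_simp
  ring

variable (hpos : ∀ ξ ∈ P.interior, (hessian u ξ).PosDef)
include hpos

/-- `det (∂²u) ∏ l_i` is bounded below by a positive constant. -/
theorem IsDelzant.exists_le_det_mul_prod {Ko : ℝ}
    (hS : ∀ ξ ∈ P.interior, |scalarCurvature u ξ| ≤ Ko) :
    ∃ c : ℝ, 0 < c ∧ ∀ ξ ∈ P.interior, c ≤ (hessian u ξ).det * ∏ i, P.l i ξ := by
  set m : Plane → ℝ := fun ξ => (hessian u ξ).det * ∏ i, P.l i ξ with hm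
  have hloc : ∀ ξ₀ ∈ P.closed, ∃ L, 0 < L ∧ Tendsto m (𝓝[P.interior] ξ₀) (𝓝 L) := by
    intro ξ₀ hξ₀
    have hlt : ∀ s : Finset (Fin d), Tendsto (fun ξ => ∏ i ∈ s, P.l i ξ) (𝓝[P.interior] ξ₀)
        (𝓝 (∏ i ∈ s, P.l i ξ₀)) := fun s =>
      (tendsto_finsetProd _ fun i _ => (P.continuous_l i).tendsto ξ₀).mono_left nhdsWithin_le_nhds
    by_cases h0 : ∀ i, 0 < P.l i ξ₀
    · refine ⟨m ξ₀, mul_pos (hpos ξ₀ h0).det_pos (Finset.prod_pos fun i _ => h0 i), ?_⟩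
      exact ((contDiffOn_det_hessian (contDiffOn_potential hψ hu)).continuousOn ξ₀ h0).mul (hlt _)
    push Not at h0
    obtain ⟨i, hi'⟩ := h0
    have hi : P.l i ξ₀ = 0 := le_antisymm hi' (hP.l_nonneg hξ₀ i)
    by_cases h1 : ∀ j, j ≠ i → 0 < P.l j ξ₀
    · have hmem : ξ₀ ∈ P.openEdge i := hP.mem_openEdge_iff.2 ⟨hi, h1⟩
      refine ⟨P.edgeDet i ψ ξ₀ * ∏ j ∈ Finset.univ.erase i, P.l j ξ₀,
        mul_pos (hP.edgeDet_pos hψ i hu hpos hS hmem)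
          (Finset.prod_pos fun j hj => h1 j (Finset.ne_of_mem_erase hj)), ?_⟩
      have ht := (((hP.contDiffOn_edgeDet hψ i).continuousOn ξ₀ (Or.inr hmem)).mono
        (interior_subset_withEdge i)).tendsto
      refine (ht.mul (hlt (Finset.univ.erase i))).congr'
        (eventually_mem_nhdsWithin.mono fun ξ hξ => ?_)
      simp only [hm]
      rw [hP.edgeDet_eq hψ i hu hξ, ← Finset.mul_prod_erase _ _ (Finset.mem_univ i)]
      ring
    push Not at h1
    obtain ⟨j, hji, hj'⟩ := h1
    have hj : P.l j ξ₀ = 0 := le_antisymm hj' (hP.l_nonneg hξ₀ j)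
    refine ⟨((P.normal i 0 : ℝ) * P.normal j 1 - P.normal i 1 * P.normal j 0) ^ 2 *
      ∏ k ∈ (Finset.univ.erase i).erase j, P.l k ξ₀, mul_pos
      (hP.det_sq_pos hji.symm hξ₀ hi hj) (Finset.prod_pos fun k hk => ?_), ?_⟩
    · refine lt_of_le_of_ne (hP.l_nonneg hξ₀ k) fun h => ?_
      exact hP.not_three_active hji.symm (Finset.ne_of_mem_erase (Finset.mem_of_mem_erase hk)).symm
        (Finset.ne_of_mem_erase hk).symm hξ₀ hi hj h.symm
    · refine ((hP.tendsto_det_vertex hψ hu hji.symm hξ₀ hi hj).mul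
        (hlt ((Finset.univ.erase i).erase j))).congr fun ξ => ?_
      simp only [hm]
      rw [← Finset.mul_prod_erase _ _ (Finset.mem_univ i),
        ← Finset.mul_prod_erase _ _ (Finset.mem_erase.2 ⟨hji, Finset.mem_univ j⟩)]
      ring
  have key : ∃ c : ℝ, 0 < c ∧ ∀ ξ ∈ P.closed, ξ ∈ P.interior → c ≤ m ξ := by
    refine hP.isCompact_closed.induction_on
      (p := fun s => ∃ c : ℝ, 0 < c ∧ ∀ ξ ∈ s, ξ ∈ P.interior → c ≤ m ξ)
      ⟨1, one_pos, fun ξ h => absurd h (notMem_empty ξ)⟩ ?_ ?_ ?_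
    · rintro s t hst ⟨c, hc, h⟩
      exact ⟨c, hc, fun ξ hξ => h ξ (hst hξ)⟩
    · rintro s t ⟨c, hc, h⟩ ⟨c', hc', h'⟩
      refine ⟨min c c', lt_min hc hc', fun ξ hξ hξI => ?_⟩
      rcases hξ with hξ | hξ
      · exact (min_le_left _ _).trans (h ξ hξ hξI)
      · exact (min_le_right _ _).trans (h' ξ hξ hξI)
    · intro ξ₀ hξ₀
      obtain ⟨L, hL, ht⟩ := hloc ξ₀ hξ₀
      have := ht.eventually (lt_mem_nhds (half_lt_self hL))
      rw [eventually_nhdsWithin_iff] at this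
      refine ⟨_, mem_nhdsWithin_of_mem_nhds this, L / 2, half_pos hL, fun ξ hξ hξI => ?_⟩
      exact (hξ hξI).le
  obtain ⟨c, hc, h⟩ := key
  exact ⟨c, hc, fun ξ hξ => h ξ (P.interior_subset_closed hξ) hξ⟩

end

end Polygon

/-! ### The inverse Hessian as a quadratic form -/

/-- The bilinear form of the inverse of `H` on covectors. -/
noncomputable def cometric (H : Matrix (Fin 2) (Fin 2) ℝ) (x y : Fin 2 → ℝ) : ℝ :=
  (H.det)⁻¹ * (H 1 1 * (x 0 * y 0) - H 0 1 * (x 0 * y 1) - H 1 0 * (x 1 * y 0) +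
    H 0 0 * (x 1 * y 1))

/-- The differential of `f` as a covector. -/
noncomputable def grad (f : Plane → ℝ) (ξ : Plane) : Fin 2 → ℝ := fun a => pderiv a f ξ

section

variable {H : Matrix (Fin 2) (Fin 2) ℝ}

theorem _root_.Matrix.PosDef.offDiag_eq (hH : H.PosDef) : H 1 0 = H 0 1 := by
  have := hH.isHermitian.apply 0 1
  simpa using this

theorem cometric_add_right (x y z : Fin 2 → ℝ) :
    cometric H x (y + z) = cometric H x y + cometric H x z := by
  simp [cometric]; ring

theorem cometric_smul_right (x y : Fin 2 → ℝ) (c : ℝ) :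
    cometric H x (c • y) = c * cometric H x y := by
  simp [cometric]; ring

theorem cometric_sum_right {ι : Type*} (s : Finset ι) (x : Fin 2 → ℝ) (y : ι → Fin 2 → ℝ) :
    cometric H x (∑ i ∈ s, y i) = ∑ i ∈ s, cometric H x (y i) := by
  classical
  induction s using Finset.induction_on with
  | empty => simp [cometric]
  | insert a s ha ih => rw [Finset.sum_insert ha, Finset.sum_insert ha, cometric_add_right, ih]

variable (hH : H.PosDef)
include hH

theorem cometric_comm (x y : Fin 2 → ℝ) : cometric H x y = cometric H y x := by
  rw [cometric, cometric, hH.offDiag_eq]; ring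

/-- The inequality `⟨v, n⟩² ≤ H⁻¹(v, v) H(n, n)`. -/
theorem sq_pairing_le_cometric (v n : Fin 2 → ℝ) :
    (v 0 * n 0 + v 1 * n 1) ^ 2 ≤ cometric H v v *
      (n 0 * n 0 * H 0 0 + n 0 * n 1 * H 0 1 + n 1 * n 0 * H 1 0 + n 1 * n 1 * H 1 1) := by
  have hd := hH.det_pos
  have h := hH.offDiag_eq
  rw [cometric, ← sub_nonneg]
  have key : H.det⁻¹ * (H 1 1 * (v 0 * v 0) - H 0 1 * (v 0 * v 1) - H 1 0 * (v 1 * v 0) +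
      H 0 0 * (v 1 * v 1)) * (n 0 * n 0 * H 0 0 + n 0 * n 1 * H 0 1 + n 1 * n 0 * H 1 0 +
        n 1 * n 1 * H 1 1) - (v 0 * n 0 + v 1 * n 1) ^ 2 =
      H.det⁻¹ * (-v 1 * n 0 * H 0 0 - v 1 * n 1 * H 0 1 + v 0 * n 0 * H 0 1 +
        v 0 * n 1 * H 1 1) ^ 2 := by
    have hd' : H.det ≠ 0 := hd.ne'
    field_simp
    rw [Matrix.det_fin_two, h]
    ring
  rw [key]
  positivity

theorem cometric_self_nonneg (x : Fin 2 → ℝ) : 0 ≤ cometric H x x := by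
  have h0 : 0 < H 0 0 := hH.diag_pos
  have h := sq_pairing_le_cometric hH x (fun a => if a = 0 then 1 else 0)
  simp at h
  by_contra hcon
  nlinarith [mul_neg_of_neg_of_pos (not_le.1 hcon) h0, sq_nonneg (x 0)]

theorem cometric_sq_le (x y : Fin 2 → ℝ) :
    cometric H x y ^ 2 ≤ cometric H x x * cometric H y y := by
  have hd := hH.det_pos
  have h := hH.offDiag_eq
  rw [← sub_nonneg]
  have key : cometric H x x * cometric H y y - cometric H x y ^ 2 =
      H.det⁻¹ * (x 0 * y 1 - x 1 * y 0) ^ 2 := by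
    have hd' : H.det ≠ 0 := hd.ne'
    simp only [cometric, h]
    field_simp
    rw [Matrix.det_fin_two, h]
    ring
  rw [key]
  positivity

theorem abs_cometric_le {x y : Fin 2 → ℝ} {X Y : ℝ} (hx : cometric H x x ≤ X)
    (hy : cometric H y y ≤ Y) : |cometric H x y| ≤ √X * √Y := by
  have hX := (cometric_self_nonneg hH x).trans hx
  rw [← Real.sqrt_mul hX]
  refine Real.abs_le_sqrt ((cometric_sq_le hH x y).trans ?_)
  exact mul_le_mul hx hy (cometric_self_nonneg hH y) hX

theorem cometric_self_le_trace (x : Fin 2 → ℝ) :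
    cometric H x x ≤ (H.det)⁻¹ * (H 0 0 + H 1 1) * (x 0 ^ 2 + x 1 ^ 2) := by
  have hd := hH.det_pos
  have h := hH.offDiag_eq
  have h0 : 0 < H 0 0 := hH.diag_pos
  have h1 : 0 < H 1 1 := hH.diag_pos
  have hdet : 0 < H 0 0 * H 1 1 - H 0 1 * H 0 1 := by
    rw [Matrix.det_fin_two, h] at hd
    exact hd
  rw [cometric, mul_assoc]
  refine mul_le_mul_of_nonneg_left ?_ (inv_pos.2 hd).le
  rw [h, ← sub_nonneg]
  have key : (H 0 0 + H 1 1) * (x 0 ^ 2 + x 1 ^ 2) - (H 1 1 * (x 0 * x 0) - H 0 1 * (x 0 * x 1) -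
      H 0 1 * (x 1 * x 0) + H 0 0 * (x 1 * x 1)) =
      H 0 0 * x 0 ^ 2 + 2 * H 0 1 * x 0 * x 1 + H 1 1 * x 1 ^ 2 := by ring
  rw [key]
  have : 0 ≤ H 0 0 * (H 0 0 * x 0 ^ 2 + 2 * H 0 1 * x 0 * x 1 + H 1 1 * x 1 ^ 2) := by
    have e : H 0 0 * (H 0 0 * x 0 ^ 2 + 2 * H 0 1 * x 0 * x 1 + H 1 1 * x 1 ^ 2) =
      (H 0 0 * x 0 + H 0 1 * x 1) ^ 2 + (H 0 0 * H 1 1 - H 0 1 * H 0 1) * x 1 ^ 2 := by ring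
    rw [e]; positivity
  exact nonneg_of_mul_nonneg_right this h0

end

namespace Polygon

variable {d : ℕ} {P : Polygon d}

/-- The normal `v_i` as a real covector. -/
def covec (P : Polygon d) (i : Fin d) : Fin 2 → ℝ := fun a => P.normal i a

/-- The product `∏ l_i`, a defining function of the boundary. -/
noncomputable def prodL (P : Polygon d) (ξ : Plane) : ℝ := ∏ i, P.l i ξ

theorem prodL_pos {ξ : Plane} (hξ : ξ ∈ P.interior) : 0 < P.prodL ξ :=
  Finset.prod_pos fun i _ => hξ i

theorem prod_l_le {B : ℝ} (hB1 : 1 ≤ B) {ξ : Plane} (h0 : ∀ i, 0 ≤ P.l i ξ)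
    (hB : ∀ i, P.l i ξ ≤ B) (s : Finset (Fin d)) : ∏ i ∈ s, P.l i ξ ≤ B ^ d := by
  have h1 : ∏ i ∈ s, P.l i ξ ≤ ∏ _i ∈ s, B := Finset.prod_le_prod (fun i _ => h0 i) fun i _ => hB i
  rw [Finset.prod_const] at h1
  refine h1.trans (pow_le_pow_right₀ hB1 ?_)
  simpa using Finset.card_le_univ s

/-- The matrix entries of `∂²u` are sums `∑ c_j² / l_j + D` with `D` bounded; multiplied by `∏ l_i`
they are controlled by the products `∏ l_i / l_j`. -/
theorem prodL_mul_le {ξ : Plane} (hξ : ξ ∈ P.interior) (s : Finset (Fin d)) (c : Fin d → ℝ)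
    {M X D : ℝ} (hD : |D| ≤ M) (h1 : P.prodL ξ ≤ X) (h2 : ∀ j ∈ s, P.prodL ξ / P.l j ξ ≤ X) :
    P.prodL ξ * (∑ j ∈ s, c j * c j / P.l j ξ + D) ≤ (∑ j ∈ s, c j * c j + M) * X := by
  rw [mul_add, add_mul, Finset.mul_sum, Finset.sum_mul]
  refine add_le_add (Finset.sum_le_sum fun j hj => ?_) ?_
  · rw [mul_div_left_comm]
    exact mul_le_mul_of_nonneg_left (h2 j hj) (mul_self_nonneg _)
  · have hp := (prodL_pos hξ).le
    have hM := (abs_nonneg D).trans hD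
    rw [mul_comm M]
    exact (mul_le_mul_of_nonneg_left ((le_abs_self _).trans hD) hp).trans
      (mul_le_mul_of_nonneg_right h1 hM)

/-- Bounds for `∏ l_i` and for the product with one factor omitted: each factor left in the product
gives first order vanishing on its edge. -/
theorem IsDelzant.exists_prodL_le (hP : P.IsDelzant) : ∃ B : ℝ, 1 ≤ B ∧
    (∀ i, ∀ ξ ∈ P.closed, P.l i ξ ≤ B) ∧
    (∀ ξ ∈ P.interior, P.prodL ξ ≤ B) ∧ (∀ i, ∀ ξ ∈ P.interior, P.prodL ξ ≤ B * P.l i ξ) ∧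
    (∀ i, ∀ ξ ∈ P.interior, P.prodL ξ / P.l i ξ ≤ B) ∧
    ∀ i j, j ≠ i → ∀ ξ ∈ P.interior, P.prodL ξ / P.l j ξ ≤ B * P.l i ξ := by
  obtain ⟨B, hB1, hB⟩ := hP.exists_l_le
  have hBd : 1 ≤ B ^ d := one_le_pow₀ hB1
  have hle : ∀ ξ ∈ P.interior, ∀ s : Finset (Fin d), ∏ i ∈ s, P.l i ξ ≤ B ^ d := fun ξ hξ s =>
    prod_l_le hB1 (fun i => (hξ i).le) (fun i => hB i ξ (P.interior_subset_closed hξ)) s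
  have hBB : B ^ d ≤ max B (B ^ d) := le_max_right _ _
  refine ⟨max B (B ^ d), hB1.trans (le_max_left _ _),
    fun i ξ hξ => (hB i ξ hξ).trans (le_max_left _ _), fun ξ hξ => (hle ξ hξ _).trans hBB,
    fun i ξ hξ => ?_, fun i ξ hξ => ?_, fun i j hji ξ hξ => ?_⟩
  · rw [prodL, ← Finset.mul_prod_erase _ _ (Finset.mem_univ i), mul_comm]
    exact mul_le_mul_of_nonneg_right ((hle ξ hξ _).trans hBB) (hξ i).le
  · rw [prodL, ← Finset.mul_prod_erase _ _ (Finset.mem_univ i), mul_div_cancel_left₀ _ (hξ i).ne']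
    exact (hle ξ hξ _).trans hBB
  · rw [prodL, ← Finset.mul_prod_erase _ _ (Finset.mem_univ j), mul_div_cancel_left₀ _ (hξ j).ne',
      ← Finset.mul_prod_erase _ _ (Finset.mem_erase.2 ⟨hji.symm, Finset.mem_univ i⟩), mul_comm]
    exact mul_le_mul_of_nonneg_right ((hle ξ hξ _).trans hBB) (hξ i).le

section

variable {ψ : Plane → ℝ} (hP : P.IsDelzant) (hψ : ContDiffOn ℝ ∞ ψ P.closed)
  {u : Plane → ℝ} (hu : ∀ ξ ∈ P.closed, u ξ = P.guillemin ξ + ψ ξ)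
include hP hψ

theorem IsDelzant.exists_bound_derivAlong (e : Plane) :
    ∃ M, 0 ≤ M ∧ ∀ ξ ∈ P.closed, |derivAlong P.closed e ψ ξ| ≤ M := by
  have hU := uniqueDiffOn_between hP.nonempty P.interior_subset_closed le_rfl
  obtain ⟨M, hM⟩ := hP.isCompact_closed.exists_bound_of_continuousOn
    (derivAlong_contDiffOn hU hψ e).continuousOn
  exact ⟨|M|, abs_nonneg _, fun ξ hξ => (hM ξ hξ).trans (le_abs_self M)⟩

theorem IsDelzant.exists_bound_derivAlong₂ (e e' : Plane) :
    ∃ M, 0 ≤ M ∧ ∀ ξ ∈ P.closed, |derivAlong P.closed e (derivAlong P.closed e' ψ) ξ| ≤ M :=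
  hP.exists_bound_derivAlong (derivAlong_contDiffOn
    (uniqueDiffOn_between hP.nonempty P.interior_subset_closed le_rfl) hψ e') e

include hu

omit hP in
theorem grad_potential {ξ : Plane} (hξ : ξ ∈ P.interior) : grad u ξ =
    (∑ i, (Real.log (P.l i ξ) + 1) • P.covec i) +
      fun a => derivAlong P.closed (EuclideanSpace.single a 1) ψ ξ := by
  funext a
  rw [grad, pderiv, (hasFDerivAt_potential hψ hu hξ).fderiv]
  simp only [add_apply, Pi.add_apply, Finset.sum_apply]
  congr 1
  rw [sum_apply]
  refine Finset.sum_congr rfl fun i _ => ?_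
  fin_cases a <;> simp [lin_apply, covec]

variable (hpos : ∀ ξ ∈ P.interior, (hessian u ξ).PosDef)
include hpos

/-- The inverse Hessian is bounded, and vanishes to first order in the normal directions at the
boundary. -/
theorem IsDelzant.exists_cometric_le {Ko : ℝ}
    (hS : ∀ ξ ∈ P.interior, |scalarCurvature u ξ| ≤ Ko) :
    ∃ C : ℝ, 0 < C ∧ ∀ ξ ∈ P.interior,
      (∀ i, cometric (hessian u ξ) (P.covec i) (P.covec i) ≤ C * P.l i ξ) ∧
      ((hessian u ξ).det)⁻¹ * (hessian u ξ 0 0 + hessian u ξ 1 1) ≤ C := by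
  obtain ⟨c, hc, hdet⟩ := hP.exists_le_det_mul_prod hψ hu hpos hS
  obtain ⟨B, hB1, -, hb1, hb2, hb3, hb4⟩ := hP.exists_prodL_le
  have hB0 : 0 < B := one_pos.trans_le hB1
  have hw : ∀ ξ ∈ P.interior, ((hessian u ξ).det)⁻¹ ≤ c⁻¹ * P.prodL ξ := fun ξ hξ => by
    have h := hdet ξ hξ
    have hd := (hpos ξ hξ).det_pos
    rw [← div_eq_inv_mul, le_div_iff₀ hc, inv_mul_le_iff₀ hd]
    exact h
  have hdiag : ∀ a : Fin 2, ∃ C, 0 ≤ C ∧ ∀ ξ ∈ P.interior,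
      P.prodL ξ * hessian u ξ a a ≤ C := fun a => by
    set e : Plane := EuclideanSpace.single a 1 with he
    obtain ⟨M, hM0, hM⟩ := hP.exists_bound_derivAlong₂ hψ e e
    refine ⟨(∑ i, P.lin i e * P.lin i e + M) * (B * 1), mul_nonneg (add_nonneg
      (Finset.sum_nonneg fun i _ => mul_self_nonneg _) hM0) (by positivity), fun ξ hξ => ?_⟩
    rw [hessian_apply, secondDeriv_potential hP.nonempty hψ hu hξ]
    exact prodL_mul_le hξ _ _ (hM ξ (P.interior_subset_closed hξ)) (by simpa using hb1 ξ hξ)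
      fun i _ => by simpa using hb3 i ξ hξ
  have hnormal : ∀ i : Fin d, ∃ C, 0 ≤ C ∧ ∀ ξ ∈ P.interior,
      P.prodL ξ * secondDeriv (P.tangent i) (P.tangent i) u ξ ≤ C * P.l i ξ := fun i => by
    set e := P.tangent i with he
    obtain ⟨M, hM0, hM⟩ := hP.exists_bound_derivAlong₂ hψ e e
    refine ⟨(∑ j ∈ Finset.univ.erase i, P.lin j e * P.lin j e + M) * B, mul_nonneg (add_nonneg
      (Finset.sum_nonneg fun i _ => mul_self_nonneg _) hM0) hB0.le, fun ξ hξ => ?_⟩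
    rw [hP.secondDeriv_eq_restHessian hψ i hu hξ, he, lin_tangent_self, zero_mul, zero_div,
      zero_add, mul_assoc]
    exact prodL_mul_le hξ _ _ (hM ξ (P.interior_subset_closed hξ)) (hb2 i ξ hξ)
      fun j hj => hb4 i j (Finset.ne_of_mem_erase hj) ξ hξ
  choose C₁ hC₁0 hC₁ using hdiag
  choose C₂ hC₂0 hC₂ using hnormal
  have hsum0 : 0 ≤ ∑ i, C₂ i := Finset.sum_nonneg fun i _ => hC₂0 i
  have hC0 : C₁ 0 + C₁ 1 ≤ C₁ 0 + C₁ 1 + ∑ i, C₂ i + 1 := by linarith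
  have h10 := hC₁0 0
  have h11 := hC₁0 1
  refine ⟨c⁻¹ * (C₁ 0 + C₁ 1 + ∑ i, C₂ i + 1), by positivity, fun ξ hξ => ⟨fun i => ?_, ?_⟩⟩
  · have e1 : cometric (hessian u ξ) (P.covec i) (P.covec i) =
        ((hessian u ξ).det)⁻¹ * secondDeriv (P.tangent i) (P.tangent i) u ξ := by
      rw [secondDeriv_expand (contDiffAt_potential hψ hu hξ), cometric]
      simp [tangent, covec]
      left; ring
    have hd := inv_pos.2 (hpos ξ hξ).det_pos
    have hnn : 0 ≤ secondDeriv (P.tangent i) (P.tangent i) u ξ := by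
      have := cometric_self_nonneg (hpos ξ hξ) (P.covec i)
      rw [e1] at this
      exact nonneg_of_mul_nonneg_right this hd
    rw [e1]
    refine (mul_le_mul_of_nonneg_right (hw ξ hξ) hnn).trans ?_
    rw [mul_assoc, mul_assoc]
    refine mul_le_mul_of_nonneg_left ((hC₂ i ξ hξ).trans ?_) (inv_pos.2 hc).le
    refine mul_le_mul_of_nonneg_right ?_ (hξ i).le
    have := Finset.single_le_sum (f := C₂) (fun i _ => hC₂0 i) (Finset.mem_univ i)
    linarith
  · have h0 : 0 < hessian u ξ 0 0 := (hpos ξ hξ).diag_pos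
    have h1 : 0 < hessian u ξ 1 1 := (hpos ξ hξ).diag_pos
    refine (mul_le_mul_of_nonneg_right (hw ξ hξ) (by positivity)).trans ?_
    rw [mul_assoc]
    refine mul_le_mul_of_nonneg_left ?_ (inv_pos.2 hc).le
    have := hC₁ 0 ξ hξ
    have := hC₁ 1 ξ hξ
    rw [mul_add]
    linarith

/-- The inverse Hessian pairs the differential of `u - f` with the normal `v_i` to a function that
is `O(√l_i)`, although `∂u` is logarithmically unbounded. -/
theorem IsDelzant.exists_abs_cometric_grad_le {Ko : ℝ}
    (hS : ∀ ξ ∈ P.interior, |scalarCurvature u ξ| ≤ Ko) {ζ : Plane → Fin 2 → ℝ} {M : ℝ}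
    (hζ : ∀ ξ ∈ P.interior, ∀ a, |ζ ξ a| ≤ M) :
    ∃ C : ℝ, 0 < C ∧ ∀ ξ ∈ P.interior, ∀ i,
      |cometric (hessian u ξ) (P.covec i) (grad u ξ + ζ ξ)| ≤ C * √(P.l i ξ) := by
  obtain ⟨C, hC0, hC⟩ := hP.exists_cometric_le hψ hu hpos hS
  obtain ⟨B, hB1, hB⟩ := hP.exists_l_le
  -- `√x (log x + 1)` is bounded on `(0, B]`
  obtain ⟨L, hL⟩ : ∃ L, ∀ x ∈ Icc (0 : ℝ) B, |(√x * (Real.log x + 1))| ≤ L := by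
    have hc : Continuous fun x : ℝ => √x + 2 * (√x * Real.log √x) := by
      have := Real.continuous_mul_log.comp Real.continuous_sqrt
      exact Real.continuous_sqrt.add (continuous_const.mul this)
    obtain ⟨L, hL⟩ := isCompact_Icc.exists_bound_of_continuousOn (hc.continuousOn (s := Icc 0 B))
    refine ⟨L, fun x hx => ?_⟩
    have := hL x hx
    rw [Real.norm_eq_abs, Real.log_sqrt hx.1] at this
    convert this using 2
    ring
  have hL0 : 0 ≤ L := (abs_nonneg _).trans (hL 0 ⟨le_rfl, by linarith⟩)
  obtain ⟨M₀, hM₀0, hM₀⟩ := hP.exists_bound_derivAlong hψ (EuclideanSpace.single 0 1)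
  obtain ⟨M₁, hM₁0, hM₁⟩ := hP.exists_bound_derivAlong hψ (EuclideanSpace.single 1 1)
  set N := (M₀ + |M|) ^ 2 + (M₁ + |M|) ^ 2 with hN
  have hN0 : 0 ≤ N := by positivity
  refine ⟨d * (C * L) + √C * √(C * N) + 1, by positivity, fun ξ hξ i => ?_⟩
  obtain ⟨h1, h2⟩ := hC ξ hξ
  have hH := hpos ξ hξ
  have hsq : 0 ≤ √(P.l i ξ) := Real.sqrt_nonneg _
  rw [grad_potential hψ hu hξ, add_assoc, cometric_add_right, cometric_sum_right]
  refine (abs_add_le _ _).trans ?_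
  have hA : |∑ j, cometric (hessian u ξ) (P.covec i) ((Real.log (P.l j ξ) + 1) • P.covec j)| ≤
      d * (C * L) * √(P.l i ξ) := by
    refine (Finset.abs_sum_le_sum_abs _ _).trans ?_
    have : ∀ j ∈ Finset.univ, |cometric (hessian u ξ) (P.covec i)
        ((Real.log (P.l j ξ) + 1) • P.covec j)| ≤ C * L * √(P.l i ξ) := fun j _ => by
      rw [cometric_smul_right, abs_mul]
      have e1 := abs_cometric_le hH (h1 i) (h1 j)
      rw [Real.sqrt_mul hC0.le, Real.sqrt_mul hC0.le] at e1
      have e2 := hL (P.l j ξ) ⟨(hξ j).le, hB j ξ (P.interior_subset_closed hξ)⟩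
      rw [abs_mul, abs_of_nonneg (Real.sqrt_nonneg _)] at e2
      calc _ ≤ |Real.log (P.l j ξ) + 1| * (√C * √(P.l i ξ) * (√C * √(P.l j ξ))) :=
            mul_le_mul_of_nonneg_left e1 (abs_nonneg _)
        _ = (√C * √C) * √(P.l i ξ) * (√(P.l j ξ) * |Real.log (P.l j ξ) + 1|) := by ring
        _ ≤ (√C * √C) * √(P.l i ξ) * L := mul_le_mul_of_nonneg_left e2 (by positivity)
        _ = C * L * √(P.l i ξ) := by rw [Real.mul_self_sqrt hC0.le]; ring
    refine (Finset.sum_le_sum this).trans ?_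
    simp
    ring_nf
    exact le_rfl
  have hZ : |cometric (hessian u ξ) (P.covec i)
      ((fun a => derivAlong P.closed (EuclideanSpace.single a 1) ψ ξ) + ζ ξ)| ≤
      √C * √(C * N) * √(P.l i ξ) := by
    have hz : cometric (hessian u ξ)
        ((fun a => derivAlong P.closed (EuclideanSpace.single a 1) ψ ξ) + ζ ξ)
        ((fun a => derivAlong P.closed (EuclideanSpace.single a 1) ψ ξ) + ζ ξ) ≤ C * N := by
      refine (cometric_self_le_trace hH _).trans ?_
      refine mul_le_mul h2 ?_ (by positivity) hC0.le
      have hb : ∀ (a : Fin 2) (M' : ℝ), (∀ ξ ∈ P.closed,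
          |derivAlong P.closed (EuclideanSpace.single a 1) ψ ξ| ≤ M') →
          ((fun a => derivAlong P.closed (EuclideanSpace.single a 1) ψ ξ) + ζ ξ) a ^ 2 ≤
          (M' + |M|) ^ 2 := fun a M' hM' => by
        refine sq_le_sq.2 ((abs_add_le _ _).trans ?_)
        refine (add_le_add (hM' ξ (P.interior_subset_closed hξ))
          ((hζ ξ hξ a).trans (le_abs_self M))).trans (le_abs_self _)
      exact add_le_add (hb 0 M₀ hM₀) (hb 1 M₁ hM₁)
    refine (abs_cometric_le hH (h1 i) hz).trans (le_of_eq ?_)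
    rw [Real.sqrt_mul hC0.le]; ring
  linarith

end

end Polygon

/-! ### Integration by parts -/

/-- The trace of `W` with respect to the positive definite matrix `H`, that is `tr (H⁻¹ W)`. -/
noncomputable def invTrace (H W : Matrix (Fin 2) (Fin 2) ℝ) : ℝ :=
  (H.det)⁻¹ * (H 1 1 * W 0 0 - H 0 1 * W 0 1 - H 1 0 * W 1 0 + H 0 0 * W 1 1)

/-- A continuous compactly supported function times a function continuous near its support. -/
theorem continuous_mul_of_tsupport {Ω : Set Plane} (hΩ : IsOpen Ω) {f H : Plane → ℝ}
    (hf : ContinuousOn f Ω) (hH : Continuous H) (hs : tsupport H ⊆ Ω) :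
    Continuous fun ξ => f ξ * H ξ :=
  (hf.mul hH.continuousOn).continuous_of_tsupport_subset hΩ
    ((tsupport_mul_subset_right (f := f) (g := H)).trans hs)

theorem integrable_mul_of_tsupport {Ω : Set Plane} (hΩ : IsOpen Ω) {f H : Plane → ℝ}
    (hf : ContinuousOn f Ω) (hH : Continuous H) (hc : HasCompactSupport H) (hs : tsupport H ⊆ Ω) :
    MeasureTheory.Integrable fun ξ => f ξ * H ξ :=
  (continuous_mul_of_tsupport hΩ hf hH hs).integrable_of_hasCompactSupport hc.mul_left

theorem integral_mul_pderiv {Ω : Set Plane} (hΩ : IsOpen Ω) {f H : Plane → ℝ}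
    (hf : ContDiffOn ℝ 1 f Ω) (hH : ContDiff ℝ 1 H) (hc : HasCompactSupport H)
    (hs : tsupport H ⊆ Ω) (i : Fin 2) :
    ∫ ξ, f ξ * pderiv i H ξ = -∫ ξ, pderiv i f ξ * H ξ := by
  have h1 : ContinuousOn (pderiv i f) Ω :=
    (hf.continuousOn_fderiv_of_isOpen hΩ le_rfl).clm_apply continuousOn_const
  have h2 : Continuous (pderiv i H) :=
    (hH.continuous_fderiv one_ne_zero).clm_apply continuous_const
  refine integral_mul_fderiv_eq_neg_fderiv_mul_of_integrable
    (integrable_mul_of_tsupport hΩ h1 hH.continuous hc hs)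
    (integrable_mul_of_tsupport hΩ hf.continuousOn h2 (hc.fderiv_apply ℝ _)
      ((tsupport_fderiv_apply_subset ℝ _).trans hs))
    (integrable_mul_of_tsupport hΩ hf.continuousOn hH.continuous hc hs)
    (fun ξ hξ => ((hf ξ (hs hξ)).contDiffAt (hΩ.mem_nhds (hs hξ))).differentiableAt one_ne_zero)
    fun ξ _ => hH.differentiable one_ne_zero ξ

theorem integral_sub_sub_add {a b c e : Plane → ℝ} (ha : MeasureTheory.Integrable a)
    (hb : MeasureTheory.Integrable b) (hc : MeasureTheory.Integrable c)
    (he : MeasureTheory.Integrable e) :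
    ∫ ξ, (a ξ - b ξ - c ξ + e ξ) = (∫ ξ, a ξ) - (∫ ξ, b ξ) - (∫ ξ, c ξ) + ∫ ξ, e ξ := by
  have h1 := MeasureTheory.integral_sub ha hb
  have h2 := MeasureTheory.integral_sub (ha.sub hb) hc
  have h3 := MeasureTheory.integral_add ((ha.sub hb).sub hc) he
  simp only [Pi.sub_apply] at h1 h2 h3
  rw [h3, h2, h1]

theorem pderiv_mul {f g : Plane → ℝ} {ξ : Plane} (hf : DifferentiableAt ℝ f ξ)
    (hg : DifferentiableAt ℝ g ξ) (i : Fin 2) :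
    pderiv i (fun η => f η * g η) ξ = f ξ * pderiv i g ξ + g ξ * pderiv i f ξ := by
  simp [pderiv, fderiv_fun_mul hf hg]

namespace Polygon

variable {d : ℕ} {P : Polygon d}

theorem pderiv_congr_on {f g : Plane → ℝ} (h : ∀ ξ ∈ P.interior, f ξ = g ξ) {ξ : Plane}
    (hξ : ξ ∈ P.interior) (i : Fin 2) : pderiv i f ξ = pderiv i g ξ := by
  have : f =ᶠ[𝓝 ξ] g := by
    filter_upwards [eventually_mem_interior hξ] with η hη
    exact h η hη
  rw [pderiv, pderiv, this.fderiv_eq]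

/-- Third derivatives are symmetric; in other words, the rows of the cofactor matrix of a Hessian are
divergence free. -/
theorem pderiv_hessian_symm {u : Plane → ℝ} (hu : ContDiffOn ℝ ∞ u P.interior) {ξ : Plane}
    (hξ : ξ ∈ P.interior) (i j k : Fin 2) :
    pderiv i (fun η => hessian u η j k) ξ = pderiv j (fun η => hessian u η i k) ξ := by
  have h2 : (2 : WithTop ℕ∞) ≤ ∞ := WithTop.coe_le_coe.2 (le_top : (2 : ℕ∞) ≤ ⊤)
  exact hessian_symm ((contDiffAt_of_interior (contDiffOn_pderiv hu k) hξ).of_le h2) i j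

theorem pderiv_hessian_symm' {u : Plane → ℝ} (hu : ContDiffOn ℝ ∞ u P.interior) {ξ : Plane}
    (hξ : ξ ∈ P.interior) (i j k : Fin 2) :
    pderiv i (fun η => hessian u η j k) ξ = pderiv i (fun η => hessian u η k j) ξ := by
  have h2 : (2 : WithTop ℕ∞) ≤ ∞ := WithTop.coe_le_coe.2 (le_top : (2 : ℕ∞) ≤ ⊤)
  exact pderiv_congr_on (fun η hη => hessian_symm
    ((contDiffAt_of_interior hu hη).of_le h2) j k) hξ i

/-- Integrating Abreu's operator by parts twice against a compactly supported function; there are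
no first order terms because the cofactor matrix of a Hessian is divergence free. -/
theorem integral_invTrace_add {u : Plane → ℝ} (hu : ContDiffOn ℝ ∞ u P.interior)
    (hpos : ∀ ξ ∈ P.interior, (hessian u ξ).PosDef) {G : Plane → ℝ} (hG : ContDiff ℝ 2 G)
    (hc : HasCompactSupport G) (hs : tsupport G ⊆ P.interior) :
    MeasureTheory.Integrable
      (fun ξ => invTrace (hessian u ξ) (hessian G ξ) + scalarCurvature u ξ * G ξ) ∧
    ∫ ξ, (invTrace (hessian u ξ) (hessian G ξ) + scalarCurvature u ξ * G ξ) = 0 := by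
  have hΩ := P.isOpen_interior
  have h1 : (1 : WithTop ℕ∞) ≤ ∞ := WithTop.coe_le_coe.2 (le_top : (1 : ℕ∞) ≤ ⊤)
  set w : Plane → ℝ := fun η => ((hessian u η).det)⁻¹ with hw
  have hwC : ContDiffOn ℝ ∞ w P.interior := contDiffOn_inv_det_hessian hu hpos
  set h : Fin 2 → Fin 2 → Plane → ℝ := fun i j ξ => hessian u ξ i j with hh
  have hhC : ∀ i j, ContDiffOn ℝ ∞ (h i j) P.interior := fun i j => contDiffOn_hessian hu i j
  have hd : ∀ {f : Plane → ℝ}, ContDiffOn ℝ ∞ f P.interior → ∀ ξ ∈ P.interior,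
      DifferentiableAt ℝ f ξ := fun hf ξ hξ =>
    (contDiffAt_of_interior hf hξ).differentiableAt (by simp)
  have hG1 : ContDiff ℝ 1 G := hG.of_le (by norm_num)
  have hGi : ∀ i, ContDiff ℝ 1 (pderiv i G) := fun i =>
    (hG.fderiv_right (m := 1) (by norm_num)).clm_apply contDiff_const
  have hGic : ∀ i, HasCompactSupport (pderiv i G) := fun i => hc.fderiv_apply ℝ _
  have hGis : ∀ i, tsupport (pderiv i G) ⊆ P.interior := fun i =>
    (tsupport_fderiv_apply_subset ℝ _).trans hs
  have hGij : ∀ i j, Continuous (fun ξ => hessian G ξ i j) := fun i j =>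
    ((hGi j).continuous_fderiv one_ne_zero).clm_apply continuous_const
  have hGijc : ∀ i j, HasCompactSupport (fun ξ => hessian G ξ i j) := fun i j =>
    (hGic j).fderiv_apply ℝ _
  have hGijs : ∀ i j, tsupport (fun ξ => hessian G ξ i j) ⊆ P.interior := fun i j =>
    (tsupport_fderiv_apply_subset ℝ _).trans (hGis j)
  -- the integrals that occur
  have I2 : ∀ {f : Plane → ℝ}, ContDiffOn ℝ ∞ f P.interior → ∀ i j,
      MeasureTheory.Integrable fun ξ => f ξ * hessian G ξ i j := fun hf i j =>
    integrable_mul_of_tsupport hΩ hf.continuousOn (hGij i j) (hGijc i j) (hGijs i j)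
  have I1 : ∀ {f : Plane → ℝ}, ContDiffOn ℝ ∞ f P.interior → ∀ i,
      MeasureTheory.Integrable fun ξ => f ξ * pderiv i G ξ := fun hf i =>
    integrable_mul_of_tsupport hΩ hf.continuousOn (hGi i).continuous (hGic i) (hGis i)
  have I0 : ∀ {f : Plane → ℝ}, ContDiffOn ℝ ∞ f P.interior →
      MeasureTheory.Integrable fun ξ => f ξ * G ξ := fun hf =>
    integrable_mul_of_tsupport hΩ hf.continuousOn hG.continuous hc hs
  have hzero : ∀ i ξ, ξ ∉ P.interior → pderiv i G ξ = 0 := fun i ξ hξ => by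
    by_contra hne
    exact hξ (hGis i (subset_tsupport _ hne))
  have hzero' : ∀ ξ, ξ ∉ P.interior → G ξ = 0 := fun ξ hξ => by
    by_contra hne
    exact hξ (hs (subset_tsupport _ hne))
  have step1 : ∀ (f : Plane → ℝ), ContDiffOn ℝ ∞ f P.interior → ∀ i j,
      ∫ ξ, f ξ * hessian G ξ i j = -∫ ξ, pderiv i f ξ * pderiv j G ξ := fun f hf i j =>
    integral_mul_pderiv hΩ (hf.of_le h1) (hGi j) (hGic j) (hGis j) i
  have step2 : ∀ (f : Plane → ℝ), ContDiffOn ℝ ∞ f P.interior → ∀ i,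
      ∫ ξ, f ξ * pderiv i G ξ = -∫ ξ, pderiv i f ξ * G ξ := fun f hf i =>
    integral_mul_pderiv hΩ (hf.of_le h1) hG1 hc hs i
  have hwh : ∀ i j, ContDiffOn ℝ ∞ (fun ξ => w ξ * h i j ξ) P.interior := fun i j =>
    hwC.mul (hhC i j)
  have hhw : ∀ i j k, ContDiffOn ℝ ∞ (fun ξ => h i j ξ * pderiv k w ξ) P.interior := fun i j k =>
    (hhC i j).mul (contDiffOn_pderiv hwC k)
  have hT : ∀ ξ, invTrace (hessian u ξ) (hessian G ξ) =
      w ξ * h 1 1 ξ * hessian G ξ 0 0 - w ξ * h 0 1 ξ * hessian G ξ 0 1 -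
        w ξ * h 1 0 ξ * hessian G ξ 1 0 + w ξ * h 0 0 ξ * hessian G ξ 1 1 := fun ξ => by
    simp only [invTrace, hw, hh]; ring
  have hA : ∫ ξ, invTrace (hessian u ξ) (hessian G ξ) =
      -∫ ξ, (h 1 1 ξ * pderiv 0 w ξ * pderiv 0 G ξ - h 1 0 ξ * pderiv 1 w ξ * pderiv 0 G ξ -
        h 0 1 ξ * pderiv 0 w ξ * pderiv 1 G ξ + h 0 0 ξ * pderiv 1 w ξ * pderiv 1 G ξ) := by
    simp_rw [hT]
    rw [integral_sub_sub_add (I2 (hwh 1 1) 0 0) (I2 (hwh 0 1) 0 1) (I2 (hwh 1 0) 1 0)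
        (I2 (hwh 0 0) 1 1),
      step1 _ (hwh 1 1), step1 _ (hwh 0 1), step1 _ (hwh 1 0), step1 _ (hwh 0 0)]
    have J : ∀ i j k l, MeasureTheory.Integrable fun ξ =>
        pderiv k (fun ξ => w ξ * h i j ξ) ξ * pderiv l G ξ := fun i j k l =>
      I1 (contDiffOn_pderiv (hwh i j) k) l
    have e : ∀ p q r s : ℝ, -p - -q - -r + -s = -(p - q - r + s) := fun _ _ _ _ => by ring
    rw [e, ← integral_sub_sub_add (J 1 1 0 0) (J 0 1 0 1) (J 1 0 1 0) (J 0 0 1 1)]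
    congr 2
    funext ξ
    by_cases hξ : ξ ∈ P.interior
    · simp only [pderiv_mul (hd hwC ξ hξ) (hd (hhC _ _) ξ hξ)]
      have c1 : pderiv 0 (h 1 1) ξ = pderiv 1 (h 1 0) ξ :=
        (pderiv_hessian_symm hu hξ 0 1 1).trans (pderiv_hessian_symm' hu hξ 1 0 1)
      have c2 : pderiv 1 (h 0 0) ξ = pderiv 0 (h 0 1) ξ :=
        (pderiv_hessian_symm hu hξ 1 0 0).trans (pderiv_hessian_symm' hu hξ 0 1 0)
      rw [c1, c2]
      ring
    · simp [hzero _ ξ hξ]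
  have hB : ∫ ξ, (h 1 1 ξ * pderiv 0 w ξ * pderiv 0 G ξ - h 1 0 ξ * pderiv 1 w ξ * pderiv 0 G ξ -
        h 0 1 ξ * pderiv 0 w ξ * pderiv 1 G ξ + h 0 0 ξ * pderiv 1 w ξ * pderiv 1 G ξ) =
      ∫ ξ, scalarCurvature u ξ * G ξ := by
    rw [integral_sub_sub_add (I1 (hhw 1 1 0) 0) (I1 (hhw 1 0 1) 0) (I1 (hhw 0 1 0) 1)
        (I1 (hhw 0 0 1) 1),
      step2 _ (hhw 1 1 0), step2 _ (hhw 1 0 1), step2 _ (hhw 0 1 0), step2 _ (hhw 0 0 1)]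
    have J : ∀ i j k l, MeasureTheory.Integrable fun ξ =>
        pderiv l (fun ξ => h i j ξ * pderiv k w ξ) ξ * G ξ := fun i j k l =>
      I0 (contDiffOn_pderiv (hhw i j k) l)
    have e : ∀ p q r s : ℝ, -p - -q - -r + -s = -(p - q - r + s) := fun _ _ _ _ => by ring
    rw [e, ← integral_sub_sub_add (J 1 1 0 0) (J 1 0 1 0) (J 0 1 0 1) (J 0 0 1 1),
      ← MeasureTheory.integral_neg]
    congr 1
    funext ξ
    by_cases hξ : ξ ∈ P.interior
    · simp only [pderiv_mul (hd (hhC _ _) ξ hξ) (hd (contDiffOn_pderiv hwC _) ξ hξ)]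
      have c1 : pderiv 0 (h 1 1) ξ = pderiv 1 (h 0 1) ξ := pderiv_hessian_symm hu hξ 0 1 1
      have c2 : pderiv 1 (h 0 0) ξ = pderiv 0 (h 1 0) ξ := pderiv_hessian_symm hu hξ 1 0 0
      have hsc : scalarCurvature u ξ = -(h 1 1 ξ * hessian w ξ 0 0 - h 0 1 ξ * hessian w ξ 0 1 -
          h 1 0 ξ * hessian w ξ 1 0 + h 0 0 ξ * hessian w ξ 1 1) := by
        simp [scalarCurvature, Matrix.adjugate_fin_two, Fin.sum_univ_two, hh, hw]
        ring
      have hHw : ∀ i j, pderiv i (pderiv j w) ξ = hessian w ξ i j := fun i j => rfl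
      have c3 : h 1 0 ξ = h 0 1 ξ := (hpos ξ hξ).offDiag_eq
      rw [c1, c2, hsc]
      simp only [hHw, c3]
      ring
    · simp [hzero' ξ hξ]
  have K1 : MeasureTheory.Integrable fun ξ => invTrace (hessian u ξ) (hessian G ξ) := by
    simp_rw [hT]
    exact (((I2 (hwh 1 1) 0 0).sub (I2 (hwh 0 1) 0 1)).sub
        (I2 (hwh 1 0) 1 0)).add (I2 (hwh 0 0) 1 1)
  have K2 : MeasureTheory.Integrable fun ξ => scalarCurvature u ξ * G ξ := by
    refine integrable_mul_of_tsupport hΩ ?_ hG.continuous hc hs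
    unfold scalarCurvature
    refine ContinuousOn.neg (continuousOn_finsetSum _ fun i _ => continuousOn_finsetSum _ fun j _ =>
      ContinuousOn.mul ?_ (contDiffOn_hessian hwC i j).continuousOn)
    have h4 := fun i j => (hhC i j).continuousOn
    simp only [Matrix.adjugate_fin_two]
    fin_cases i <;> fin_cases j <;> simp
    · exact h4 1 1
    · exact (h4 0 1).neg
    · exact (h4 1 0).neg
    · exact h4 0 0
  refine ⟨K1.add K2, ?_⟩
  rw [MeasureTheory.integral_add K1 K2, hA, hB]
  ring

end Polygon

/-! ### Logarithmic cutoff functions -/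

theorem hasDerivAt_posPart_pow (n : ℕ) (x : ℝ) :
    HasDerivAt (fun y : ℝ => (max 0 y) ^ (n + 2)) ((n + 2) * (max 0 x) ^ (n + 1)) x := by
  rcases lt_trichotomy x 0 with h | h | h
  · have h1 : (fun y : ℝ => (max 0 y) ^ (n + 2)) =ᶠ[𝓝 x] fun _ => 0 := by
      filter_upwards [gt_mem_nhds h] with y hy
      rw [max_eq_left hy.le]; simp
    rw [max_eq_left h.le]
    simpa using (hasDerivAt_const x (0 : ℝ)).congr_of_eventuallyEq h1
  · subst h
    rw [max_self]
    simp only [ne_eq, Nat.add_eq_zero_iff, one_ne_zero, and_false, not_false_eq_true, zero_pow,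
      mul_zero]
    rw [hasDerivAt_iff_isLittleO_nhds_zero]
    simp only [zero_add, max_self, ne_eq, Nat.add_eq_zero_iff, OfNat.ofNat_ne_zero, and_false,
      not_false_eq_true, zero_pow, sub_zero, smul_zero]
    have h1 : (fun h : ℝ => (max 0 h) ^ (n + 2)) =O[𝓝 0] fun h => h ^ (n + 2) := by
      refine Asymptotics.isBigO_of_le _ fun h => ?_
      rw [norm_pow, norm_pow]
      refine pow_le_pow_left₀ (norm_nonneg _) ?_ _
      rw [Real.norm_eq_abs, Real.norm_eq_abs, abs_of_nonneg (le_max_left _ _)]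
      exact max_le (abs_nonneg _) (le_abs_self _)
    refine h1.trans_isLittleO ?_
    have := Asymptotics.isLittleO_pow_id (𝕜 := ℝ) (n := n + 2) (by omega)
    exact this
  · have h1 : (fun y : ℝ => (max 0 y) ^ (n + 2)) =ᶠ[𝓝 x] fun y => y ^ (n + 2) := by
      filter_upwards [lt_mem_nhds h] with y hy
      rw [max_eq_right hy.le]
    rw [max_eq_right h.le]
    have := (hasDerivAt_pow (n + 2) x).congr_of_eventuallyEq h1
    push_cast at this
    exact this

theorem contDiff_posPart_cube : ContDiff ℝ 2 fun y : ℝ => (max 0 y) ^ 3 := by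
  have hd3 : deriv (fun y : ℝ => (max 0 y) ^ 3) = fun y => 3 * (max 0 y) ^ 2 := by
    funext x
    have := (hasDerivAt_posPart_pow 1 x).deriv
    norm_num at this
    exact this
  have hd2 : deriv (fun y : ℝ => (max 0 y) ^ 2) = fun y => 2 * max 0 y := by
    funext x
    have := (hasDerivAt_posPart_pow 0 x).deriv
    norm_num at this
    exact this
  have h2 : ContDiff ℝ 1 fun y : ℝ => (max 0 y) ^ 2 := by
    refine contDiff_one_iff_deriv.2 ⟨fun x => (hasDerivAt_posPart_pow 0 x).differentiableAt, ?_⟩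
    rw [hd2]
    fun_prop
  have h21 : (2 : WithTop ℕ∞) = 1 + 1 := by norm_num
  rw [h21, contDiff_succ_iff_deriv]
  refine ⟨fun x => (hasDerivAt_posPart_pow 1 x).differentiableAt, by simp, ?_⟩
  rw [hd3]
  exact contDiff_const.mul h2

section

variable {H : Matrix (Fin 2) (Fin 2) ℝ}

theorem invTrace_add (W V : Matrix (Fin 2) (Fin 2) ℝ) :
    invTrace H (W + V) = invTrace H W + invTrace H V := by
  simp [invTrace]; ring

theorem invTrace_smul (c : ℝ) (W : Matrix (Fin 2) (Fin 2) ℝ) :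
    invTrace H (c • W) = c * invTrace H W := by
  simp [invTrace]; ring

theorem invTrace_vecMulVec (x y : Fin 2 → ℝ) :
    invTrace H (Matrix.vecMulVec x y) = cometric H x y := by
  simp [invTrace, cometric, Matrix.vecMulVec_apply]

theorem invTrace_sum {ι : Type*} (s : Finset ι) (W : ι → Matrix (Fin 2) (Fin 2) ℝ) :
    invTrace H (∑ i ∈ s, W i) = ∑ i ∈ s, invTrace H (W i) := by
  classical
  induction s using Finset.induction_on with
  | empty => simp [invTrace]
  | insert a s ha ih => rw [Finset.sum_insert ha, Finset.sum_insert ha, invTrace_add, ih]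

theorem invTrace_self (hH : H.PosDef) : invTrace H H = 2 := by
  have hd := hH.det_pos.ne'
  rw [invTrace]
  field_simp
  rw [Matrix.det_fin_two, hH.offDiag_eq]
  ring

end

namespace Polygon

variable {d : ℕ} {P : Polygon d}

theorem hessian_mul {f g : Plane → ℝ} (hf : ContDiffOn ℝ 2 f P.interior)
    (hg : ContDiffOn ℝ 2 g P.interior) {ξ : Plane} (hξ : ξ ∈ P.interior) :
    hessian (fun η => f η * g η) ξ = f ξ • hessian g ξ + Matrix.vecMulVec (grad f ξ) (grad g ξ) +
      Matrix.vecMulVec (grad g ξ) (grad f ξ) + g ξ • hessian f ξ := by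
  have hd : ∀ {f : Plane → ℝ}, ContDiffOn ℝ 2 f P.interior → ∀ η ∈ P.interior,
      DifferentiableAt ℝ f η := fun hf η hη =>
    (contDiffAt_of_interior hf hη).differentiableAt two_ne_zero
  have hd2 : ∀ {f : Plane → ℝ}, ContDiffOn ℝ 2 f P.interior → ∀ j, ∀ η ∈ P.interior,
      DifferentiableAt ℝ (pderiv j f) η := fun hf j η hη =>
    differentiableAt_fderiv_apply (contDiffAt_of_interior hf hη) _
  ext i j
  change pderiv i (pderiv j fun η => f η * g η) ξ = _
  rw [pderiv_congr_on (g := fun η => f η * pderiv j g η + g η * pderiv j f η)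
    (fun η hη => pderiv_mul (hd hf η hη) (hd hg η hη) j) hξ]
  have e : pderiv i (fun η => f η * pderiv j g η + g η * pderiv j f η) ξ =
      pderiv i (fun η => f η * pderiv j g η) ξ + pderiv i (fun η => g η * pderiv j f η) ξ := by
    rw [pderiv, fderiv_fun_add ((hd hf ξ hξ).fun_mul (hd2 hg j ξ hξ))
      ((hd hg ξ hξ).fun_mul (hd2 hf j ξ hξ))]
    rfl
  rw [e, pderiv_mul (hd hf ξ hξ) (hd2 hg j ξ hξ), pderiv_mul (hd hg ξ hξ) (hd2 hf j ξ hξ)]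
  simp [hessian, grad, Matrix.vecMulVec_apply]
  ring

theorem hessian_sub {f g : Plane → ℝ} (hf : ContDiffOn ℝ 2 f P.interior)
    (hg : ContDiffOn ℝ 2 g P.interior) {ξ : Plane} (hξ : ξ ∈ P.interior) :
    hessian (fun η => f η - g η) ξ = hessian f ξ - hessian g ξ := by
  have hd : ∀ {f : Plane → ℝ}, ContDiffOn ℝ 2 f P.interior → ∀ η ∈ P.interior,
      DifferentiableAt ℝ f η := fun hf η hη =>
    (contDiffAt_of_interior hf hη).differentiableAt two_ne_zero
  have hd2 : ∀ {f : Plane → ℝ}, ContDiffOn ℝ 2 f P.interior → ∀ j, ∀ η ∈ P.interior,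
      DifferentiableAt ℝ (pderiv j f) η := fun hf j η hη =>
    differentiableAt_fderiv_apply (contDiffAt_of_interior hf hη) _
  ext i j
  change pderiv i (pderiv j fun η => f η - g η) ξ = _
  rw [pderiv_congr_on (g := fun η => pderiv j f η - pderiv j g η) (fun η hη => by
    rw [pderiv, fderiv_fun_sub (hd hf η hη) (hd hg η hη)]; rfl) hξ]
  rw [pderiv, fderiv_fun_sub (hd2 hf j ξ hξ) (hd2 hg j ξ hξ)]
  rfl

/-- `log ∏ l_i`. -/
noncomputable def logProd (P : Polygon d) (ξ : Plane) : ℝ := ∑ i, Real.log (P.l i ξ)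

theorem logProd_eq {ξ : Plane} (hξ : ξ ∈ P.interior) : P.logProd ξ = Real.log (P.prodL ξ) :=
  (Real.log_prod fun i _ => (hξ i).ne').symm

theorem contDiffOn_logProd {n : WithTop ℕ∞} : ContDiffOn ℝ n P.logProd P.interior :=
  ContDiffOn.sum fun i _ => (P.contDiff_l i).contDiffOn.log fun _ hξ => (hξ i).ne'

theorem hasFDerivAt_logProd {ξ : Plane} (hξ : ξ ∈ P.interior) :
    HasFDerivAt P.logProd (∑ i, (P.l i ξ)⁻¹ • P.lin i) ξ :=
  HasFDerivAt.fun_sum fun i _ => (P.hasFDerivAt_l i ξ).log (hξ i).ne'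

/-- The cutoff function `Θ(1 + (log ∏ l_i) / R)` with `Θ(y) = max(0, y)³`. It changes slowly on the
logarithmic scale and its support is compact in `Δ`. -/
noncomputable def cutoff (P : Polygon d) (R : ℝ) (ξ : Plane) : ℝ :=
  (max 0 (1 + P.logProd ξ / R)) ^ 3

/-- The covector `∑ v_i / l_i`, the differential of `log ∏ l_i`. -/
noncomputable def logGrad (P : Polygon d) (ξ : Plane) : Fin 2 → ℝ :=
  ∑ i, (P.l i ξ)⁻¹ • P.covec i

theorem lin_single (i : Fin d) (a : Fin 2) :
    P.lin i (EuclideanSpace.single a 1) = P.covec i a := by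
  fin_cases a <;> simp [lin_apply, covec]

theorem logGrad_apply (ξ : Plane) (a : Fin 2) :
    P.logGrad ξ a = ∑ i, (P.l i ξ)⁻¹ * P.covec i a := by
  simp [logGrad]

theorem contDiffOn_cutoff (R : ℝ) : ContDiffOn ℝ 2 (P.cutoff R) P.interior :=
  contDiff_posPart_cube.comp_contDiffOn
    (contDiffOn_const.add (contDiffOn_logProd.div_const R))

theorem hasFDerivAt_posPart_pow_logProd (R : ℝ) (n : ℕ) {ξ : Plane} (hξ : ξ ∈ P.interior) :
    HasFDerivAt (fun η => (max 0 (1 + P.logProd η / R)) ^ (n + 2))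
      (((n + 2) * (max 0 (1 + P.logProd ξ / R)) ^ (n + 1) / R) • ∑ i, (P.l i ξ)⁻¹ • P.lin i) ξ := by
  have h1 : HasFDerivAt (fun η => 1 + P.logProd η / R) (R⁻¹ • ∑ i, (P.l i ξ)⁻¹ • P.lin i) ξ := by
    have := ((hasFDerivAt_logProd hξ).const_mul R⁻¹).const_add 1
    simpa only [div_eq_inv_mul] using this
  have h2 := (hasDerivAt_posPart_pow n (1 + P.logProd ξ / R)).comp_hasFDerivAt ξ h1
  rw [smul_smul] at h2
  exact h2

theorem pderiv_cutoff (R : ℝ) {ξ : Plane} (hξ : ξ ∈ P.interior) (a : Fin 2) :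
    pderiv a (P.cutoff R) ξ = 3 * (max 0 (1 + P.logProd ξ / R)) ^ 2 / R * P.logGrad ξ a := by
  have h := hasFDerivAt_posPart_pow_logProd R 1 hξ
  rw [pderiv]
  change fderiv ℝ (fun η => (max 0 (1 + P.logProd η / R)) ^ (1 + 2)) ξ _ = _
  rw [h.fderiv, logGrad_apply]
  simp [lin_single]
  norm_num

theorem grad_cutoff (R : ℝ) {ξ : Plane} (hξ : ξ ∈ P.interior) :
    grad (P.cutoff R) ξ = (3 * (max 0 (1 + P.logProd ξ / R)) ^ 2 / R) • P.logGrad ξ :=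
  funext fun a => pderiv_cutoff R hξ a

theorem hessian_cutoff (R : ℝ) {ξ : Plane} (hξ : ξ ∈ P.interior) :
    hessian (P.cutoff R) ξ =
      (6 * max 0 (1 + P.logProd ξ / R) / R ^ 2) • Matrix.vecMulVec (P.logGrad ξ) (P.logGrad ξ) +
      (-(3 * (max 0 (1 + P.logProd ξ / R)) ^ 2 / R)) •
        ∑ i, (P.l i ξ ^ 2)⁻¹ • Matrix.vecMulVec (P.covec i) (P.covec i) := by
  ext a b
  change pderiv a (pderiv b (P.cutoff R)) ξ = _
  rw [pderiv_congr_on (fun η hη => pderiv_cutoff R hη b) hξ]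
  have h1 := (hasFDerivAt_posPart_pow_logProd R 0 hξ).const_mul (3 / R)
  have h2 : HasFDerivAt (fun η => P.logGrad η b)
      (∑ i, P.covec i b • (-(P.l i ξ ^ 2)⁻¹) • P.lin i) ξ := by
    have : (fun η => P.logGrad η b) = fun η => ∑ i, (P.l i η)⁻¹ * P.covec i b :=
      funext fun η => logGrad_apply η b
    rw [this]
    refine HasFDerivAt.fun_sum fun i _ => ?_
    exact ((hasDerivAt_inv (hξ i).ne').comp_hasFDerivAt ξ (P.hasFDerivAt_l i ξ)).mul_const _
  have h3 := h1.fun_mul h2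
  have e : (fun η => 3 * (max 0 (1 + P.logProd η / R)) ^ 2 / R * P.logGrad η b) =
      fun η => 3 / R * (max 0 (1 + P.logProd η / R)) ^ (0 + 2) * P.logGrad η b := by
    funext η; ring
  rw [e, pderiv, h3.fderiv]
  have e2 : P.logGrad ξ a = ∑ i, (P.l i ξ)⁻¹ * P.covec i a := logGrad_apply ξ a
  simp only [Matrix.add_apply, Matrix.smul_apply, Matrix.vecMulVec_apply, Matrix.sum_apply, e2,
    add_apply, smul_apply, sum_apply, lin_single, smul_eq_mul]
  have e3 : ∑ x, P.covec x b * (-(P.l x ξ ^ 2)⁻¹ * P.covec x a) =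
      -∑ x, (P.l x ξ ^ 2)⁻¹ * (P.covec x a * P.covec x b) := by
    rw [← Finset.sum_neg_distrib]
    exact Finset.sum_congr rfl fun x _ => by ring
  rw [e3]
  push_cast
  ring

/-- The trace of the Hessian of the product of a cutoff function and a function `F`. -/
theorem invTrace_cutoff_mul (R : ℝ) {F : Plane → ℝ} (hF : ContDiffOn ℝ 2 F P.interior)
    (H : Matrix (Fin 2) (Fin 2) ℝ) (hH : H.PosDef) {ξ : Plane} (hξ : ξ ∈ P.interior) :
    invTrace H (hessian (fun η => P.cutoff R η * F η) ξ) =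
      P.cutoff R ξ * invTrace H (hessian F ξ) +
      2 * (3 * (max 0 (1 + P.logProd ξ / R)) ^ 2 / R) *
        ∑ i, (P.l i ξ)⁻¹ * cometric H (P.covec i) (grad F ξ) +
      F ξ * (6 * max 0 (1 + P.logProd ξ / R) / R ^ 2 * cometric H (P.logGrad ξ) (P.logGrad ξ) -
        3 * (max 0 (1 + P.logProd ξ / R)) ^ 2 / R *
          ∑ i, (P.l i ξ ^ 2)⁻¹ * cometric H (P.covec i) (P.covec i)) := by
  rw [hessian_mul (contDiffOn_cutoff R) hF hξ, hessian_cutoff R hξ, grad_cutoff R hξ]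
  have e : cometric H (P.logGrad ξ) (grad F ξ) =
      ∑ i, (P.l i ξ)⁻¹ * cometric H (P.covec i) (grad F ξ) := by
    rw [cometric_comm hH, logGrad, cometric_sum_right]
    exact Finset.sum_congr rfl fun i _ => by rw [cometric_smul_right, cometric_comm hH]
  simp only [invTrace_add, invTrace_smul, invTrace_vecMulVec, invTrace_sum,
    cometric_smul_right]
  rw [cometric_comm hH _ (grad F ξ), cometric_smul_right, cometric_comm hH (grad F ξ), e]
  ring

/-- The squared length of `∑ v_i / l_i` in the inverse Hessian is `O(∑ 1 / l_i)`. The mixed terms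
`H⁻¹(v_i, v_j) / (l_i l_j)` are `O((l_i l_j)^{-1/2})` by Cauchy-Schwarz, hence bounded by the
diagonal ones. -/
theorem cometric_logGrad_le {H : Matrix (Fin 2) (Fin 2) ℝ} (hH : H.PosDef) {C : ℝ} (hC : 0 ≤ C)
    {ξ : Plane} (hξ : ξ ∈ P.interior)
    (h : ∀ i, cometric H (P.covec i) (P.covec i) ≤ C * P.l i ξ) :
    cometric H (P.logGrad ξ) (P.logGrad ξ) ≤ C * d * ∑ i, (P.l i ξ)⁻¹ := by
  have hb : ∀ i j, (P.l i ξ)⁻¹ * ((P.l j ξ)⁻¹ * cometric H (P.covec i) (P.covec j)) ≤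
      C / 2 * (P.l i ξ)⁻¹ + C / 2 * (P.l j ξ)⁻¹ := fun i j => by
    have h1 := (le_abs_self _).trans (abs_cometric_le hH (h i) (h j))
    rw [Real.sqrt_mul hC, Real.sqrt_mul hC] at h1
    have hx := hξ i
    have hy := hξ j
    set x := √(P.l i ξ) with hxs
    set y := √(P.l j ξ) with hys
    have hx0 : 0 < x := Real.sqrt_pos.2 hx
    have hy0 : 0 < y := Real.sqrt_pos.2 hy
    have hxx : P.l i ξ = x ^ 2 := (Real.sq_sqrt hx.le).symm
    have hyy : P.l j ξ = y ^ 2 := (Real.sq_sqrt hy.le).symm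
    have h2 : cometric H (P.covec i) (P.covec j) ≤ C * (x * y) := by
      refine h1.trans (le_of_eq ?_)
      have := Real.mul_self_sqrt hC
      linear_combination (x * y) * this
    rw [hxx, hyy]
    calc (x ^ 2)⁻¹ * ((y ^ 2)⁻¹ * cometric H (P.covec i) (P.covec j))
        ≤ (x ^ 2)⁻¹ * ((y ^ 2)⁻¹ * (C * (x * y))) := by gcongr
      _ = C * (x⁻¹ * y⁻¹) := by field_simp
      _ ≤ C * (((x⁻¹) ^ 2 + (y⁻¹) ^ 2) / 2) := by
          refine mul_le_mul_of_nonneg_left ?_ hC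
          nlinarith [sq_nonneg (x⁻¹ - y⁻¹)]
      _ = C / 2 * (x ^ 2)⁻¹ + C / 2 * (y ^ 2)⁻¹ := by field_simp
  have e : cometric H (P.logGrad ξ) (P.logGrad ξ) =
      ∑ i, ∑ j, (P.l i ξ)⁻¹ * ((P.l j ξ)⁻¹ * cometric H (P.covec i) (P.covec j)) := by
    conv_lhs => rw [logGrad, cometric_sum_right]
    refine Finset.sum_congr rfl fun i _ => ?_
    rw [cometric_smul_right, cometric_comm hH, cometric_sum_right, Finset.mul_sum]
    exact Finset.sum_congr rfl fun j _ => by rw [cometric_smul_right]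
  rw [e]
  refine (Finset.sum_le_sum fun i _ => Finset.sum_le_sum fun j _ => hb i j).trans (le_of_eq ?_)
  simp only [Finset.sum_add_distrib, Finset.sum_const, Finset.card_univ, Fintype.card_fin,
    nsmul_eq_mul, ← Finset.mul_sum]
  ring

/-- The pointwise inequality behind the boundary estimate: the term with the cutoff function's
first derivative against `H⁻¹(v_i, v_i)` has a sign, and the remaining terms are small. -/
theorem cutoff_pointwise {u f : Plane → ℝ} (hu : ContDiffOn ℝ 2 u P.interior)
    (hf : ContDiffOn ℝ 2 f P.interior) {ξ : Plane} (hξ : ξ ∈ P.interior)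
    (hH : (hessian u ξ).PosDef) {R C M S Ko : ℝ} (hR : 0 < R) (hC : 0 ≤ C) (hS : S ≤ Ko)
    (h1 : ∀ i, cometric (hessian u ξ) (P.covec i) (P.covec i) ≤ C * P.l i ξ)
    (h2 : ∀ i, |cometric (hessian u ξ) (P.covec i) (grad (fun η => u η - f η) ξ)| ≤
      C * √(P.l i ξ))
    (hF0 : 0 ≤ u ξ - f ξ) (hFM : u ξ - f ξ ≤ M) (i : Fin d) :
    (u ξ - f ξ) * (3 * (max 0 (1 + P.logProd ξ / R)) ^ 2 / R *
        ((P.l i ξ ^ 2)⁻¹ * cometric (hessian u ξ) (P.covec i) (P.covec i))) ≤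
      -(invTrace (hessian u ξ) (hessian (fun η => P.cutoff R η * (u η - f η)) ξ) +
        S * (P.cutoff R ξ * (u ξ - f ξ))) +
      (P.cutoff R ξ * (2 - invTrace (hessian u ξ) (hessian f ξ) + Ko * (u ξ - f ξ)) +
        (6 * C * (max 0 (1 + P.logProd ξ / R)) ^ 2 / R * ∑ i, (√(P.l i ξ))⁻¹ +
        6 * M * C * d * max 0 (1 + P.logProd ξ / R) / R ^ 2 * ∑ i, (P.l i ξ)⁻¹)) := by
  have hFC : ContDiffOn ℝ 2 (fun η => u η - f η) P.interior := hu.sub hf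
  rw [invTrace_cutoff_mul R hFC _ hH hξ, hessian_sub hu hf hξ, sub_eq_add_neg (hessian u ξ),
    invTrace_add, invTrace_self hH]
  have eneg : invTrace (hessian u ξ) (-hessian f ξ) = -invTrace (hessian u ξ) (hessian f ξ) := by
    have := invTrace_smul (H := hessian u ξ) (-1) (hessian f ξ)
    simpa using this
  rw [eneg]
  set p := max 0 (1 + P.logProd ξ / R) with hp
  have hp0 : 0 ≤ p := le_max_left _ _
  set F := u ξ - f ξ with hF
  set T := invTrace (hessian u ξ) (hessian f ξ)
  have hχ0 : 0 ≤ P.cutoff R ξ := pow_nonneg hp0 3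
  set χ := P.cutoff R ξ
  have hM := hF0.trans hFM
  -- the good term
  have b1 : (P.l i ξ ^ 2)⁻¹ * cometric (hessian u ξ) (P.covec i) (P.covec i) ≤
      ∑ j, (P.l j ξ ^ 2)⁻¹ * cometric (hessian u ξ) (P.covec j) (P.covec j) :=
    Finset.single_le_sum (f := fun j => (P.l j ξ ^ 2)⁻¹ *
      cometric (hessian u ξ) (P.covec j) (P.covec j)) (fun j _ =>
        mul_nonneg (inv_nonneg.2 (sq_nonneg _)) (cometric_self_nonneg hH _)) (Finset.mem_univ i)
  set g := ∑ j, (P.l j ξ ^ 2)⁻¹ * cometric (hessian u ξ) (P.covec j) (P.covec j)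
  -- the cross term
  have b2 : ∑ j, (P.l j ξ)⁻¹ * cometric (hessian u ξ) (P.covec j)
      (grad (fun η => u η - f η) ξ) ≤ C * ∑ j, (√(P.l j ξ))⁻¹ := by
    rw [Finset.mul_sum]
    refine Finset.sum_le_sum fun j _ => ?_
    have hl := hξ j
    calc (P.l j ξ)⁻¹ * cometric (hessian u ξ) (P.covec j) (grad (fun η => u η - f η) ξ)
        ≤ (P.l j ξ)⁻¹ * (C * √(P.l j ξ)) :=
          mul_le_mul_of_nonneg_left ((le_abs_self _).trans (h2 j)) (inv_nonneg.2 hl.le)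
      _ = C * (√(P.l j ξ))⁻¹ := by
        have h0 : √(P.l j ξ) ≠ 0 := (Real.sqrt_pos.2 hl).ne'
        have := Real.sq_sqrt hl.le
        field_simp
        rw [this, mul_comm]
  set X := ∑ j, (P.l j ξ)⁻¹ * cometric (hessian u ξ) (P.covec j) (grad (fun η => u η - f η) ξ)
  set Y := ∑ j, (√(P.l j ξ))⁻¹
  -- the term with the second derivative of `Θ`
  have b3 := cometric_logGrad_le hH hC hξ h1
  have hcs := cometric_self_nonneg hH (P.logGrad ξ)
  set Z := cometric (hessian u ξ) (P.logGrad ξ) (P.logGrad ξ)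
  set W := ∑ j, (P.l j ξ)⁻¹
  have c1 : F * (3 * p ^ 2 / R * ((P.l i ξ ^ 2)⁻¹ *
      cometric (hessian u ξ) (P.covec i) (P.covec i))) ≤ F * (3 * p ^ 2 / R * g) := by
    gcongr
  have c2 : 2 * (3 * p ^ 2 / R) * X ≤ 6 * C * p ^ 2 / R * Y := by
    calc 2 * (3 * p ^ 2 / R) * X ≤ 2 * (3 * p ^ 2 / R) * (C * Y) :=
          mul_le_mul_of_nonneg_left b2 (by positivity)
      _ = 6 * C * p ^ 2 / R * Y := by ring
  have c3 : F * (6 * p / R ^ 2 * Z) ≤ 6 * M * C * d * p / R ^ 2 * W := by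
    calc F * (6 * p / R ^ 2 * Z) ≤ M * (6 * p / R ^ 2 * (C * d * W)) := by
          gcongr
      _ = 6 * M * C * d * p / R ^ 2 * W := by ring
  have c4 : S * (χ * F) ≤ χ * (Ko * F) := by
    calc S * (χ * F) ≤ Ko * (χ * F) := mul_le_mul_of_nonneg_right hS (mul_nonneg hχ0 hF0)
      _ = χ * (Ko * F) := by ring
  linarith

end Polygon

/-! ### Integrals near an edge -/

open MeasureTheory

/-- The derivative of `arctan (log x)`: an integrable singularity stronger than any power of
`log x` over a power of `x` smaller than `1`. -/
theorem integrableOn_inv_mul_log_sq (B : ℝ) :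
    IntegrableOn (fun x : ℝ => (x * (1 + Real.log x ^ 2))⁻¹) (Ioc 0 B) := by
  set g : ℝ → ℝ := fun x => if x ≤ 0 then -(Real.pi / 2) else Real.arctan (Real.log x) with hg
  have hgpos : ∀ x, 0 < x → g =ᶠ[𝓝 x] fun y => Real.arctan (Real.log y) := fun x hx => by
    filter_upwards [lt_mem_nhds hx] with y hy
    exact if_neg (not_le.2 hy)
  have hder : ∀ x, 0 < x → HasDerivAt g ((x * (1 + Real.log x ^ 2))⁻¹) x := fun x hx => by
    have := ((Real.hasDerivAt_log hx.ne').arctan).congr_of_eventuallyEq (hgpos x hx)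
    rwa [one_div, ← mul_inv, mul_comm] at this
  refine intervalIntegral.integrableOn_deriv_of_nonneg (g := g) ?_ (fun x hx => hder x hx.1)
    (fun x hx => inv_nonneg.2 (mul_nonneg hx.1.le (by positivity)))
  intro x hx
  rcases hx.1.eq_or_lt with h | h
  · subst h
    have h1 : Tendsto g (𝓝[>] 0) (𝓝 (-(Real.pi / 2))) := by
      have : Tendsto (fun y => Real.arctan (Real.log y)) (𝓝[>] 0) (𝓝 (-(Real.pi / 2))) :=
        (Real.tendsto_arctan_atBot.mono_right nhdsWithin_le_nhds).comp Real.tendsto_log_nhdsGT_zero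
      refine this.congr' ?_
      filter_upwards [self_mem_nhdsWithin] with y hy
      exact (if_neg (not_le.2 hy)).symm
    have h0 : g 0 = -(Real.pi / 2) := if_pos le_rfl
    have h2 : ContinuousWithinAt g (Ioi 0) 0 := by
      rw [ContinuousWithinAt, h0]; exact h1
    exact (h2.insert).mono fun y hy => by
      rcases hy.1.eq_or_lt with h | h
      · exact Or.inl h.symm
      · exact Or.inr h
  · exact (hder x h).continuousAt.continuousWithinAt

namespace Polygon

variable {d : ℕ} {P : Polygon d}

/-- Affine coordinates adapted to the edge `ℓ_i`: the first one is the distance to the edge, measured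
by `l_i`, the second one runs along the edge. -/
noncomputable def edgeChart (P : Polygon d) (i : Fin d) (q : Plane) (z : ℝ × ℝ) : Plane :=
  q + (z.1 • P.unitNormal i + z.2 • P.tangent i)

theorem IsDelzant.l_edgeChart (hP : P.IsDelzant) (i : Fin d) (q : Plane) (z : ℝ × ℝ) :
    P.l i (P.edgeChart i q z) = P.l i q + z.1 := by
  rw [edgeChart, l_add, map_add, map_smul, map_smul, hP.lin_unitNormal, lin_tangent_self]
  simp

/-- The linear part of the edge coordinates. -/
noncomputable def IsDelzant.edgeFrame (hP : P.IsDelzant) (i : Fin d) : (ℝ × ℝ) ≃L[ℝ] Plane :=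
  (LinearMap.linearEquivOfInjective
    ((LinearMap.fst ℝ ℝ ℝ).smulRight (P.unitNormal i) +
      (LinearMap.snd ℝ ℝ ℝ).smulRight (P.tangent i))
    (by
      rw [injective_iff_map_eq_zero]
      rintro ⟨a, b⟩ h
      have e0 := congrArg (fun v : Plane => v 0) h
      have e1 := congrArg (fun v : Plane => v 1) h
      have hd := hP.det_unitNormal_tangent i
      simp at e0 e1
      ext
      · simp only [Prod.fst_zero]
        linear_combination P.tangent i 1 * e0 - P.tangent i 0 * e1 - a * hd
      · simp only [Prod.snd_zero]
        linear_combination P.unitNormal i 0 * e1 - P.unitNormal i 1 * e0 - b * hd)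
    (by simp)).toContinuousLinearEquiv

theorem IsDelzant.edgeChart_eq (hP : P.IsDelzant) (i : Fin d) (q : Plane) :
    P.edgeChart i q = (hP.edgeFrame i).toHomeomorph.trans (Homeomorph.addLeft q) := rfl

theorem IsDelzant.measurableEmbedding_edgeChart (hP : P.IsDelzant) (i : Fin d) (q : Plane) :
    MeasurableEmbedding (P.edgeChart i q) := by
  rw [hP.edgeChart_eq]
  exact Homeomorph.measurableEmbedding _

theorem IsDelzant.exists_volume_eq (hP : P.IsDelzant) (i : Fin d) :
    ∃ c : NNReal, 0 < c ∧ ∀ q, (volume : Measure Plane) =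
      c • Measure.map (P.edgeChart i q) volume := by
  have hh : (Measure.map (hP.edgeFrame i) (volume : Measure (ℝ × ℝ))).IsAddHaarMeasure :=
    ContinuousLinearEquiv.isAddHaarMeasure_map _ _
  refine ⟨_, Measure.addHaarScalarFactor_pos_of_isAddHaarMeasure volume
    (Measure.map (hP.edgeFrame i) (volume : Measure (ℝ × ℝ))), fun q => ?_⟩
  have e : P.edgeChart i q = (fun x => q + x) ∘ (hP.edgeFrame i) := rfl
  rw [e, ← Measure.map_map (measurable_const_add q) (hP.edgeFrame i).continuous.measurable,
    map_add_left_eq_self]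
  exact Measure.isAddLeftInvariant_eq_smul _ _

theorem IsDelzant.isCompact_edgeChart_preimage (hP : P.IsDelzant) (i : Fin d) (q : Plane) :
    IsCompact (P.edgeChart i q ⁻¹' P.closed) := by
  rw [hP.edgeChart_eq, Homeomorph.isCompact_preimage]
  exact hP.isCompact_closed

theorem IsDelzant.integrableOn_inv_l_log_sq (hP : P.IsDelzant) (i : Fin d) :
    IntegrableOn (fun ξ => (P.l i ξ * (1 + Real.log (P.l i ξ) ^ 2))⁻¹) P.interior := by
  obtain ⟨q, -, hq⟩ := (hP.edge_nontrivial i).nonempty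
  obtain ⟨c, -, hc⟩ := hP.exists_volume_eq i
  obtain ⟨B, -, hB⟩ := hP.exists_l_le
  obtain ⟨r, hr⟩ := (hP.isCompact_edgeChart_preimage i q).isBounded.exists_norm_le
  rw [hc q]
  rw [IntegrableOn, Measure.restrict_smul]
  refine Integrable.smul_measure_nnreal ?_
  change IntegrableOn _ _ _
  rw [(hP.measurableEmbedding_edgeChart i q).integrableOn_map_iff]
  have h1 : IntegrableOn (fun z : ℝ × ℝ => (z.1 * (1 + Real.log z.1 ^ 2))⁻¹ * (1 : ℝ))
      (Ioc 0 B ×ˢ Icc (-r) r) := by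
    have := (integrableOn_inv_mul_log_sq B).integrable.mul_prod
      (integrableOn_const (μ := volume) (s := Icc (-r) r) (C := (1 : ℝ)) (by simp)).integrable
    rw [Measure.prod_restrict] at this
    exact this
  refine (h1.mono_set fun z hz => ?_).congr_fun (fun z _ => ?_)
    ((hP.measurableEmbedding_edgeChart i q).measurable P.measurableSet_interior)
  · have hz' := P.interior_subset_closed hz
    have e1 := hP.l_edgeChart i q z
    rw [hq, zero_add] at e1
    have e2 := (norm_snd_le z).trans (hr z hz')
    exact ⟨⟨e1 ▸ hz i, e1 ▸ hB i _ hz'⟩, abs_le.1 e2⟩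
  · simp only [Function.comp, hP.l_edgeChart, hq, zero_add, mul_one]

/-- The integral of `1 / l_i` over a strip along the edge diverges logarithmically. -/
theorem IsDelzant.exists_integral_inv_l (hP : P.IsDelzant) (i : Fin d) :
    ∃ c : ℝ, 0 < c ∧ ∀ q, P.l i q = 0 → ∀ a b r : ℝ, 0 < a → a ≤ b → 0 ≤ r →
      IntegrableOn (fun ξ => (P.l i ξ)⁻¹) (P.edgeChart i q '' (Icc a b ×ˢ Icc (-r) r)) ∧
      ∫ ξ in P.edgeChart i q '' (Icc a b ×ˢ Icc (-r) r), (P.l i ξ)⁻¹ =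
        c * (2 * r) * (Real.log b - Real.log a) := by
  obtain ⟨c, hc0, hc⟩ := hP.exists_volume_eq i
  refine ⟨c, hc0, fun q hq a b r ha hab hr => ?_⟩
  have hme := hP.measurableEmbedding_edgeChart i q
  have hinj := hme.injective
  have hcont : ContinuousOn (fun x : ℝ => x⁻¹) (Icc a b) := fun x hx =>
    (continuousAt_inv₀ (ha.trans_le hx.1).ne').continuousWithinAt
  have h0 : IntegrableOn (fun x : ℝ => x⁻¹) (Icc a b) := hcont.integrableOn_Icc
  have h1 : IntegrableOn (fun z : ℝ × ℝ => z.1⁻¹ * (1 : ℝ)) (Icc a b ×ˢ Icc (-r) r) := by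
    have := h0.integrable.mul_prod
      (integrableOn_const (μ := volume) (s := Icc (-r) r) (C := (1 : ℝ)) (by simp)).integrable
    rw [Measure.prod_restrict] at this
    exact this
  have e : ∀ z : ℝ × ℝ, (P.l i (P.edgeChart i q z))⁻¹ = z.1⁻¹ * (1 : ℝ) := fun z => by
    rw [hP.l_edgeChart, hq, zero_add, mul_one]
  constructor
  · rw [hc q, IntegrableOn, Measure.restrict_smul]
    refine Integrable.smul_measure_nnreal ?_
    change IntegrableOn _ _ _
    rw [hme.integrableOn_map_iff, preimage_image_eq _ hinj]
    have : (fun ξ => (P.l i ξ)⁻¹) ∘ P.edgeChart i q = fun z : ℝ × ℝ => z.1⁻¹ * (1 : ℝ) :=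
      funext e
    rw [this]
    exact h1
  · conv_lhs => rw [hc q]
    rw [Measure.restrict_smul, integral_smul_nnreal_measure, hme.setIntegral_map,
      preimage_image_eq _ hinj]
    simp only [e]
    have hv : (volume : Measure (ℝ × ℝ)) = (volume : Measure ℝ).prod volume := rfl
    rw [hv, setIntegral_prod_mul (fun x : ℝ => x⁻¹) (fun _ : ℝ => (1 : ℝ))]
    rw [integral_Icc_eq_integral_Ioc, ← intervalIntegral.integral_of_le hab,
      integral_inv_of_pos ha (ha.trans_le hab), Real.log_div (ha.trans_le hab).ne' ha.ne']
    simp only [integral_const, smul_eq_mul, mul_one, measureReal_restrict_apply_univ]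
    rw [Measure.real, Real.volume_Icc, ENNReal.toReal_ofReal (by linarith)]
    rw [NNReal.smul_def, smul_eq_mul]
    ring

end Polygon

/-! ### The boundary estimate -/

/-- The singularity `1 / √x` is weaker than the integrable singularity `1 / (x (1 + log² x))`. -/
theorem sqrt_mul_log_sq_le {B : ℝ} (hB : 1 ≤ B) {x : ℝ} (hx : 0 < x) (hxB : x ≤ B) :
    √x * (1 + Real.log x ^ 2) ≤ B + 16 * (1 + B) ^ 2 := by
  set s := √(√x) with hs
  have hs0 : 0 < s := Real.sqrt_pos.2 (Real.sqrt_pos.2 hx)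
  have hs2 : s ^ 2 = √x := Real.sq_sqrt (Real.sqrt_nonneg x)
  have hs4 : s ^ 4 = x := by
    rw [show s ^ 4 = (s ^ 2) ^ 2 by ring, hs2, Real.sq_sqrt hx.le]
  have hlog : Real.log x = 4 * Real.log s := by
    rw [← hs4, Real.log_pow]; norm_num
  have hsB : s ^ 2 ≤ B := by
    rw [hs2]
    refine Real.sqrt_le_iff.2 ⟨by linarith, hxB.trans ?_⟩
    nlinarith
  have h1 : |s * Real.log s| ≤ 1 + s ^ 2 := by
    rcases le_total s 1 with h | h
    · have := (Real.abs_log_mul_self_lt s hs0 h).le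
      rw [mul_comm] at this
      nlinarith [sq_nonneg s]
    · have h2 := Real.log_nonneg h
      have h3 := Real.log_le_self hs0.le
      rw [abs_of_nonneg (mul_nonneg hs0.le h2)]
      nlinarith
  have h2 : (s * Real.log s) ^ 2 ≤ (1 + B) ^ 2 := by
    rw [← sq_abs]
    exact pow_le_pow_left₀ (abs_nonneg _) (h1.trans (by linarith)) 2
  rw [← hs2, hlog]
  nlinarith

namespace Polygon

variable {d : ℕ} {P : Polygon d}

theorem hessian_congr_on {f g : Plane → ℝ} (h : ∀ ξ ∈ P.interior, f ξ = g ξ) {ξ : Plane}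
    (hξ : ξ ∈ P.interior) : hessian f ξ = hessian g ξ := by
  ext a b
  exact pderiv_congr_on (fun η hη => pderiv_congr_on h hη b) hξ a

/-- Cutting off produces functions with compact support in the open polygon. -/
theorem IsDelzant.contDiff_indicator_cutoff_mul (hP : P.IsDelzant) {R : ℝ} (hR : 0 < R)
    {F : Plane → ℝ} (hF : ContDiffOn ℝ 2 F P.interior) :
    ContDiff ℝ 2 (P.interior.indicator fun ξ => P.cutoff R ξ * F ξ) ∧
    HasCompactSupport (P.interior.indicator fun ξ => P.cutoff R ξ * F ξ) ∧
    tsupport (P.interior.indicator fun ξ => P.cutoff R ξ * F ξ) ⊆ P.interior := by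
  set G := P.interior.indicator fun ξ => P.cutoff R ξ * F ξ with hG
  set A := {ξ | ξ ∈ P.closed ∧ Real.exp (-R) ≤ P.prodL ξ} with hA
  have hcont : Continuous P.prodL := continuous_finsetProd _ fun i _ => P.continuous_l i
  have hAc : IsCompact A :=
    hP.isCompact_closed.inter_right (isClosed_le continuous_const hcont)
  have hAΔ : A ⊆ P.interior := fun ξ hξ i => by
    refine lt_of_le_of_ne (hP.l_nonneg hξ.1 i) fun h => ?_
    have : P.prodL ξ = 0 := Finset.prod_eq_zero (Finset.mem_univ i) h.symm
    have h2 := hξ.2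
    rw [this] at h2
    exact absurd (Real.exp_pos (-R)) (not_lt.2 h2)
  have hsupp : Function.support G ⊆ A := fun ξ hξ => by
    have hξΔ : ξ ∈ P.interior := mem_of_indicator_ne_zero hξ
    refine ⟨P.interior_subset_closed hξΔ, ?_⟩
    have h1 : P.cutoff R ξ ≠ 0 := fun h => hξ (by rw [hG, indicator_of_mem hξΔ, h, zero_mul])
    have h2 : 0 < 1 + P.logProd ξ / R := by
      by_contra hcon
      refine h1 ?_
      rw [cutoff, max_eq_left (not_lt.1 hcon)]
      norm_num
    have h3 : -R < P.logProd ξ := by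
      have : -1 < P.logProd ξ / R := by linarith
      rw [lt_div_iff₀ hR] at this
      linarith
    rw [logProd_eq hξΔ] at h3
    exact ((Real.lt_log_iff_exp_lt (prodL_pos hξΔ)).1 h3).le
  have hts : tsupport G ⊆ A := closure_minimal hsupp hAc.isClosed
  refine ⟨?_, HasCompactSupport.of_support_subset_isCompact hAc hsupp, hts.trans hAΔ⟩
  rw [contDiff_iff_contDiffAt]
  intro ξ
  by_cases hξ : ξ ∈ P.interior
  · refine (contDiffAt_of_interior ((contDiffOn_cutoff R).mul hF) hξ).congr_of_eventuallyEq ?_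
    filter_upwards [eventually_mem_interior hξ] with η hη
    exact indicator_of_mem hη _
  · have h0 : G =ᶠ[𝓝 ξ] fun _ => 0 := by
      filter_upwards [hAc.isClosed.isOpen_compl.mem_nhds fun h => hξ (hAΔ h)] with η hη
      by_contra h
      exact hη (hsupp h)
    exact contDiffAt_const.congr_of_eventuallyEq h0

/-- The cutoff functions are uniformly bounded, and on the support of the one with parameter `R` each
`|log l_i|` is `O(R)`, because the logarithms of the other `l_j` are bounded above. -/
theorem IsDelzant.exists_logProd_bounds (hP : P.IsDelzant) : ∃ Q : ℝ, 1 ≤ Q ∧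
    ∀ R : ℝ, 1 ≤ R → ∀ ξ ∈ P.interior, max 0 (1 + P.logProd ξ / R) ≤ Q ∧
      (0 < max 0 (1 + P.logProd ξ / R) → ∀ i, |Real.log (P.l i ξ)| ≤ Q * R) := by
  obtain ⟨B, hB1, hb0, hb1, -, hb3, -⟩ := hP.exists_prodL_le
  have hB0 : 0 < B := one_pos.trans_le hB1
  have hL := Real.log_nonneg hB1
  refine ⟨1 + Real.log B, by linarith, fun R hR ξ hξ => ?_⟩
  have hR0 : 0 < R := one_pos.trans_le hR
  have hle : P.logProd ξ ≤ Real.log B := by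
    rw [logProd_eq hξ]
    exact Real.log_le_log (prodL_pos hξ) (hb1 ξ hξ)
  constructor
  · refine max_le (by linarith) ?_
    have : P.logProd ξ / R ≤ Real.log B := by
      rw [div_le_iff₀ hR0]
      nlinarith
    linarith
  · intro hp i
    have h2 : 0 < 1 + P.logProd ξ / R := by
      by_contra hcon
      rw [max_eq_left (not_lt.1 hcon)] at hp
      exact hp.ne rfl
    have h3 : -R < P.logProd ξ := by
      have : -1 < P.logProd ξ / R := by linarith
      rw [lt_div_iff₀ hR0] at this
      linarith
    have hl := hξ i
    have h4 : P.logProd ξ - Real.log (P.l i ξ) ≤ Real.log B := by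
      rw [logProd_eq hξ, ← Real.log_div (prodL_pos hξ).ne' hl.ne']
      exact Real.log_le_log (div_pos (prodL_pos hξ) hl) (hb3 i ξ hξ)
    have h5 : Real.log (P.l i ξ) ≤ Real.log B :=
      Real.log_le_log hl (hb0 i ξ (P.interior_subset_closed hξ))
    rw [abs_le]
    constructor <;> nlinarith

/-- The error terms in the boundary estimate are dominated by an integrable function. -/
theorem IsDelzant.exists_error_le (hP : P.IsDelzant) : ∃ Q : ℝ, 0 < Q ∧
    ∀ R : ℝ, 1 ≤ R → ∀ ξ ∈ P.interior, max 0 (1 + P.logProd ξ / R) ≤ Q ∧ ∀ i,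
      (max 0 (1 + P.logProd ξ / R)) ^ 2 / R * (√(P.l i ξ))⁻¹ ≤
        Q * (P.l i ξ * (1 + Real.log (P.l i ξ) ^ 2))⁻¹ ∧
      max 0 (1 + P.logProd ξ / R) / R ^ 2 * (P.l i ξ)⁻¹ ≤
        Q * (P.l i ξ * (1 + Real.log (P.l i ξ) ^ 2))⁻¹ := by
  obtain ⟨q, hq1, hq⟩ := hP.exists_logProd_bounds
  obtain ⟨B, hB1, hB⟩ := hP.exists_l_le
  have hq0 : 0 < q := one_pos.trans_le hq1
  set K := B + 16 * (1 + B) ^ 2 with hK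
  have hK0 : 0 < K := by positivity
  refine ⟨q + q ^ 2 * K + q * (1 + q ^ 2), by positivity, fun R hR ξ hξ => ?_⟩
  obtain ⟨hp, hlog⟩ := hq R hR ξ hξ
  have hR0 : 0 < R := one_pos.trans_le hR
  set p := max 0 (1 + P.logProd ξ / R) with hpdef
  have hp0 : 0 ≤ p := le_max_left _ _
  have hz : 0 ≤ q ^ 2 * K := by positivity
  have hz' : 0 ≤ q * (1 + q ^ 2) := by positivity
  refine ⟨by linarith, fun i => ?_⟩
  have hl := hξ i
  set x := P.l i ξ with hx
  have hL : 0 < 1 + Real.log x ^ 2 := by positivity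
  constructor
  · have h1 := sqrt_mul_log_sq_le hB1 hl (hB i ξ (P.interior_subset_closed hξ))
    have hs : 0 < √x := Real.sqrt_pos.2 hl
    have hxx := Real.mul_self_sqrt hl.le
    calc p ^ 2 / R * (√x)⁻¹ ≤ q ^ 2 / 1 * (√x)⁻¹ := by gcongr
      _ ≤ q ^ 2 * (K * (x * (1 + Real.log x ^ 2))⁻¹) := by
        rw [div_one]
        gcongr
        rw [inv_le_iff_one_le_mul₀ hs, mul_assoc, inv_mul_eq_div, mul_div_assoc', le_div_iff₀
          (by positivity), one_mul]
        calc x * (1 + Real.log x ^ 2) = √x * (1 + Real.log x ^ 2) * √x := by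
              linear_combination (-(1 + Real.log x ^ 2)) * hxx
          _ ≤ K * √x := by gcongr
      _ ≤ _ := by
        rw [← mul_assoc]
        gcongr
        linarith
  · rcases hp0.eq_or_lt with h | h
    · rw [← h]
      simp only [zero_div, zero_mul]
      positivity
    · have h1 : 1 + Real.log x ^ 2 ≤ (1 + q ^ 2) * R ^ 2 := by
        have h2 := pow_le_pow_left₀ (abs_nonneg _) (hlog h i) 2
        rw [sq_abs] at h2
        nlinarith
      calc p / R ^ 2 * x⁻¹ ≤ q / R ^ 2 * x⁻¹ := by gcongr
        _ ≤ q * ((1 + q ^ 2) * (x * (1 + Real.log x ^ 2))⁻¹) := by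
          rw [div_mul_eq_mul_div, mul_div_assoc]
          gcongr
          rw [div_le_iff₀ (by positivity), mul_inv]
          calc x⁻¹ = x⁻¹ * 1 := (mul_one _).symm
            _ ≤ x⁻¹ * ((1 + q ^ 2) * R ^ 2 * (1 + Real.log x ^ 2)⁻¹) := by
              gcongr
              rw [← div_eq_mul_inv, le_div_iff₀ hL, one_mul]
              exact h1
            _ = _ := by ring
        _ ≤ _ := by
          rw [← mul_assoc]
          gcongr
          linarith [mul_pos hq0 hq0, hz]

/-- The inverse Hessian does not vanish faster than to first order in the direction `v_i` at the edge
`ℓ_i`: from `⟨v_i, n⟩² ≤ H⁻¹(v_i, v_i) H(n, n)` with `n` the unit normal, where `H(n, n)` is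
`1 / l_i` up to a bounded term. -/
theorem IsDelzant.exists_le_cometric (hP : P.IsDelzant) (i : Fin d) {u ψ : Plane → ℝ}
    (hψ : ContDiffOn ℝ ∞ ψ P.closed) (hu : ∀ ξ ∈ P.closed, u ξ = P.guillemin ξ + ψ ξ)
    (hpos : ∀ ξ ∈ P.interior, (hessian u ξ).PosDef) {μ : ℝ} (hμ : 0 < μ) :
    ∃ x₀ : ℝ, 0 < x₀ ∧ ∀ ξ ∈ P.interior, P.l i ξ ≤ x₀ → (∀ j, j ≠ i → μ ≤ P.l j ξ) →
      P.l i ξ / 2 ≤ cometric (hessian u ξ) (P.covec i) (P.covec i) := by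
  set n := P.unitNormal i
  obtain ⟨M, hM0, hM⟩ := hP.exists_bound_derivAlong₂ hψ n n
  set N := (∑ j ∈ Finset.univ.erase i, P.lin j n * P.lin j n / μ) + M with hN
  have hs0 : 0 ≤ ∑ j ∈ Finset.univ.erase i, P.lin j n * P.lin j n / μ :=
    Finset.sum_nonneg fun j _ => div_nonneg (mul_self_nonneg _) hμ.le
  have hN0 : 0 ≤ N := add_nonneg hs0 hM0
  refine ⟨(N + 1)⁻¹, by positivity, fun ξ hξ hx hj => ?_⟩
  have hl := hξ i
  have h1 := sq_pairing_le_cometric (hpos ξ hξ) (P.covec i) n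
  have h2 := secondDeriv_expand (contDiffAt_of_interior ((contDiffOn_potential hψ hu).of_le
    (WithTop.coe_le_coe.2 (le_top : (2 : ℕ∞) ≤ ⊤))) hξ) n n
  have h3 := hP.secondDeriv_eq_restHessian hψ i hu hξ n n
  rw [hP.lin_unitNormal] at h3
  have h4 : P.covec i 0 * n 0 + P.covec i 1 * n 1 = 1 := by
    have := hP.lin_unitNormal i
    rw [lin_apply] at this
    change (P.normal i 0 : ℝ) * P.unitNormal i 0 + (P.normal i 1 : ℝ) * P.unitNormal i 1 = 1
    linarith
  have h5 : P.restHessian i ψ n n ξ ≤ N := by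
    rw [restHessian, hN]
    refine add_le_add (Finset.sum_le_sum fun j hjm => ?_)
      ((le_abs_self _).trans (hM ξ (P.interior_subset_closed hξ)))
    exact div_le_div_of_nonneg_left (mul_self_nonneg _) hμ (hj j (Finset.ne_of_mem_erase hjm))
  rw [h4, ← h2, h3] at h1
  set a := cometric (hessian u ξ) (P.covec i) (P.covec i)
  have ha0 : 0 ≤ a := cometric_self_nonneg (hpos ξ hξ) _
  have h6 : P.l i ξ * N ≤ 1 := by
    have : P.l i ξ * (N + 1) ≤ 1 := by
      rw [← le_div_iff₀ (by positivity), one_div]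
      exact hx
    nlinarith
  have h7 : 1 ≤ a * (1 / P.l i ξ + N) := by
    have : a * (1 * 1 / P.l i ξ + P.restHessian i ψ n n ξ) ≤ a * (1 / P.l i ξ + N) := by
      rw [one_mul]
      gcongr
    linarith
  have h8 : P.l i ξ ≤ a * (1 + P.l i ξ * N) := by
    calc P.l i ξ = P.l i ξ * 1 := (mul_one _).symm
      _ ≤ P.l i ξ * (a * (1 / P.l i ξ + N)) := mul_le_mul_of_nonneg_left h7 hl.le
      _ = a * (1 + P.l i ξ * N) := by field_simp
  nlinarith

end Polygon

theorem abs_invTrace_le {H W : Matrix (Fin 2) (Fin 2) ℝ} (hH : H.PosDef) {C L : ℝ}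
    (hC : (H.det)⁻¹ * (H 0 0 + H 1 1) ≤ C) (hW : ∀ a b, |W a b| ≤ L) :
    |invTrace H W| ≤ 2 * C * L := by
  have hd := hH.det_pos
  have h := hH.offDiag_eq
  have h0 : 0 < H 0 0 := hH.diag_pos
  have h1 : 0 < H 1 1 := hH.diag_pos
  have hdet : 0 < H 0 0 * H 1 1 - H 0 1 * H 0 1 := by
    rw [Matrix.det_fin_two, h] at hd
    exact hd
  have h01 : |H 0 1| ≤ (H 0 0 + H 1 1) / 2 :=
    abs_le_of_sq_le_sq (by nlinarith [sq_nonneg (H 0 0 - H 1 1)]) (by linarith)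
  have hL : 0 ≤ L := (abs_nonneg _).trans (hW 0 0)
  have key : |H 1 1 * W 0 0 - H 0 1 * W 0 1 - H 1 0 * W 1 0 + H 0 0 * W 1 1| ≤
      2 * L * (H 0 0 + H 1 1) := by
    rw [h]
    have e1 : |H 1 1 * W 0 0| ≤ H 1 1 * L := by
      rw [abs_mul, abs_of_pos h1]; exact mul_le_mul_of_nonneg_left (hW _ _) h1.le
    have e2 : |H 0 0 * W 1 1| ≤ H 0 0 * L := by
      rw [abs_mul, abs_of_pos h0]; exact mul_le_mul_of_nonneg_left (hW _ _) h0.le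
    have e3 : ∀ a b, |H 0 1 * W a b| ≤ (H 0 0 + H 1 1) / 2 * L := fun a b => by
      rw [abs_mul]; exact mul_le_mul h01 (hW _ _) (abs_nonneg _) (by linarith)
    rw [abs_le] at e1 e2 ⊢
    have e4 := abs_le.1 (e3 0 1)
    have e5 := abs_le.1 (e3 1 0)
    constructor <;> linarith [e1.1, e1.2, e2.1, e2.2, e4.1, e4.2, e5.1, e5.2]
  rw [invTrace, abs_mul, abs_of_pos (inv_pos.2 hd)]
  calc H.det⁻¹ * _ ≤ H.det⁻¹ * (2 * L * (H 0 0 + H 1 1)) :=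
        mul_le_mul_of_nonneg_left key (inv_pos.2 hd).le
    _ = 2 * L * (H.det⁻¹ * (H 0 0 + H 1 1)) := by ring
    _ ≤ 2 * L * C := mul_le_mul_of_nonneg_left hC (by linarith)
    _ = 2 * C * L := by ring

namespace Polygon

variable {d : ℕ} {P : Polygon d}

theorem IsDelzant.volume_interior_ne_top (hP : P.IsDelzant) :
    (volume : Measure Plane) P.interior ≠ ⊤ :=
  hP.bounded.measure_lt_top.ne

theorem IsDelzant.integrableOn_of_continuousOn (hP : P.IsDelzant) {g : Plane → ℝ} {M : ℝ}
    (hg : ContinuousOn g P.interior) (hM : ∀ ξ ∈ P.interior, |g ξ| ≤ M) :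
    IntegrableOn g P.interior :=
  Integrable.mono' (integrableOn_const (C := M) hP.volume_interior_ne_top)
    (hg.aestronglyMeasurable P.measurableSet_interior)
    ((ae_restrict_mem P.measurableSet_interior).mono hM)

theorem continuousOn_invTrace {u f : Plane → ℝ} (hu : ContDiffOn ℝ ∞ u P.interior)
    (hf : ContDiffOn ℝ ∞ f P.interior) (hpos : ∀ ξ ∈ P.interior, (hessian u ξ).PosDef) :
    ContinuousOn (fun ξ => invTrace (hessian u ξ) (hessian f ξ)) P.interior := by
  have h1 := fun a b => (contDiffOn_hessian hu a b).continuousOn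
  have h2 := fun a b => (contDiffOn_hessian hf a b).continuousOn
  exact (contDiffOn_inv_det_hessian hu hpos).continuousOn.mul
    (((((h1 1 1).mul (h2 0 0)).sub ((h1 0 1).mul (h2 0 1))).sub ((h1 1 0).mul (h2 1 0))).add
      ((h1 0 0).mul (h2 1 1)))

theorem tendsto_posPart_logProd (ξ : Plane) :
    Tendsto (fun n : ℕ => max 0 (1 + P.logProd ξ / ((n : ℝ) + 1))) atTop (𝓝 1) := by
  have h1 : Tendsto (fun n : ℕ => 1 + P.logProd ξ / ((n : ℝ) + 1)) atTop (𝓝 (1 + 0)) :=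
    tendsto_const_nhds.add (tendsto_const_nhds.div_atTop
      (tendsto_natCast_atTop_atTop.atTop_add tendsto_const_nhds))
  have h2 := (tendsto_const_nhds (x := (0 : ℝ))).max h1
  simpa using h2

/-- On the part of a strip along `ℓ_i` where `l_i ≥ e^{-R/2}`, the cutoff function with parameter `R`
is bounded below as soon as `R` is large compared with the logarithms of the other `l_j`. -/
theorem le_logProd_div {i : Fin d} {ξ : Plane} (hξ : ξ ∈ P.interior) {μ R : ℝ} (hμ : 0 < μ)
    (hj : ∀ j, j ≠ i → μ ≤ P.l j ξ) (hR : 0 < R) (hRμ : -(d * Real.log (min μ 1)) ≤ R / 4)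
    (hx : Real.exp (-(R / 2)) ≤ P.l i ξ) : 1 / 4 ≤ max 0 (1 + P.logProd ξ / R) := by
  refine le_max_of_le_right ?_
  have hm : 0 < min μ 1 := lt_min hμ one_pos
  have hm0 : Real.log (min μ 1) ≤ 0 := Real.log_nonpos hm.le (min_le_right _ _)
  have h1 : -(R / 2) ≤ Real.log (P.l i ξ) := (Real.le_log_iff_exp_le (hξ i)).2 hx
  have h2 : (d : ℝ) * Real.log (min μ 1) ≤ ∑ j ∈ Finset.univ.erase i, Real.log (P.l j ξ) := by
    calc (d : ℝ) * Real.log (min μ 1) ≤ (Finset.univ.erase i).card * Real.log (min μ 1) := by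
          refine mul_le_mul_of_nonpos_right ?_ hm0
          have := Finset.card_le_univ (Finset.univ.erase i)
          rw [Fintype.card_fin] at this
          exact_mod_cast this
      _ = ∑ j ∈ Finset.univ.erase i, Real.log (min μ 1) := by simp
      _ ≤ _ := Finset.sum_le_sum fun j hjm => Real.log_le_log hm
          ((min_le_left _ _).trans (hj j (Finset.ne_of_mem_erase hjm)))
  have h3 : P.logProd ξ = Real.log (P.l i ξ) +
      ∑ j ∈ Finset.univ.erase i, Real.log (P.l j ξ) :=
    (Finset.add_sum_erase _ _ (Finset.mem_univ i)).symm
  have h4 : -(3 / 4) ≤ P.logProd ξ / R := by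
    rw [le_div_iff₀ hR]
    linarith
  linarith

/-- The boundary estimate. If `f ≤ u` is smooth in `Δ` with bounded first and second derivatives and
`u - f ≥ ε` in a strip along a segment `-r ≤ y ≤ r` of the edge `ℓ_i`, then the integral of
`2 - tr ((∂²u)⁻¹ ∂²f) + K_o (u - f)` is at least `c ε r`, with `c` depending on the edge only.

Formally, integrating `U^{ij} ∂²_{ij} w` by parts against `u - f` leaves a boundary integral of
`u - f` over the edges, with the universal density that the poles `1 / l_i` of the Hessian produce.
Here the boundary integral is the limit `R → ∞` of the contribution of the cutoff functions, and the
constants `L`, `M`, `δ`, `μ` only enter through terms that vanish in this limit. -/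
theorem IsDelzant.exists_boundary_estimate (hP : P.IsDelzant) (i : Fin d) :
    ∃ c : ℝ, 0 < c ∧ ∀ {Ko M L ε δ r μ : ℝ} {u ψ f : Plane → ℝ} {q : Plane},
      ContDiffOn ℝ ∞ ψ P.closed → (∀ ξ ∈ P.closed, u ξ = P.guillemin ξ + ψ ξ) →
      (∀ ξ ∈ P.interior, (hessian u ξ).PosDef) →
      (∀ ξ ∈ P.interior, |scalarCurvature u ξ| ≤ Ko) →
      ContDiffOn ℝ ∞ f P.interior → (∀ ξ ∈ P.interior, ∀ a, |pderiv a f ξ| ≤ L) →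
      (∀ ξ ∈ P.interior, ∀ a b, |hessian f ξ a b| ≤ L) →
      (∀ ξ ∈ P.interior, 0 ≤ u ξ - f ξ ∧ u ξ - f ξ ≤ M) →
      P.l i q = 0 → 0 ≤ ε → 0 < δ → 0 ≤ r → 0 < μ →
      (∀ z ∈ Icc 0 δ ×ˢ Icc (-r) r, ∀ j, j ≠ i → μ ≤ P.l j (P.edgeChart i q z)) →
      (∀ z ∈ Ioc 0 δ ×ˢ Icc (-r) r,
        ε ≤ u (P.edgeChart i q z) - f (P.edgeChart i q z)) →
      c * (ε * r) ≤ ∫ ξ in P.interior,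
        (2 - invTrace (hessian u ξ) (hessian f ξ) + Ko * (u ξ - f ξ)) := by
  obtain ⟨c, hc0, hc⟩ := hP.exists_integral_inv_l i
  refine ⟨3 / 64 * c, by positivity, ?_⟩
  intro Ko M L ε δ r μ u ψ f q hψ hu hpos hS hf hfL hfLL hF hq hε hδ hr hμ hstrip hFε
  have h2 : (2 : WithTop ℕ∞) ≤ ∞ := WithTop.coe_le_coe.2 (le_top : (2 : ℕ∞) ≤ ⊤)
  have huC := contDiffOn_potential hψ hu
  have hu2 := huC.of_le h2
  have hf2 := hf.of_le h2
  obtain ⟨ξ₀, hξ₀⟩ := hP.nonempty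
  have hM0 : 0 ≤ M := (hF ξ₀ hξ₀).1.trans (hF ξ₀ hξ₀).2
  have hKo0 : 0 ≤ Ko := (abs_nonneg _).trans (hS ξ₀ hξ₀)
  have hL0 : 0 ≤ L := (abs_nonneg _).trans (hfL ξ₀ hξ₀ 0)
  obtain ⟨C₁, hC₁0, hC₁⟩ := hP.exists_cometric_le hψ hu hpos hS
  obtain ⟨C₂, hC₂0, hC₂⟩ := hP.exists_abs_cometric_grad_le hψ hu hpos hS
    (ζ := fun ξ a => -pderiv a f ξ) (M := L) (fun ξ hξ a => by rw [abs_neg]; exact hfL ξ hξ a)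
  set C := max C₁ C₂ with hC
  have hC0 : 0 ≤ C := hC₁0.le.trans (le_max_left _ _)
  obtain ⟨x₀, hx₀, hcom⟩ := hP.exists_le_cometric i hψ hu hpos hμ
  obtain ⟨Q, hQ0, hQ⟩ := hP.exists_error_le
  set Φ : Plane → ℝ := fun ξ => 2 - invTrace (hessian u ξ) (hessian f ξ) + Ko * (u ξ - f ξ)
    with hΦ
  set p : ℕ → Plane → ℝ := fun n ξ => max 0 (1 + P.logProd ξ / ((n : ℝ) + 1)) with hp
  set E : ℕ → Plane → ℝ := fun n ξ => P.cutoff ((n : ℝ) + 1) ξ * Φ ξ +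
    (6 * C * p n ξ ^ 2 / ((n : ℝ) + 1) * ∑ j, (√(P.l j ξ))⁻¹ +
      6 * M * C * d * p n ξ / ((n : ℝ) + 1) ^ 2 * ∑ j, (P.l j ξ)⁻¹) with hE
  set D : Plane → ℝ := fun ξ => ∑ j, (P.l j ξ * (1 + Real.log (P.l j ξ) ^ 2))⁻¹ with hD
  have hcF : ∀ ξ ∈ P.interior, grad (fun η => u η - f η) ξ =
      grad u ξ + fun a => -pderiv a f ξ := fun ξ hξ => by
    funext a
    have := fderiv_fun_sub ((contDiffAt_of_interior hu2 hξ).differentiableAt two_ne_zero)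
      ((contDiffAt_of_interior hf2 hξ).differentiableAt two_ne_zero)
    simp only [grad, pderiv, Pi.add_apply, this]
    simp [sub_eq_add_neg]
  -- the functions `E n` converge to `Φ` pointwise and are dominated by an integrable function
  have hΦM : ∀ ξ ∈ P.interior, |Φ ξ| ≤ 2 + 2 * C₁ * L + Ko * M := fun ξ hξ => by
    have h1 := abs_invTrace_le (hpos ξ hξ) (hC₁ ξ hξ).2 (hfLL ξ hξ)
    have h3 := mul_le_mul_of_nonneg_left (hF ξ hξ).2 hKo0
    have h4 := mul_nonneg hKo0 (hF ξ hξ).1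
    rw [abs_le] at h1 ⊢
    constructor <;> simp only [hΦ] <;> linarith [h1.1, h1.2, h3, h4]
  set N := 2 + 2 * C₁ * L + Ko * M with hN
  have hN0 : 0 ≤ N := by positivity
  have hΦc : ContinuousOn Φ P.interior :=
    (continuousOn_const.sub (continuousOn_invTrace huC hf hpos)).add
      (continuousOn_const.mul (huC.continuousOn.sub hf.continuousOn))
  have hEc : ∀ n, ContinuousOn (E n) P.interior := fun n => by
    have hpc : ContinuousOn (p n) P.interior :=
      continuousOn_const.sup (continuousOn_const.add
        ((contDiffOn_logProd (n := 0)).continuousOn.div_const _))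
    have hl : ∀ j, ContinuousOn (fun ξ => P.l j ξ) P.interior := fun j =>
      (P.continuous_l j).continuousOn
    refine ((contDiffOn_cutoff _).continuousOn.mul hΦc).add (ContinuousOn.add ?_ ?_)
    · exact ((continuousOn_const.mul (hpc.pow 2)).div_const _).mul
        (continuousOn_finsetSum _ fun j _ => (hl j).sqrt.inv₀ fun ξ hξ =>
          (Real.sqrt_pos.2 (hξ j)).ne')
    · exact ((continuousOn_const.mul hpc).div_const _).mul
        (continuousOn_finsetSum _ fun j _ => (hl j).inv₀ fun ξ hξ => (hξ j).ne')
  have hDi : IntegrableOn D P.interior :=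
    integrable_finsetSum _ fun j _ => hP.integrableOn_inv_l_log_sq j
  set bd : Plane → ℝ := fun ξ => Q ^ 3 * N + (6 * C * Q + 6 * M * C * d * Q) * D ξ with hbd
  have hbdi : IntegrableOn bd P.interior :=
    (integrableOn_const hP.volume_interior_ne_top).add (hDi.const_mul _)
  have hEbd : ∀ n, ∀ ξ ∈ P.interior, ‖E n ξ‖ ≤ bd ξ := fun n ξ hξ => by
    obtain ⟨hpQ, herr⟩ := hQ ((n : ℝ) + 1) (by simp) ξ hξ
    have hp0 : 0 ≤ p n ξ := le_max_left _ _
    have e1 : |P.cutoff ((n : ℝ) + 1) ξ * Φ ξ| ≤ Q ^ 3 * N := by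
      rw [abs_mul, cutoff, abs_of_nonneg (pow_nonneg hp0 3)]
      exact mul_le_mul (pow_le_pow_left₀ hp0 hpQ 3) (hΦM ξ hξ) (abs_nonneg _) (by positivity)
    have e2 : 6 * C * p n ξ ^ 2 / ((n : ℝ) + 1) * ∑ j, (√(P.l j ξ))⁻¹ ≤ 6 * C * (Q * D ξ) := by
      rw [mul_div_assoc, mul_assoc]
      refine mul_le_mul_of_nonneg_left ?_ (by positivity)
      rw [hD, Finset.mul_sum, Finset.mul_sum]
      exact Finset.sum_le_sum fun j _ => (herr j).1
    have e3 : 6 * M * C * d * p n ξ / ((n : ℝ) + 1) ^ 2 * ∑ j, (P.l j ξ)⁻¹ ≤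
        6 * M * C * d * (Q * D ξ) := by
      rw [mul_div_assoc, mul_assoc]
      refine mul_le_mul_of_nonneg_left ?_ (by positivity)
      rw [hD, Finset.mul_sum, Finset.mul_sum]
      exact Finset.sum_le_sum fun j _ => (herr j).2
    have e4 : 0 ≤ 6 * C * p n ξ ^ 2 / ((n : ℝ) + 1) * ∑ j, (√(P.l j ξ))⁻¹ := by positivity
    have e5 : 0 ≤ 6 * M * C * d * p n ξ / ((n : ℝ) + 1) ^ 2 * ∑ j, (P.l j ξ)⁻¹ :=
      mul_nonneg (by positivity) (Finset.sum_nonneg fun j _ => inv_nonneg.2 (hξ j).le)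
    rw [Real.norm_eq_abs]
    rw [abs_le] at e1 ⊢
    constructor <;> simp only [hE, hbd] <;> linarith [e1.1, e1.2]
  have hEi : ∀ n, IntegrableOn (E n) P.interior := fun n =>
    Integrable.mono' hbdi ((hEc n).aestronglyMeasurable P.measurableSet_interior)
      ((ae_restrict_mem P.measurableSet_interior).mono (hEbd n))
  have hlim : Tendsto (fun n => ∫ ξ in P.interior, E n ξ) atTop (𝓝 (∫ ξ in P.interior, Φ ξ)) := by
    refine tendsto_integral_of_dominated_convergence bd
      (fun n => (hEc n).aestronglyMeasurable P.measurableSet_interior) hbdi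
      (fun n => (ae_restrict_mem P.measurableSet_interior).mono (hEbd n)) (ae_of_all _ fun ξ => ?_)
    have t1 : Tendsto (fun n => p n ξ) atTop (𝓝 1) := tendsto_posPart_logProd ξ
    have t2 : Tendsto (fun n : ℕ => (n : ℝ) + 1) atTop atTop :=
      tendsto_natCast_atTop_atTop.atTop_add tendsto_const_nhds
    have t3 : Tendsto (fun n : ℕ => ((n : ℝ) + 1) ^ 2) atTop atTop :=
      (tendsto_pow_atTop two_ne_zero).comp t2
    have t4 := (((t1.pow 3).mul_const (Φ ξ)).add
      (((((t1.pow 2).const_mul (6 * C)).div_atTop t2).mul_const (∑ j, (√(P.l j ξ))⁻¹)).add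
      (((t1.const_mul (6 * M * C * d)).div_atTop t3).mul_const (∑ j, (P.l j ξ)⁻¹))))
    simp only [one_pow, one_mul, zero_mul, add_zero] at t4
    exact t4
  -- the contribution of the strip
  refine ge_of_tendsto hlim ?_
  have ev : ∀ᶠ n : ℕ in atTop, -(d * Real.log (min μ 1)) ≤ ((n : ℝ) + 1) / 4 ∧
      Real.exp (-(((n : ℝ) + 1) / 4)) ≤ min x₀ δ := by
    have t2 : Tendsto (fun n : ℕ => ((n : ℝ) + 1) / 4) atTop atTop :=
      (tendsto_natCast_atTop_atTop.atTop_add tendsto_const_nhds).atTop_div_const (by norm_num)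
    refine (t2.eventually_ge_atTop _).and ?_
    have t3 := (Real.tendsto_exp_atBot.comp (tendsto_neg_atTop_atBot.comp t2))
    exact t3.eventually_le_const (lt_min hx₀ hδ)
  filter_upwards [ev] with n hn
  set R : ℝ := (n : ℝ) + 1 with hR
  have hR0 : 0 < R := by positivity
  obtain ⟨hGC, hGc, hGs⟩ := hP.contDiff_indicator_cutoff_mul hR0 (hu2.sub hf2)
  set G := P.interior.indicator fun ξ => P.cutoff R ξ * (u ξ - f ξ) with hG
  obtain ⟨hGi, hG0⟩ := integral_invTrace_add huC hpos hGC hGc hGs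
  set T : Plane → ℝ := fun ξ => invTrace (hessian u ξ) (hessian G ξ) + scalarCurvature u ξ * G ξ
    with hT
  -- off `Δ` the integrand vanishes: `G` is zero near every point outside its support
  have hT0 : ∫ ξ in P.interior, T ξ = 0 := by
    rw [← hG0]
    refine setIntegral_eq_integral_of_forall_compl_eq_zero fun ξ hξ => ?_
    have hξ' : ξ ∉ tsupport G := fun h => hξ (hGs h)
    have hG00 : G =ᶠ[𝓝 ξ] fun _ => 0 := notMem_tsupport_iff_eventuallyEq.1 hξ'
    have hh : hessian G ξ = 0 := by
      have e1 : ∀ b, pderiv b G =ᶠ[𝓝 ξ] fun _ => 0 := fun b => by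
        filter_upwards [hG00.eventually_nhds] with η hη
        rw [pderiv, (show G =ᶠ[𝓝 η] fun _ => 0 from hη).fderiv_eq]
        simp
      ext a b
      change pderiv a (pderiv b G) ξ = 0
      rw [pderiv, (e1 b).fderiv_eq]
      simp
    change invTrace (hessian u ξ) (hessian G ξ) + scalarCurvature u ξ * G ξ = 0
    rw [hh, hG00.eq_of_nhds]
    simp [invTrace]
  have hpt : ∀ ξ ∈ P.interior, (u ξ - f ξ) * (3 * p n ξ ^ 2 / R *
      ((P.l i ξ ^ 2)⁻¹ * cometric (hessian u ξ) (P.covec i) (P.covec i))) ≤ -T ξ + E n ξ :=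
    fun ξ hξ => by
      have h := cutoff_pointwise hu2 hf2 hξ (hpos ξ hξ) hR0 hC0
        ((le_abs_self _).trans (hS ξ hξ))
        (fun j => ((hC₁ ξ hξ).1 j).trans
          (mul_le_mul_of_nonneg_right (le_max_left _ _) (hξ j).le))
        (fun j => by
          rw [hcF ξ hξ]
          exact (hC₂ ξ hξ j).trans
            (mul_le_mul_of_nonneg_right (le_max_right _ _) (Real.sqrt_nonneg _)))
        (hF ξ hξ).1 (hF ξ hξ).2 i
      have e1 : G ξ = P.cutoff R ξ * (u ξ - f ξ) := indicator_of_mem hξ _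
      have e2 : hessian G ξ = hessian (fun η => P.cutoff R η * (u η - f η)) ξ :=
        hessian_congr_on (fun η hη => indicator_of_mem hη _) hξ
      simp only [hT, e1, e2]
      exact h
  -- Part of the region where the derivative of the cutoff function lives, seen on the scale of
  -- `log l_i`: of length `R / 4`, which compensates the factor `1 / R` in that derivative, and such
  -- that `Θ'` is bounded below on it.
  set a := Real.exp (-(R / 2)) with ha
  set b := Real.exp (-(R / 4)) with hb
  have ha0 : 0 < a := Real.exp_pos _
  have hab : a ≤ b := Real.exp_le_exp.2 (by linarith)
  obtain ⟨hci, hcv⟩ := hc q hq a b r ha0 hab hr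
  set Z := P.edgeChart i q '' (Icc a b ×ˢ Icc (-r) r) with hZ
  have hlz : ∀ z : ℝ × ℝ, P.l i (P.edgeChart i q z) = z.1 := fun z => by
    rw [hP.l_edgeChart, hq, zero_add]
  have hzz : ∀ z ∈ Icc a b ×ˢ Icc (-r) r, z ∈ Ioc 0 δ ×ˢ Icc (-r) r := fun z hz =>
    ⟨⟨ha0.trans_le hz.1.1, hz.1.2.trans (hn.2.trans (min_le_right _ _))⟩, hz.2⟩
  have hzz' : ∀ z ∈ Icc a b ×ˢ Icc (-r) r, z ∈ Icc 0 δ ×ˢ Icc (-r) r := fun z hz =>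
    ⟨Ioc_subset_Icc_self (hzz z hz).1, hz.2⟩
  have hZΔ : Z ⊆ P.interior := by
    rintro _ ⟨z, hz, rfl⟩ j
    rcases eq_or_ne j i with rfl | hji
    · rw [hlz]; exact (hzz z hz).1.1
    · exact hμ.trans_le (hstrip z (hzz' z hz) j hji)
  have hZm : MeasurableSet Z :=
    (hP.measurableEmbedding_edgeChart i q).measurableSet_image.2
      (measurableSet_Icc.prod measurableSet_Icc)
  have hlow : ∀ ξ ∈ Z, 3 * ε / (32 * R) * (P.l i ξ)⁻¹ ≤ -T ξ + E n ξ := by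
    rintro _ ⟨z, hz, rfl⟩
    have hΔ := hZΔ (mem_image_of_mem _ hz)
    have hj := hstrip z (hzz' z hz)
    have hε' := hFε z (hzz z hz)
    have hp4 := le_logProd_div hΔ hμ hj hR0 hn.1 (by rw [hlz]; exact hz.1.1)
    have hcm := hcom _ hΔ (by rw [hlz]; exact hz.1.2.trans (hn.2.trans (min_le_left _ _))) hj
    refine le_trans ?_ (hpt _ hΔ)
    set ξ := P.edgeChart i q z
    have hl := hΔ i
    have hF0 := (hF ξ hΔ).1
    have hp2 : (1 / 4 : ℝ) ^ 2 ≤ p n ξ ^ 2 := pow_le_pow_left₀ (by norm_num) hp4 2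
    calc 3 * ε / (32 * R) * (P.l i ξ)⁻¹ =
          ε * (3 * (1 / 4) ^ 2 / R * ((P.l i ξ ^ 2)⁻¹ * (P.l i ξ / 2))) := by
          field_simp; ring
      _ ≤ _ := by gcongr
  have hTi : IntegrableOn (fun ξ => -T ξ + E n ξ) P.interior :=
    hGi.neg.integrableOn.add (hEi n)
  calc 3 / 64 * c * (ε * r) = ∫ ξ in Z, 3 * ε / (32 * R) * (P.l i ξ)⁻¹ := by
        rw [integral_const_mul, hcv, Real.log_exp, Real.log_exp]
        field_simp
        ring
    _ ≤ ∫ ξ in Z, (-T ξ + E n ξ) :=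
        setIntegral_mono_on (hci.const_mul _) (hTi.mono_set hZΔ) hZm hlow
    _ ≤ ∫ ξ in P.interior, (-T ξ + E n ξ) := by
        refine setIntegral_mono_set hTi ?_ hZΔ.eventuallyLE
        filter_upwards [ae_restrict_mem P.measurableSet_interior] with ξ hξ
        refine le_trans ?_ (hpt ξ hξ)
        exact mul_nonneg (hF ξ hξ).1 (mul_nonneg (by positivity)
          (mul_nonneg (by positivity) (cometric_self_nonneg (hpos ξ hξ) _)))
    _ = ∫ ξ in P.interior, E n ξ := by
        rw [integral_add (f := fun ξ => -T ξ) hGi.neg.integrableOn (hEi n), integral_neg, hT0]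
        simp

end Polygon

/-! ### Convexity up to the boundary -/

/-- The arithmetic-geometric mean inequality `tr (H⁻¹ W) ≥ 2 (det W / det H)^{1/2}`, squared. -/
theorem four_mul_det_le_sq_invTrace {H W : Matrix (Fin 2) (Fin 2) ℝ} (hH : H.PosDef)
    (hW : W.PosDef) : 0 ≤ invTrace H W ∧ 4 * (W.det / H.det) ≤ invTrace H W ^ 2 := by
  have hD := hH.det_pos
  have hN := hW.det_pos
  have h := hH.offDiag_eq
  have w := hW.offDiag_eq
  have h0 : 0 < H 0 0 := hH.diag_pos
  have h1 : 0 < H 1 1 := hH.diag_pos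
  have w0 : 0 < W 0 0 := hW.diag_pos
  have w1 : 0 < W 1 1 := hW.diag_pos
  have eD : H.det = H 0 0 * H 1 1 - H 0 1 * H 0 1 := by rw [Matrix.det_fin_two, h]
  have eN : W.det = W 0 0 * W 1 1 - W 0 1 * W 0 1 := by rw [Matrix.det_fin_two, w]
  set D := H.det
  set N := W.det
  set X := H 1 1 * W 0 0 with hX
  set Y := H 0 0 * W 1 1 with hY
  have hX0 : 0 < X := mul_pos h1 w0
  have hY0 : 0 < Y := mul_pos h0 w1
  set z := H 0 1 * W 0 1 with hz
  set m := √(D * N) with hm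
  have hm0 : 0 < m := Real.sqrt_pos.2 (mul_pos hD hN)
  have hm2 : m ^ 2 = D * N := Real.sq_sqrt (mul_pos hD hN).le
  have hXY : X * Y = (D + H 0 1 ^ 2) * (N + W 0 1 ^ 2) := by
    rw [eD, eN, hX, hY]; ring
  have hcs : 2 * (m * |z|) ≤ D * W 0 1 ^ 2 + N * H 0 1 ^ 2 := by
    refine abs_le_of_sq_le_sq' ?_ (by positivity) |>.2
    have : (2 * (m * |z|)) ^ 2 = 4 * (D * N) * (H 0 1 * W 0 1) ^ 2 := by
      rw [mul_pow, mul_pow, hm2, sq_abs, hz]; ring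
    rw [this]
    nlinarith [sq_nonneg (D * W 0 1 ^ 2 - N * H 0 1 ^ 2)]
  have hsum : 2 * (m + |z|) ≤ X + Y := by
    refine abs_le_of_sq_le_sq' ?_ (by positivity) |>.2
    have hz2 : |z| ^ 2 = H 0 1 ^ 2 * W 0 1 ^ 2 := by rw [sq_abs, hz]; ring
    nlinarith [sq_nonneg (X - Y)]
  have hT : invTrace H W = D⁻¹ * (X + Y - 2 * z) := by
    rw [invTrace, h, w]; ring
  have hlow : 2 * m ≤ X + Y - 2 * z := by
    have := le_abs_self z
    linarith
  rw [hT]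
  refine ⟨mul_nonneg (inv_pos.2 hD).le (by linarith), ?_⟩
  have h4 : 4 * m ^ 2 ≤ (X + Y - 2 * z) ^ 2 := by nlinarith
  rw [hm2] at h4
  calc 4 * (N / D) = D⁻¹ ^ 2 * (4 * (D * N)) := by field_simp
    _ ≤ D⁻¹ ^ 2 * (X + Y - 2 * z) ^ 2 := by gcongr
    _ = _ := by ring

/-- A lower bound for `tr (H⁻¹ W)` that is a bounded function of the two determinants and extends
continuously to degenerate `H`. It follows from the arithmetic-geometric mean inequality since
`√x ≥ min (x, 1)` for `x = det W / det H`. -/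
theorem two_mul_det_div_max_le_invTrace {H W : Matrix (Fin 2) (Fin 2) ℝ} (hH : H.PosDef)
    (hW : W.PosDef) : 2 * (W.det / max W.det H.det) ≤ invTrace H W := by
  obtain ⟨h0, h1⟩ := four_mul_det_le_sq_invTrace hH hW
  have hD := hH.det_pos
  have hN := hW.det_pos
  refine abs_le_of_sq_le_sq' ?_ h0 |>.2
  refine le_trans ?_ h1
  rcases le_total H.det W.det with h | h
  · rw [max_eq_left h, div_self hN.ne']
    have : 1 ≤ W.det / H.det := (one_le_div hD).2 h
    linarith
  · rw [max_eq_right h]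
    have h2 : W.det / H.det ≤ 1 := (div_le_one hD).2 h
    have h3 : 0 ≤ W.det / H.det := (div_pos hN hD).le
    nlinarith

namespace Polygon

variable {d : ℕ} {P : Polygon d}

theorem convexOn_interior_of_posDef {u : Plane → ℝ} (hu : ContDiffOn ℝ 2 u P.interior)
    (hpos : ∀ ξ ∈ P.interior, (hessian u ξ).PosDef) : ConvexOn ℝ P.interior u := by
  refine ⟨P.convex_interior, fun x hx y hy a b ha hb hab => ?_⟩
  set v := y - x with hv
  set γ : ℝ → Plane := fun s => x + s • v with hγ
  have hmem : ∀ s ∈ Icc (0 : ℝ) 1, γ s ∈ P.interior := fun s hs => by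
    have := P.convex_interior hx hy (sub_nonneg.2 hs.2) hs.1 (by ring)
    convert this using 1
    simp only [hγ, hv]
    module
  have hγd : ∀ s, HasDerivAt γ v s := fun s => by
    have := ((hasDerivAt_id s).smul_const v).const_add x
    rwa [one_smul] at this
  have hc : ConvexOn ℝ (Icc (0 : ℝ) 1) (u ∘ γ) := by
    refine convexOn_of_hasDerivWithinAt2_nonneg (convex_Icc 0 1)
      (f' := fun s => fderiv ℝ u (γ s) v) (f'' := fun s => secondDeriv v v u (γ s)) ?_ ?_ ?_ ?_
    · refine hu.continuousOn.comp (fun s _ => (hγd s).continuousAt.continuousWithinAt) hmem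
    · intro s hs
      have h1 := contDiffAt_of_interior hu (hmem s (interior_subset hs))
      exact ((h1.differentiableAt two_ne_zero).hasFDerivAt.comp_hasDerivAt s (hγd s)
        ).hasDerivWithinAt
    · intro s hs
      have h1 := contDiffAt_of_interior hu (hmem s (interior_subset hs))
      exact ((differentiableAt_fderiv_apply h1 v).hasFDerivAt.comp_hasDerivAt s (hγd s)
        ).hasDerivWithinAt
    · intro s hs
      have hΔ := hmem s (interior_subset hs)
      rw [secondDeriv_expand (contDiffAt_of_interior hu hΔ)]
      have := (hpos _ hΔ).posSemidef.dotProduct_mulVec_nonneg (fun a => v a)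
      simp [Matrix.mulVec, dotProduct, Fin.sum_univ_two] at this
      linarith
  have h := hc.2 (left_mem_Icc.2 zero_le_one) (right_mem_Icc.2 zero_le_one) ha hb hab
  have e0 : γ 0 = x := by simp [hγ]
  have e1 : γ 1 = y := by simp [hγ, hv]
  have e2 : γ (a • 0 + b • 1) = a • x + b • y := by
    simp only [hγ, hv, smul_eq_mul, mul_zero, mul_one, zero_add]
    rw [eq_sub_of_add_eq hab]
    module
  simpa only [Function.comp, e0, e1, e2] using h

theorem IsDelzant.tendsto_contract (hP : P.IsDelzant) {p ξ : Plane} (hp : p ∈ P.interior)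
    (hξ : ξ ∈ P.closed) :
    Tendsto (fun t : ℝ => (1 - t) • p + t • ξ) (𝓝[<] 1) (𝓝[P.interior] ξ) := by
  refine tendsto_nhdsWithin_iff.2 ⟨?_, ?_⟩
  · have : Tendsto (fun t : ℝ => (1 - t) • p + t • ξ) (𝓝 1)
        (𝓝 ((1 - (1 : ℝ)) • p + (1 : ℝ) • ξ)) := Continuous.tendsto (by fun_prop) 1
    simp only [sub_self, zero_smul, one_smul, zero_add] at this
    exact this.mono_left nhdsWithin_le_nhds
  · have h0 : ∀ᶠ t : ℝ in 𝓝[<] 1, 0 < t := nhdsWithin_le_nhds (lt_mem_nhds one_pos)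
    filter_upwards [h0, self_mem_nhdsWithin] with t ht ht1
    exact hP.contract_mem hp hξ ht.le ht1

theorem IsDelzant.convexOn_closed (hP : P.IsDelzant) {f : Plane → ℝ}
    (hf : ConvexOn ℝ P.interior f) (hc : ContinuousOn f P.closed) : ConvexOn ℝ P.closed f := by
  obtain ⟨p, hp⟩ := hP.nonempty
  refine ⟨P.convex_closed, fun x hx y hy a b ha hb hab => ?_⟩
  have hl : ∀ ξ ∈ P.closed, Tendsto (fun t : ℝ => f ((1 - t) • p + t • ξ)) (𝓝[<] 1) (𝓝 (f ξ)) :=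
    fun ξ hξ => ((hc ξ hξ).mono P.interior_subset_closed).tendsto.comp (hP.tendsto_contract hp hξ)
  refine le_of_tendsto_of_tendsto (hl _ (P.convex_closed hx hy ha hb hab))
    (((hl x hx).const_mul a).add ((hl y hy).const_mul b)) ?_
  have h0 : ∀ᶠ t : ℝ in 𝓝[<] 1, 0 < t := nhdsWithin_le_nhds (lt_mem_nhds one_pos)
  filter_upwards [h0, self_mem_nhdsWithin] with t ht ht1
  have h := hf.2 (hP.contract_mem hp hx ht.le ht1) (hP.contract_mem hp hy ht.le ht1) ha hb hab
  have e : a • ((1 - t) • p + t • x) + b • ((1 - t) • p + t • y) =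
      (1 - t) • p + t • (a • x + b • y) := by
    rw [eq_sub_of_add_eq hab]
    module
  rw [e] at h
  exact h

/-- A bounded function converges along `F` if each of its values `f y` eventually exceeds the later
values by at most an error that tends to zero with `y`: then `limsup f ≤ liminf f`. -/
theorem _root_.Filter.exists_tendsto_of_forall_eventually_le {α : Type*} {F : Filter α} [F.NeBot]
    {f φ : α → ℝ} (hφ : Tendsto φ F (𝓝 0)) (h : ∀ᶠ y in F, ∀ᶠ x in F, f y ≤ f x + φ y)
    (hb : ∃ a b, ∀ᶠ x in F, a ≤ f x ∧ f x ≤ b) : ∃ c, Tendsto f F (𝓝 c) := by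
  obtain ⟨a, b, hab⟩ := hb
  have hbd : F.IsBoundedUnder (· ≤ ·) f := ⟨b, eventually_map.2 (hab.mono fun x hx => hx.2)⟩
  have hbd' : F.IsBoundedUnder (· ≥ ·) f := ⟨a, eventually_map.2 (hab.mono fun x hx => hx.1)⟩
  refine ⟨liminf f F, tendsto_of_le_liminf_of_limsup_le le_rfl ?_ hbd hbd'⟩
  refine le_of_forall_pos_le_add fun ε hε => ?_
  refine limsup_le_of_le hbd'.isCoboundedUnder_flip ?_
  filter_upwards [h, hφ.eventually_lt_const hε] with y hy hyε
  have : f y - φ y ≤ liminf f F :=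
    le_liminf_of_le hbd.isCoboundedUnder_flip (hy.mono fun x hx => by linarith)
  linarith

/-- A bounded convex function on an open polygon has limits at the boundary (this fails for
general convex domains). -/
theorem IsDelzant.exists_tendsto_of_convexOn (hP : P.IsDelzant) {f : Plane → ℝ}
    (hf : ConvexOn ℝ P.interior f) {C : ℝ}
    (hC : ∀ ξ ∈ P.interior, ∀ η ∈ P.interior, |f ξ - f η| ≤ C) {x₀ : Plane}
    (hx₀ : x₀ ∈ P.closed) : ∃ c, Tendsto f (𝓝[P.interior] x₀) (𝓝 c) := by
  by_cases hxΔ : x₀ ∈ P.interior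
  · exact ⟨f x₀, hf.continuousOn P.isOpen_interior x₀ hxΔ⟩
  have : (𝓝[P.interior] x₀).NeBot := mem_closure_iff_nhdsWithin_neBot.1 hx₀
  obtain ⟨p, hp⟩ := hP.nonempty
  have hC0 : 0 ≤ C := (abs_nonneg _).trans (hC p hp p hp)
  -- `A` times the distance to `x₀` bounds the oscillation, because at a distance `1 / A` from
  -- `x₀` no inequality that is strict at `x₀` is violated
  obtain ⟨κ, hκ0, hκ⟩ : ∃ κ : ℝ, 0 < κ ∧ ∀ i, 0 < P.l i x₀ → κ ≤ P.l i x₀ := by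
    classical
    rcases (Finset.univ.filter fun i => 0 < P.l i x₀).eq_empty_or_nonempty with h | h
    · refine ⟨1, one_pos, fun i hi => ?_⟩
      have : i ∈ Finset.univ.filter fun i => 0 < P.l i x₀ := by simp [hi]
      rw [h] at this
      simp at this
    · obtain ⟨j, hj, hmin⟩ := Finset.exists_min_image _ (fun i => P.l i x₀) h
      exact ⟨P.l j x₀, (Finset.mem_filter.1 hj).2, fun i hi => hmin i (by simp [hi])⟩
  set Λ := ∑ i, ‖P.lin i‖ with hΛ
  have hΛ0 : 0 ≤ Λ := Finset.sum_nonneg fun i _ => norm_nonneg _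
  have hlin : ∀ i v, |P.lin i v| ≤ Λ * ‖v‖ := fun i v => by
    refine ((P.lin i).le_opNorm v).trans (mul_le_mul_of_nonneg_right ?_ (norm_nonneg v))
    exact Finset.single_le_sum (f := fun i => ‖P.lin i‖) (fun i _ => norm_nonneg _)
      (Finset.mem_univ i)
  set A := 4 * (Λ + 1) / κ with hA
  have hA0 : 0 < A := by positivity
  refine Filter.exists_tendsto_of_forall_eventually_le (φ := fun y => A * ‖y - x₀‖ * C) ?_ ?_
    ⟨f p - C, f p + C, eventually_mem_nhdsWithin.mono fun x hx => ?_⟩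
  · have : Tendsto (fun y : Plane => A * ‖y - x₀‖ * C) (𝓝 x₀) (𝓝 (A * ‖x₀ - x₀‖ * C)) :=
      Continuous.tendsto (by fun_prop) x₀
    simp only [sub_self, norm_zero, mul_zero, zero_mul] at this
    exact this.mono_left nhdsWithin_le_nhds
  · filter_upwards [self_mem_nhdsWithin] with y hy
    have hne : y ≠ x₀ := fun h => hxΔ (h ▸ hy)
    have hr : 0 < ‖y - x₀‖ := norm_pos_iff.2 (sub_ne_zero.2 hne)
    set lam := A * ‖y - x₀‖ with hlam
    have hlam0 : 0 < lam := mul_pos hA0 hr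
    have e1 : ∀ᶠ x in 𝓝[P.interior] x₀, ‖x - x₀‖ < ‖y - x₀‖ := by
      refine nhdsWithin_le_nhds ?_
      have : ContinuousAt (fun x : Plane => ‖x - x₀‖) x₀ := by fun_prop
      exact this.eventually_lt_const (by simpa using hr)
    have e2 : ∀ᶠ x in 𝓝[P.interior] x₀, ∀ i, P.l i x₀ = 0 → P.l i x < P.l i y := by
      refine nhdsWithin_le_nhds (eventually_all.2 ?_)
      intro i
      by_cases h : P.l i x₀ = 0
      · have : ContinuousAt (P.l i) x₀ := (P.continuous_l i).continuousAt
        exact (this.eventually_lt_const (by rw [h]; exact hy i)).mono fun x hx _ => hx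
      · exact Eventually.of_forall fun x h' => absurd h' h
    filter_upwards [e1, e2, self_mem_nhdsWithin] with x hx1 hx2 hx
    rcases le_or_gt 1 lam with h1 | h1
    · have := (abs_le.1 (hC y hy x hx)).2
      nlinarith
    · -- `y` lies between `x` and a point `z` of the polygon
      set z := x + lam⁻¹ • (y - x) with hz
      have hzΔ : z ∈ P.interior := fun i => by
        rw [hz, l_add, map_smul, smul_eq_mul]
        have hyx : P.lin i (y - x) = P.l i y - P.l i x := by
          have := P.l_add i x (y - x)
          rw [add_sub_cancel] at this
          linarith
        rcases (hP.l_nonneg hx₀ i).eq_or_lt with h | h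
        · rw [hyx]
          have h3 := mul_pos (inv_pos.2 hlam0) (sub_pos.2 (hx2 i h.symm))
          linarith [hx i]
        · have h2 := hκ i h
          have h3 : |lam⁻¹ * P.lin i (y - x)| ≤ κ / 2 := by
            rw [abs_mul, abs_of_pos (inv_pos.2 hlam0), inv_mul_le_iff₀ hlam0]
            have h4 : ‖y - x‖ ≤ 2 * ‖y - x₀‖ := by
              have := norm_sub_le (y - x₀) (x - x₀)
              rw [sub_sub_sub_cancel_right] at this
              linarith
            calc |P.lin i (y - x)| ≤ Λ * ‖y - x‖ := hlin i _
              _ ≤ (Λ + 1) * (2 * ‖y - x₀‖) := by gcongr; linarith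
              _ = lam * (κ / 2) := by rw [hlam, hA]; field_simp; ring
          have h5 : 3 * κ / 4 ≤ P.l i x := by
            have h6 : P.l i x = P.l i x₀ + P.lin i (x - x₀) := by
              rw [← l_add, add_sub_cancel]
            have h7 := (abs_le.1 (hlin i (x - x₀))).1
            have h8 : Λ * ‖x - x₀‖ ≤ κ / 4 := by
              have : ‖x - x₀‖ ≤ A⁻¹ := by
                rw [← one_div, le_div_iff₀ hA0, mul_comm]
                exact (mul_le_mul_of_nonneg_left hx1.le hA0.le).trans h1.le
              calc Λ * ‖x - x₀‖ ≤ (Λ + 1) * A⁻¹ := by gcongr; linarith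
                _ = κ / 4 := by rw [hA]; field_simp
            linarith
          have := (abs_le.1 h3).1
          linarith
      have hcomb : (1 - lam) • x + lam • z = y := by
        rw [hz, smul_add, smul_smul, mul_inv_cancel₀ hlam0.ne']
        module
      have h := hf.2 hx hzΔ (sub_nonneg.2 h1.le) hlam0.le (by ring)
      rw [hcomb, smul_eq_mul, smul_eq_mul] at h
      have h2 := (abs_le.1 (hC z hzΔ x hx)).2
      nlinarith
  · have := abs_le.1 (hC x hx p hp)
    constructor <;> linarith [this.1, this.2]

end Polygon

/-! ### Comparison with a contracted potential -/

/-- The contraction towards `p` with factor `t`. -/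
noncomputable def contract (p : Plane) (t : ℝ) (ξ : Plane) : Plane := (1 - t) • p + t • ξ

/-- The contracted function `w ∘ contract p t`, made uniformly convex and lowered by a constant. -/
noncomputable def competitor (w : Plane → ℝ) (p : Plane) (m t : ℝ) (ξ : Plane) : ℝ :=
  w (contract p t ξ) + (1 - t) / 2 * (ξ 0 ^ 2 + ξ 1 ^ 2) - (1 - t) * m

/-- The Hessian of `competitor`. -/
noncomputable def contractHess (w : Plane → ℝ) (p : Plane) (t : ℝ) (ξ : Plane) :
    Matrix (Fin 2) (Fin 2) ℝ := t ^ 2 • hessian w (contract p t ξ) + (1 - t) • 1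

/-- An upper bound for `2 - tr ((∂²w)⁻¹ ∂²f) + K_o (w - f)` with `f` the competitor. Unlike this
expression it stays bounded when `∂²w` degenerates. -/
noncomputable def excess (Ko m : ℝ) (p : Plane) (t : ℝ) (w : Plane → ℝ) (ξ : Plane) : ℝ :=
  2 * (1 - (contractHess w p t ξ).det /
    max (contractHess w p t ξ).det (hessian w ξ).det) + Ko * (w ξ - competitor w p m t ξ)

theorem hasFDerivAt_contract (p : Plane) (t : ℝ) (ξ : Plane) :
    HasFDerivAt (contract p t) (t • ContinuousLinearMap.id ℝ Plane) ξ :=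
  ((hasFDerivAt_id ξ).const_smul t).const_add _

theorem continuous_contract (p : Plane) (t : ℝ) : Continuous (contract p t) := by
  unfold contract; fun_prop

theorem contDiff_contract (p : Plane) (t : ℝ) : ContDiff ℝ ∞ (contract p t) := by
  unfold contract; fun_prop

theorem hasFDerivAt_coord (a : Fin 2) (ξ : Plane) :
    HasFDerivAt (fun η : Plane => η a) (EuclideanSpace.proj a : Plane →L[ℝ] ℝ) ξ :=
  (EuclideanSpace.proj a : Plane →L[ℝ] ℝ).hasFDerivAt

theorem det_sq_smul_add_pos {A : Matrix (Fin 2) (Fin 2) ℝ} (hA : A.PosSemidef) {t : ℝ}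
    (ht : t < 1) : (t ^ 2 • A + (1 - t) • (1 : Matrix (Fin 2) (Fin 2) ℝ)).PosDef :=
  Matrix.PosDef.posSemidef_add (hA.smul (sq_nonneg t)) (Matrix.PosDef.one.smul (sub_pos.2 ht))

namespace Polygon

variable {d : ℕ} {P : Polygon d}

section

variable {w : Plane → ℝ} (hw : ContDiffOn ℝ 2 w P.interior) {p : Plane} {m t : ℝ}
include hw

theorem pderiv_competitor {ξ : Plane} (hξ : contract p t ξ ∈ P.interior) (a : Fin 2) :
    pderiv a (competitor w p m t) ξ = t * pderiv a w (contract p t ξ) + (1 - t) * ξ a := by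
  have h1 := ((contDiffAt_of_interior hw hξ).differentiableAt two_ne_zero).hasFDerivAt.comp ξ
    (hasFDerivAt_contract p t ξ)
  have h2 := ((((hasFDerivAt_coord 0 ξ).pow 2).fun_add
    ((hasFDerivAt_coord 1 ξ).pow 2)).const_mul ((1 - t) / 2))
  have h3 := (h1.fun_add h2).sub_const ((1 - t) * m)
  have h4 : HasFDerivAt (competitor w p m t) _ ξ := h3
  rw [pderiv, h4.fderiv]
  fin_cases a <;> simp [pderiv] <;> ring

theorem hessian_competitor (hc : ∀ ξ ∈ P.interior, contract p t ξ ∈ P.interior) {ξ : Plane}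
    (hξ : ξ ∈ P.interior) : hessian (competitor w p m t) ξ = contractHess w p t ξ := by
  ext a b
  change pderiv a (pderiv b (competitor w p m t)) ξ = _
  rw [pderiv_congr_on (fun η hη => pderiv_competitor hw (hc η hη) b) hξ]
  have hd : DifferentiableAt ℝ (pderiv b w) (contract p t ξ) :=
    differentiableAt_fderiv_apply (contDiffAt_of_interior hw (hc ξ hξ)) _
  have h1 := hd.hasFDerivAt.comp ξ (hasFDerivAt_contract p t ξ)
  have h2 := (h1.const_mul t).fun_add ((hasFDerivAt_coord b ξ).const_mul (1 - t))
  have h3 : HasFDerivAt (fun η => t * pderiv b w (contract p t η) + (1 - t) * η b) _ ξ := h2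
  rw [pderiv, h3.fderiv]
  change _ = t ^ 2 * fderiv ℝ (pderiv b w) (contract p t ξ) (EuclideanSpace.single a 1) +
    (1 - t) * (1 : Matrix (Fin 2) (Fin 2) ℝ) a b
  fin_cases a <;> fin_cases b <;> simp <;> ring

end

theorem contDiffOn_competitor {w : Plane → ℝ} (hw : ContDiffOn ℝ ∞ w P.interior) {p : Plane}
    {m t : ℝ} (hc : ∀ ξ ∈ P.interior, contract p t ξ ∈ P.interior) :
    ContDiffOn ℝ ∞ (competitor w p m t) P.interior := by
  have h0 : ∀ a, ContDiff ℝ ∞ fun η : Plane => η a := fun a =>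
    (EuclideanSpace.proj a : Plane →L[ℝ] ℝ).contDiff
  refine ((hw.comp (contDiff_contract p t).contDiffOn hc).add
    (ContDiff.contDiffOn ?_)).sub contDiffOn_const
  exact contDiff_const.mul (((h0 0).pow 2).add ((h0 1).pow 2))

theorem continuousOn_contractHess {w : Plane → ℝ}
    (hw : ∀ a b, ContinuousOn (fun ξ => hessian w ξ a b) P.interior)
    {p : Plane} {t : ℝ} {S : Set Plane} (hc : ∀ ξ ∈ S, contract p t ξ ∈ P.interior)
    (a b : Fin 2) : ContinuousOn (fun ξ => contractHess w p t ξ a b) S := by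
  simp only [contractHess, Matrix.add_apply, Matrix.smul_apply, smul_eq_mul]
  exact (continuousOn_const.mul ((hw a b).comp (continuous_contract p t).continuousOn hc)).add
    continuousOn_const

theorem continuousOn_excess {w : Plane → ℝ} (hw : ContinuousOn w P.interior)
    (hw2 : ∀ a b, ContinuousOn (fun ξ => hessian w ξ a b) P.interior)
    (hpos : ∀ ξ ∈ P.interior, (hessian w ξ).PosSemidef) {Ko m t : ℝ} {p : Plane} (ht : t < 1)
    (hc : ∀ ξ ∈ P.interior, contract p t ξ ∈ P.interior) :
    ContinuousOn (excess Ko m p t w) P.interior := by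
  have h1 := fun a b => continuousOn_contractHess hw2 hc a b
  have hN : ContinuousOn (fun ξ => (contractHess w p t ξ).det) P.interior := by
    simp only [Matrix.det_fin_two]
    exact ((h1 0 0).mul (h1 1 1)).sub ((h1 0 1).mul (h1 1 0))
  have hD : ContinuousOn (fun ξ => (hessian w ξ).det) P.interior := by
    simp only [Matrix.det_fin_two]
    exact ((hw2 0 0).mul (hw2 1 1)).sub ((hw2 0 1).mul (hw2 1 0))
  have hcoord : ∀ a, Continuous fun η : Plane => η a := fun a =>
    (EuclideanSpace.proj a : Plane →L[ℝ] ℝ).continuous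
  have hF : ContinuousOn (competitor w p m t) P.interior := by
    refine ((hw.comp (continuous_contract p t).continuousOn hc).add
      (Continuous.continuousOn ?_)).sub continuousOn_const
    exact continuous_const.mul (((hcoord 0).pow 2).add ((hcoord 1).pow 2))
  refine (continuousOn_const.mul (continuousOn_const.sub (hN.div (hN.sup hD) fun ξ hξ => ?_))).add
    (continuousOn_const.mul (hw.sub hF))
  exact (lt_of_lt_of_le (det_sq_smul_add_pos (hpos _ (hc ξ hξ)) ht).det_pos
    (le_max_left _ _)).ne'

/-- The excess depends continuously on the potential and on the contraction factor, as long as the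
denominator does not degenerate. -/
theorem tendsto_excess {ι : Type*} {F : Filter ι} {w : ι → Plane → ℝ} {w₀ : Plane → ℝ}
    {t : ι → ℝ} {t₀ : ℝ} {Ko m : ℝ} {p ξ : Plane} (ht : Tendsto t F (𝓝 t₀))
    (h1 : Tendsto (fun k => w k ξ) F (𝓝 (w₀ ξ)))
    (h2 : Tendsto (fun k => w k (contract p (t k) ξ)) F (𝓝 (w₀ (contract p t₀ ξ))))
    (h3 : ∀ a b, Tendsto (fun k => hessian (w k) ξ a b) F (𝓝 (hessian w₀ ξ a b)))
    (h4 : ∀ a b, Tendsto (fun k => hessian (w k) (contract p (t k) ξ) a b) F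
      (𝓝 (hessian w₀ (contract p t₀ ξ) a b)))
    (h0 : max (contractHess w₀ p t₀ ξ).det (hessian w₀ ξ).det ≠ 0) :
    Tendsto (fun k => excess Ko m p (t k) (w k) ξ) F (𝓝 (excess Ko m p t₀ w₀ ξ)) := by
  have h5 : ∀ a b, Tendsto (fun k => contractHess (w k) p (t k) ξ a b) F
      (𝓝 (contractHess w₀ p t₀ ξ a b)) := fun a b => by
    simp only [contractHess, Matrix.add_apply, Matrix.smul_apply, smul_eq_mul]
    exact ((ht.pow 2).mul (h4 a b)).add ((ht.const_sub 1).mul tendsto_const_nhds)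
  have hN : Tendsto (fun k => (contractHess (w k) p (t k) ξ).det) F
      (𝓝 (contractHess w₀ p t₀ ξ).det) := by
    simp only [Matrix.det_fin_two]
    exact ((h5 0 0).mul (h5 1 1)).sub ((h5 0 1).mul (h5 1 0))
  have hD : Tendsto (fun k => (hessian (w k) ξ).det) F (𝓝 (hessian w₀ ξ).det) := by
    simp only [Matrix.det_fin_two]
    exact ((h3 0 0).mul (h3 1 1)).sub ((h3 0 1).mul (h3 1 0))
  have hs := ht.const_sub 1
  exact ((tendsto_const_nhds.sub (hN.div (hN.max hD) h0)).const_mul 2).add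
    ((h1.sub ((h2.add ((hs.div_const 2).mul_const _)).sub (hs.mul_const m))).const_mul Ko)

/-- Locally uniform convergence in `C^m` with `m ≥ 2` gives pointwise convergence of the values and of
the Hessians. -/
theorem tendsto_of_locallyUniformCm {u : ℕ → Plane → ℝ} {v : Plane → ℝ} {m : ℕ} (hm : 2 ≤ m)
    (h : LocallyUniformCm m u v P.interior) {ξ : Plane} (hξ : ξ ∈ P.interior) :
    Tendsto (fun k => u k ξ) atTop (𝓝 (v ξ)) ∧
    ∀ a b, Tendsto (fun k => hessian (u k) ξ a b) atTop (𝓝 (hessian v ξ a b)) := by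
  obtain ⟨h1, h2, h3⟩ := h
  have hm' : (2 : WithTop ℕ∞) ≤ m := by exact_mod_cast hm
  have e0 := (h3 0 (Nat.zero_le _)).tendsto_at hξ
  have e2 := (h3 2 hm).tendsto_at hξ
  have ev : ∀ (r : ℕ) (x : Fin r → Plane), Continuous
      fun T : ContinuousMultilinearMap ℝ (fun _ : Fin r => Plane) ℝ => T x := fun r x =>
    (ContinuousMultilinearMap.apply ℝ (fun _ : Fin r => Plane) ℝ x).continuous
  constructor
  · have := ((ev 0 0).tendsto _).comp e0
    simpa [Function.comp_def] using this
  · intro a b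
    have := ((ev 2 ![EuclideanSpace.single a 1, EuclideanSpace.single b 1]).tendsto _).comp e2
    have e : ∀ w : Plane → ℝ, ContDiffOn ℝ m w P.interior → hessian w ξ a b =
        iteratedFDeriv ℝ 2 w ξ ![EuclideanSpace.single a 1, EuclideanSpace.single b 1] :=
      fun w hw => by
        rw [iteratedFDeriv_two_apply, hessian_apply,
          secondDeriv_eq (contDiffAt_of_interior (hw.of_le hm') hξ)]
        simp
    rw [e v h2]
    simp only [e _ (h1 _)]
    exact this

end Polygon

/-! ### The boundary estimate for contracted potentials -/

theorem posSemidef_of_tendsto {ι : Type*} {F : Filter ι} [F.NeBot]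
    {A : ι → Matrix (Fin 2) (Fin 2) ℝ} {B : Matrix (Fin 2) (Fin 2) ℝ}
    (hA : ∀ k, (A k).PosSemidef) (h : ∀ a b, Tendsto (fun k => A k a b) F (𝓝 (B a b))) :
    B.PosSemidef := by
  refine Matrix.PosSemidef.of_dotProduct_mulVec_nonneg ?_ fun x => ?_
  · refine Matrix.IsHermitian.ext fun a b => ?_
    refine tendsto_nhds_unique (h b a) ?_
    have e : ∀ k, A k a b = A k b a := fun k => by
      simpa using ((hA k).isHermitian.apply a b).symm
    simpa only [← e] using h a b
  · have h1 : Tendsto (fun k => star x ⬝ᵥ (A k).mulVec x) F (𝓝 (star x ⬝ᵥ B.mulVec x)) := by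
      simp only [dotProduct, Matrix.mulVec]
      exact tendsto_finsetSum _ fun a _ => tendsto_const_nhds.mul
        (tendsto_finsetSum _ fun b _ => (h a b).mul tendsto_const_nhds)
    exact ge_of_tendsto' h1 fun k => (hA k).dotProduct_mulVec_nonneg x

namespace Polygon

variable {d : ℕ} {P : Polygon d}

theorem exists_forall_notMem_of_isCompact {B : Set (ℝ × ℝ)} (hB : IsCompact B)
    (h0 : ∀ z ∈ B, 0 < z.1) : ∃ δ : ℝ, 0 < δ ∧ ∀ z ∈ B, δ < z.1 := by
  rcases B.eq_empty_or_nonempty with rfl | hne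
  · exact ⟨1, one_pos, fun z hz => absurd hz (notMem_empty z)⟩
  · obtain ⟨w, hw, hmin⟩ := hB.exists_isMinOn hne continuous_fst.continuousOn
    exact ⟨w.1 / 2, half_pos (h0 w hw), fun z hz => (half_lt_self (h0 w hw)).trans_le (hmin hz)⟩

theorem IsDelzant.continuous_edgeChart (hP : P.IsDelzant) (i : Fin d) (q : Plane) :
    Continuous (P.edgeChart i q) := by
  rw [hP.edgeChart_eq]
  exact Homeomorph.continuous _

/-- A strict inequality along a segment of an edge persists in a strip around it. -/
theorem IsDelzant.exists_strip (hP : P.IsDelzant) (i : Fin d) {q : Plane} {r ε : ℝ}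
    (hq : P.l i q = 0)
    (hedge : ∀ y ∈ Icc (-r) r, P.edgeChart i q (0, y) ∈ P.openEdge i) {F : Plane → ℝ}
    (hF : ContinuousOn F P.closed) (hFε : ∀ y ∈ Icc (-r) r, ε < F (P.edgeChart i q (0, y))) :
    ∃ δ μ : ℝ, 0 < δ ∧ 0 < μ ∧
      (∀ z ∈ Icc 0 δ ×ˢ Icc (-r) r, ∀ j, j ≠ i → μ ≤ P.l j (P.edgeChart i q z)) ∧
      ∀ z ∈ Icc 0 δ ×ˢ Icc (-r) r, ε ≤ F (P.edgeChart i q z) := by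
  have he := hP.continuous_edgeChart i q
  have hlc : ∀ j, Continuous fun z => P.l j (P.edgeChart i q z) := fun j =>
    (P.continuous_l j).comp he
  have hli : ∀ z : ℝ × ℝ, P.l i (P.edgeChart i q z) = z.1 := fun z => by
    rw [hP.l_edgeChart, hq, zero_add]
  obtain ⟨δ₁, hδ₁, h1⟩ : ∃ δ : ℝ, 0 < δ ∧ ∀ z ∈ Icc 0 δ ×ˢ Icc (-r) r, ∀ j, j ≠ i →
      0 < P.l j (P.edgeChart i q z) := by
    set B := (Icc (0 : ℝ) 1 ×ˢ Icc (-r) r) ∩ ⋃ j ∈ {j | j ≠ i}, {z | P.l j (P.edgeChart i q z) ≤ 0}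
      with hB
    have hBc : IsCompact B := (isCompact_Icc.prod isCompact_Icc).inter_right
      ((Set.toFinite {j | j ≠ i}).isClosed_biUnion fun j _ =>
        isClosed_le (hlc j) continuous_const)
    obtain ⟨δ, hδ, h⟩ := exists_forall_notMem_of_isCompact hBc fun z hz => by
      obtain ⟨hz1, hz2⟩ := hz
      obtain ⟨j, hj, hz3⟩ := mem_iUnion₂.1 hz2
      refine lt_of_le_of_ne hz1.1.1 fun h => ?_
      have h2 := (hP.mem_openEdge_iff.1 (hedge z.2 hz1.2)).2 j hj
      have e : ((0 : ℝ), z.2) = z := Prod.ext h rfl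
      rw [e] at h2
      exact absurd h2 (not_lt.2 hz3)
    refine ⟨min δ 1, lt_min hδ one_pos, fun z hz j hj => ?_⟩
    by_contra hcon
    have := h z ⟨⟨⟨hz.1.1, hz.1.2.trans (min_le_right _ _)⟩, hz.2⟩,
      mem_iUnion₂.2 ⟨j, hj, not_lt.1 hcon⟩⟩
    exact absurd (hz.1.2.trans (min_le_left _ _)) (not_le.2 this)
  have hcl : ∀ z ∈ Icc 0 δ₁ ×ˢ Icc (-r) r, P.edgeChart i q z ∈ P.closed := fun z hz => by
    rw [mem_closed_iff hP.nonempty]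
    intro j
    rcases eq_or_ne j i with rfl | hj
    · rw [hli]; exact hz.1.1
    · exact (h1 z hz j hj).le
  obtain ⟨δ₂, hδ₂, h2⟩ : ∃ δ : ℝ, 0 < δ ∧ ∀ z ∈ Icc 0 δ₁ ×ˢ Icc (-r) r,
      F (P.edgeChart i q z) ≤ ε → δ < z.1 := by
    have hS : IsCompact (Icc (0 : ℝ) δ₁ ×ˢ Icc (-r) r) := isCompact_Icc.prod isCompact_Icc
    have hBc : IsCompact ((Icc (0 : ℝ) δ₁ ×ˢ Icc (-r) r) ∩
        (fun z => F (P.edgeChart i q z)) ⁻¹' Iic ε) := by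
      refine hS.of_isClosed_subset ?_ inter_subset_left
      exact (hF.comp he.continuousOn hcl).preimage_isClosed_of_isClosed hS.isClosed isClosed_Iic
    obtain ⟨δ, hδ, h⟩ := exists_forall_notMem_of_isCompact hBc fun z hz => by
      refine lt_of_le_of_ne hz.1.1.1 fun h => ?_
      have h2 := hFε z.2 hz.1.2
      have e : ((0 : ℝ), z.2) = z := Prod.ext h rfl
      rw [e] at h2
      exact absurd h2 (not_lt.2 hz.2)
    exact ⟨δ, hδ, fun z hz hz2 => h z ⟨hz, hz2⟩⟩
  have hK : IsCompact (Icc (0 : ℝ) (min δ₁ δ₂) ×ˢ Icc (-r) r) := isCompact_Icc.prod isCompact_Icc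
  have hsub : ∀ z ∈ Icc (0 : ℝ) (min δ₁ δ₂) ×ˢ Icc (-r) r, z ∈ Icc (0 : ℝ) δ₁ ×ˢ Icc (-r) r :=
    fun z hz => ⟨⟨hz.1.1, hz.1.2.trans (min_le_left _ _)⟩, hz.2⟩
  have hμ : ∀ j, ∃ μ : ℝ, 0 < μ ∧ ∀ z ∈ Icc (0 : ℝ) (min δ₁ δ₂) ×ˢ Icc (-r) r, j ≠ i →
      μ ≤ P.l j (P.edgeChart i q z) := fun j => by
    by_cases hj : j = i
    · exact ⟨1, one_pos, fun z _ h => absurd hj h⟩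
    · obtain ⟨μ, hμ, h⟩ := hK.exists_forall_le' (hlc j).continuousOn (a := 0)
        fun z hz => h1 z (hsub z hz) j hj
      exact ⟨μ, hμ, fun z hz _ => h z hz⟩
  choose μ hμ0 hμ using hμ
  obtain ⟨j₀, -, hj₀⟩ := Finset.exists_min_image Finset.univ μ ⟨i, Finset.mem_univ i⟩
  refine ⟨min δ₁ δ₂, μ j₀, lt_min hδ₁ hδ₂, hμ0 j₀, fun z hz j hj =>
    (hj₀ j (Finset.mem_univ j)).trans (hμ j z hz hj), fun z hz => ?_⟩
  by_contra hcon
  exact absurd (hz.1.2.trans (min_le_right _ _)) (not_le.2 (h2 z (hsub z hz) (not_le.1 hcon).le))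

theorem IsDelzant.contract_mem_interior (hP : P.IsDelzant) {p : Plane} (hp : p ∈ P.interior)
    {t : ℝ} (ht0 : 0 ≤ t) (ht1 : t < 1) {ξ : Plane} (hξ : ξ ∈ P.closed) :
    contract p t ξ ∈ P.interior :=
  hP.contract_mem hp hξ ht0 ht1

/-- With the constant `C + m`, for `C` the oscillation of `w` and `m` a bound for `|ξ|²`, the competitor
lies below `w` by convexity, stays within a bounded distance of it, and lies below the contracted
function. -/
theorem sub_competitor_bounds {w : Plane → ℝ} {S : Set Plane} (hw : ConvexOn ℝ S w) {C m t : ℝ}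
    (hC : ∀ ξ ∈ S, ∀ η ∈ S, |w ξ - w η| ≤ C) {p : Plane} (hp : p ∈ S) (ht0 : 0 ≤ t) (ht1 : t ≤ 1)
    {ξ : Plane} (hξ : ξ ∈ S) (hm : ξ 0 ^ 2 + ξ 1 ^ 2 ≤ m) :
    0 ≤ w ξ - competitor w p (C + m) t ξ ∧
    w ξ - competitor w p (C + m) t ξ ≤ C + (C + m) ∧
    w ξ - w (contract p t ξ) ≤ w ξ - competitor w p (C + m) t ξ := by
  have hs : 0 ≤ 1 - t := sub_nonneg.2 ht1
  have h1 := hw.2 hp hξ hs ht0 (by ring)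
  rw [smul_eq_mul, smul_eq_mul] at h1
  have hmem : contract p t ξ ∈ S := hw.1 hp hξ hs ht0 (by ring)
  have h2 := abs_le.1 (hC p hp ξ hξ)
  have h3 := (abs_le.1 (hC ξ hξ _ hmem)).2
  have h0 : 0 ≤ C := (abs_nonneg _).trans (hC p hp p hp)
  have hq : 0 ≤ ξ 0 ^ 2 + ξ 1 ^ 2 := by positivity
  have e1 : w (contract p t ξ) ≤ (1 - t) * w p + t * w ξ := h1
  have e2 := mul_nonneg hs (sub_nonneg.2 hm)
  have e3 := mul_nonneg hs (sub_nonneg.2 h2.2)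
  have e4 := mul_nonneg hs hq
  have e5 := mul_nonneg ht0 (add_nonneg h0 (hq.trans hm))
  have e6 := mul_nonneg hs h0
  simp only [competitor]
  refine ⟨by nlinarith, by nlinarith, by nlinarith⟩

theorem excess_bounds {w : Plane → ℝ} {Ko m t M : ℝ} {p ξ : Plane} (hKo : 0 ≤ Ko)
    (hpos : (hessian w (contract p t ξ)).PosSemidef) (ht : t < 1)
    (h0 : 0 ≤ w ξ - competitor w p m t ξ) (hM : w ξ - competitor w p m t ξ ≤ M) :
    0 ≤ excess Ko m p t w ξ ∧ excess Ko m p t w ξ ≤ 2 + Ko * M := by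
  have hN : 0 < (contractHess w p t ξ).det := (det_sq_smul_add_pos hpos ht).det_pos
  have hle := le_max_left (contractHess w p t ξ).det (hessian w ξ).det
  have h1 : (contractHess w p t ξ).det / max (contractHess w p t ξ).det (hessian w ξ).det ≤ 1 :=
    (div_le_one (hN.trans_le hle)).2 hle
  have h2 : 0 ≤ (contractHess w p t ξ).det / max (contractHess w p t ξ).det (hessian w ξ).det :=
    div_nonneg hN.le (hN.le.trans hle)
  have h3 := mul_nonneg hKo h0
  have h4 := mul_le_mul_of_nonneg_left hM hKo
  rw [excess]
  constructor <;> linarith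

theorem continuousOn_hessian {w : Plane → ℝ} (hw : ContDiffOn ℝ 2 w P.interior) (a b : Fin 2) :
    ContinuousOn (fun ξ => hessian w ξ a b) P.interior := by
  have h1 : ContDiffOn ℝ 1 (pderiv b w) P.interior :=
    (hw.fderiv_of_isOpen P.isOpen_interior (m := 1) (by norm_num)).clm_apply contDiffOn_const
  exact (h1.continuousOn_fderiv_of_isOpen P.isOpen_interior le_rfl).clm_apply continuousOn_const

/-- The boundary estimate for the competitor: if a potential exceeds its competitor by `ε` along a
segment `-r ≤ y ≤ r` of an edge, then the integral of the excess is at least `c ε r`. For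
`t < 1` the contraction maps the closed polygon into the open one, which makes the competitor smooth
up to the boundary. -/
theorem IsDelzant.exists_le_integral_excess (hP : P.IsDelzant) (i : Fin d) :
    ∃ c : ℝ, 0 < c ∧ ∀ {Ko C m t ε r : ℝ} {u : Plane → ℝ} {p q : Plane},
      u ∈ P.potentialsBdd Ko → (∀ ξ ∈ P.closed, ∀ η ∈ P.closed, |u ξ - u η| ≤ C) →
      (∀ ξ ∈ P.closed, ξ 0 ^ 2 + ξ 1 ^ 2 ≤ m) → p ∈ P.interior → 0 ≤ t → t < 1 → 0 ≤ ε → 0 ≤ r →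
      (∀ y ∈ Icc (-r) r, P.edgeChart i q (0, y) ∈ P.openEdge i ∧
        ε < u (P.edgeChart i q (0, y)) -
          competitor u p (C + m) t (P.edgeChart i q (0, y))) →
      c * (ε * r) ≤ ∫ ξ in P.interior, excess Ko (C + m) p t u ξ := by
  obtain ⟨c, hc0, hc⟩ := hP.exists_boundary_estimate i
  refine ⟨c, hc0, ?_⟩
  rintro Ko C m t ε r u p q ⟨⟨⟨ψ, hψ, hu⟩, hpos⟩, hS⟩ hosc hm hp ht0 ht1 hε hr hedge
  have h2 : (2 : WithTop ℕ∞) ≤ ∞ := WithTop.coe_le_coe.2 (le_top : (2 : ℕ∞) ≤ ⊤)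
  have hKo0 : 0 ≤ Ko := (abs_nonneg _).trans (hS p hp)
  have huC := contDiffOn_potential hψ hu
  have hu2 := huC.of_le h2
  have huc := continuousOn_potential hψ hu
  have hconv := hP.convexOn_closed (convexOn_interior_of_posDef hu2 hpos) huc
  have hcl : ∀ ξ ∈ P.closed, contract p t ξ ∈ P.interior := fun ξ hξ =>
    hP.contract_mem_interior hp ht0 ht1 hξ
  have hin : ∀ ξ ∈ P.interior, contract p t ξ ∈ P.interior := fun ξ hξ =>
    hcl ξ (P.interior_subset_closed hξ)
  have hb := fun ξ (hξ : ξ ∈ P.closed) => sub_competitor_bounds hconv hosc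
    (P.interior_subset_closed hp) ht0 ht1.le hξ (hm ξ hξ)
  have hcoord : ∀ a, Continuous fun η : Plane => η a := fun a =>
    (EuclideanSpace.proj a : Plane →L[ℝ] ℝ).continuous
  set f := competitor u p (C + m) t with hf
  have hfc : ContinuousOn f P.closed := by
    refine ((huC.continuousOn.comp (continuous_contract p t).continuousOn hcl).add
      (Continuous.continuousOn ?_)).sub continuousOn_const
    exact continuous_const.mul (((hcoord 0).pow 2).add ((hcoord 1).pow 2))
  have hfC : ContDiffOn ℝ ∞ f P.interior := contDiffOn_competitor huC hin
  have hhess : ∀ ξ ∈ P.interior, hessian f ξ = contractHess u p t ξ := fun ξ hξ =>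
    hessian_competitor hu2 hin hξ
  -- the derivatives of `f` extend continuously to the closed polygon
  obtain ⟨L, hL1, hL2⟩ : ∃ L, (∀ ξ ∈ P.interior, ∀ a, |pderiv a f ξ| ≤ L) ∧
      ∀ ξ ∈ P.interior, ∀ a b, |hessian f ξ a b| ≤ L := by
    have k1 : ∀ a, ∃ L, ∀ ξ ∈ P.closed, ‖t * pderiv a u (contract p t ξ) + (1 - t) * ξ a‖ ≤ L :=
      fun a => hP.isCompact_closed.exists_bound_of_continuousOn
        ((continuousOn_const.mul ((contDiffOn_pderiv huC a).continuousOn.comp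
          (continuous_contract p t).continuousOn hcl)).add
          (continuousOn_const.mul (hcoord a).continuousOn))
    have k2 : ∀ a b, ∃ L, ∀ ξ ∈ P.closed, ‖contractHess u p t ξ a b‖ ≤ L :=
      fun a b => hP.isCompact_closed.exists_bound_of_continuousOn
        (continuousOn_contractHess (fun a b => continuousOn_hessian hu2 a b) hcl a b)
    choose L₁ hL₁ using k1
    choose L₂ hL₂ using k2
    refine ⟨∑ a, |L₁ a| + ∑ a, ∑ b, |L₂ a b|, fun ξ hξ a => ?_, fun ξ hξ a b => ?_⟩
    · rw [pderiv_competitor hu2 (hin ξ hξ)]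
      have e1 := (hL₁ a ξ (P.interior_subset_closed hξ)).trans (le_abs_self _)
      have e2 := Finset.single_le_sum (f := fun a => |L₁ a|) (fun a _ => abs_nonneg _)
        (Finset.mem_univ a)
      have e3 : 0 ≤ ∑ a, ∑ b, |L₂ a b| :=
        Finset.sum_nonneg fun a _ => Finset.sum_nonneg fun b _ => abs_nonneg _
      exact (e1.trans e2).trans (le_add_of_nonneg_right e3)
    · rw [hhess ξ hξ]
      have e1 := (hL₂ a b ξ (P.interior_subset_closed hξ)).trans (le_abs_self _)
      have e2 := Finset.single_le_sum (f := fun b => |L₂ a b|) (fun b _ => abs_nonneg _)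
        (Finset.mem_univ b)
      have e4 := Finset.single_le_sum (f := fun a => ∑ b, |L₂ a b|)
        (fun a _ => Finset.sum_nonneg fun b _ => abs_nonneg _) (Finset.mem_univ a)
      have e3 : 0 ≤ ∑ a, |L₁ a| := Finset.sum_nonneg fun a _ => abs_nonneg _
      exact ((e1.trans e2).trans e4).trans (le_add_of_nonneg_left e3)
  have hq : P.l i q = 0 := by
    have h := (hP.mem_openEdge_iff.1 (hedge 0 ⟨by linarith, hr⟩).1).1
    rw [hP.l_edgeChart] at h
    simpa using h
  obtain ⟨δ, μ, hδ, hμ, hs1, hs2⟩ := hP.exists_strip i hq (fun y hy => (hedge y hy).1)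
    (huc.sub hfc) (fun y hy => (hedge y hy).2)
  refine (hc hψ hu hpos hS hfC hL1 hL2 (fun ξ hξ =>
    ⟨(hb ξ (P.interior_subset_closed hξ)).1, (hb ξ (P.interior_subset_closed hξ)).2.1⟩)
    hq hε hδ hr hμ hs1 (fun z hz => hs2 z ⟨Ioc_subset_Icc_self hz.1, hz.2⟩)).trans ?_
  have hEb : ∀ ξ ∈ P.interior, |excess Ko (C + m) p t u ξ| ≤ 2 + Ko * (C + (C + m)) :=
    fun ξ hξ => by
      have h := excess_bounds hKo0 (hpos _ (hin ξ hξ)).posSemidef ht1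
        (hb ξ (P.interior_subset_closed hξ)).1 (hb ξ (P.interior_subset_closed hξ)).2.1
      rw [abs_of_nonneg h.1]
      exact h.2
  have hEi := hP.integrableOn_of_continuousOn (continuousOn_excess (Ko := Ko) (m := C + m)
    huC.continuousOn (fun a b => continuousOn_hessian hu2 a b)
    (fun ξ hξ => (hpos ξ hξ).posSemidef) ht1 hin) hEb
  obtain ⟨C₁, -, hC₁⟩ := hP.exists_cometric_le hψ hu hpos hS
  have hle : ∀ ξ ∈ P.interior, 2 - invTrace (hessian u ξ) (hessian f ξ) + Ko * (u ξ - f ξ) ≤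
      excess Ko (C + m) p t u ξ := fun ξ hξ => by
    have h := two_mul_det_div_max_le_invTrace (hpos ξ hξ)
      (det_sq_smul_add_pos (hpos _ (hin ξ hξ)).posSemidef ht1)
    rw [hhess ξ hξ, excess]
    simp only [contractHess] at *
    linarith
  have hΦi : IntegrableOn (fun ξ => 2 - invTrace (hessian u ξ) (hessian f ξ) +
      Ko * (u ξ - f ξ)) P.interior := by
    refine hP.integrableOn_of_continuousOn (M := 2 + 2 * C₁ * L + Ko * (C + (C + m)))
      ((continuousOn_const.sub (continuousOn_invTrace huC hfC hpos)).add
        (continuousOn_const.mul (huC.continuousOn.sub hfC.continuousOn))) fun ξ hξ => ?_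
    have h1 := abs_invTrace_le (hpos ξ hξ) (hC₁ ξ hξ).2 (hL2 ξ hξ)
    have h3 := mul_le_mul_of_nonneg_left (hb ξ (P.interior_subset_closed hξ)).2.1 hKo0
    have h4 := mul_nonneg hKo0 (hb ξ (P.interior_subset_closed hξ)).1
    rw [abs_le] at h1 ⊢
    constructor <;> linarith [h1.1, h1.2, h3, h4]
  exact setIntegral_mono_on hΦi hEi P.measurableSet_interior hle

end Polygon

/-! ### Limits of the excess -/

namespace Polygon

variable {d : ℕ} {P : Polygon d}

theorem convexOn_potential {Ko : ℝ} {u : Plane → ℝ} (hu : u ∈ P.potentialsBdd Ko) :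
    ConvexOn ℝ P.interior u := by
  obtain ⟨⟨⟨ψ, hψ, hu⟩, hpos⟩, -⟩ := hu
  exact convexOn_interior_of_posDef ((contDiffOn_potential hψ hu).of_le
    (WithTop.coe_le_coe.2 (le_top : (2 : ℕ∞) ≤ ⊤))) hpos

theorem continuousOn_of_mem_potentialsBdd {Ko : ℝ} {u : Plane → ℝ}
    (hu : u ∈ P.potentialsBdd Ko) : ContinuousOn u P.closed := by
  obtain ⟨⟨⟨ψ, hψ, hu⟩, -⟩, -⟩ := hu
  exact continuousOn_potential hψ hu

theorem convexOn_of_tendsto {S : Set Plane} {u : ℕ → Plane → ℝ} {v : Plane → ℝ}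
    (hu : ∀ k, ConvexOn ℝ S (u k)) (h : ∀ ξ ∈ S, Tendsto (fun k => u k ξ) atTop (𝓝 (v ξ))) :
    ConvexOn ℝ S v := by
  have hS := (hu 0).1
  refine ⟨hS, fun x hx y hy a b ha hb hab => ?_⟩
  exact le_of_tendsto_of_tendsto' (h _ (hS hx hy ha hb hab))
    (((h x hx).const_mul a).add ((h y hy).const_mul b)) fun k => (hu k).2 hx hy ha hb hab

/-- The contraction can be chosen so close to the identity that the integral of the excess is
eventually small. -/
theorem IsDelzant.exists_eventually_integral_excess_lt (hP : P.IsDelzant) {Ko C m : ℝ}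
    {u : ℕ → Plane → ℝ} {v : Plane → ℝ} (hu : ∀ k, u k ∈ P.potentialsBdd Ko)
    (hosc : ∀ k, ∀ ξ ∈ P.closed, ∀ η ∈ P.closed, |u k ξ - u k η| ≤ C)
    (hm : ∀ ξ ∈ P.closed, ξ 0 ^ 2 + ξ 1 ^ 2 ≤ m) (hconv : LocallyUniformCm 6 u v P.interior)
    {p : Plane} (hp : p ∈ P.interior) {η : ℝ} (hη : 0 < η) {t₀ : ℝ} (ht₀ : t₀ < 1) :
    ∃ t, t₀ < t ∧ 0 ≤ t ∧ t < 1 ∧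
      ∀ᶠ k in atTop, ∫ ξ in P.interior, excess Ko (C + m) p t (u k) ξ < η := by
  have hsub := P.interior_subset_closed
  have hKo0 : 0 ≤ Ko := (abs_nonneg _).trans ((hu 0).2 p hp)
  have hlim : ∀ ξ ∈ P.interior, _ := fun ξ hξ =>
    tendsto_of_locallyUniformCm (by norm_num) hconv hξ
  have hu2 : ∀ k, ContDiffOn ℝ 2 (u k) P.interior := fun k =>
    (hconv.1 k).of_le (by norm_cast)
  have hv2 : ContDiffOn ℝ 2 v P.interior := hconv.2.1.of_le (by norm_cast)
  have hin : ∀ t : ℝ, 0 ≤ t → t < 1 → ∀ ξ ∈ P.interior, contract p t ξ ∈ P.interior :=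
    fun t h0 h1 ξ hξ => hP.contract_mem_interior hp h0 h1 (hsub hξ)
  have hpos : ∀ ξ ∈ P.interior, (hessian v ξ).PosSemidef := fun ξ hξ =>
    posSemidef_of_tendsto (fun k => ((hu k).1.2 ξ hξ).posSemidef) (hlim ξ hξ).2
  have hconvv : ConvexOn ℝ P.interior v :=
    convexOn_of_tendsto (fun k => convexOn_potential (hu k)) fun ξ hξ => (hlim ξ hξ).1
  have hoscv : ∀ ξ ∈ P.interior, ∀ η ∈ P.interior, |v ξ - v η| ≤ C := fun ξ hξ η hη =>
    le_of_tendsto' (((hlim ξ hξ).1.sub (hlim η hη).1).abs) fun k =>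
      hosc k ξ (hsub hξ) η (hsub hη)
  set B := 2 + Ko * (C + (C + m)) with hB
  have hbd : ∀ w : Plane → ℝ, ConvexOn ℝ P.interior w →
      (∀ ξ ∈ P.interior, ∀ η ∈ P.interior, |w ξ - w η| ≤ C) →
      (∀ ξ ∈ P.interior, (hessian w ξ).PosSemidef) → ∀ t : ℝ, 0 ≤ t → t < 1 →
      ∀ ξ ∈ P.interior, ‖excess Ko (C + m) p t w ξ‖ ≤ B := fun w h1 h2 h3 t h0 ht ξ hξ => by
    have hb := sub_competitor_bounds h1 h2 hp h0 ht.le hξ (hm ξ (hsub hξ))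
    have h := excess_bounds hKo0 (h3 _ (hin t h0 ht ξ hξ)) ht hb.1 hb.2.1
    rw [Real.norm_eq_abs, abs_of_nonneg h.1]
    exact h.2
  have hmeas : ∀ w : Plane → ℝ, ContDiffOn ℝ 2 w P.interior →
      (∀ ξ ∈ P.interior, (hessian w ξ).PosSemidef) → ∀ t : ℝ, 0 ≤ t → t < 1 →
      AEStronglyMeasurable (excess Ko (C + m) p t w) (volume.restrict P.interior) :=
    fun w h1 h3 t h0 ht => (continuousOn_excess h1.continuousOn
      (fun a b => continuousOn_hessian h1 a b) h3 ht (hin t h0 ht)).aestronglyMeasurable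
        P.measurableSet_interior
  have hBi : Integrable (fun _ : Plane => B) (volume.restrict P.interior) :=
    (integrableOn_const hP.volume_interior_ne_top).integrable
  have hev0 : ∀ᶠ t : ℝ in 𝓝[<] 1, 0 < t := nhdsWithin_le_nhds (lt_mem_nhds one_pos)
  -- the limit `t → 1` for the limit function
  have hlim1 : Tendsto (fun t : ℝ => ∫ ξ in P.interior, excess Ko (C + m) p t v ξ) (𝓝[<] 1)
      (𝓝 (∫ _ξ in P.interior, (0 : ℝ))) := by
    refine tendsto_integral_filter_of_dominated_convergence (fun _ => B) ?_ ?_ hBi ?_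
    · filter_upwards [hev0, self_mem_nhdsWithin] with t h0 h1
      exact hmeas v hv2 hpos t h0.le h1
    · filter_upwards [hev0, self_mem_nhdsWithin] with t h0 h1
      exact (ae_restrict_mem P.measurableSet_interior).mono (hbd v hconvv hoscv hpos t h0.le h1)
    · refine (ae_restrict_mem P.measurableSet_interior).mono fun ξ hξ => ?_
      have hct : Tendsto (fun t : ℝ => contract p t ξ) (𝓝[<] 1) (𝓝[P.interior] ξ) :=
        hP.tendsto_contract hp (hsub hξ)
      have hc1 : contract p 1 ξ = ξ := by simp [contract]
      have ht1 : Tendsto (fun t : ℝ => t) (𝓝[<] 1) (𝓝 1) := tendsto_id.mono_left nhdsWithin_le_nhds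
      have hvt : Tendsto (fun t : ℝ => v (contract p t ξ)) (𝓝[<] 1) (𝓝 (v ξ)) :=
        (hv2.continuousOn ξ hξ).tendsto.comp hct
      have hcomp1 : competitor v p (C + m) 1 ξ = v ξ := by simp [competitor, hc1]
      have hN1 : contractHess v p 1 ξ = hessian v ξ := by simp [contractHess, hc1]
      -- where `∂²v` degenerates the quotient of determinants is identically `1` for `t < 1`
      by_cases hD : (hessian v ξ).det = 0
      · have e : ∀ᶠ t : ℝ in 𝓝[<] 1, Ko * (v ξ - competitor v p (C + m) t ξ) =
            excess Ko (C + m) p t v ξ := by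
          filter_upwards [hev0, self_mem_nhdsWithin] with t h0 h1
          have hN := (det_sq_smul_add_pos (hpos _ (hin t h0.le h1 ξ hξ)) h1).det_pos
          change 0 < (contractHess v p t ξ).det at hN
          rw [excess, hD, max_eq_left hN.le, div_self hN.ne']
          ring
        refine Tendsto.congr' e ?_
        have hs := ht1.const_sub 1
        have := ((hvt.add ((hs.div_const 2).mul_const (ξ 0 ^ 2 + ξ 1 ^ 2))).sub
          (hs.mul_const (C + m))).const_sub (v ξ) |>.const_mul Ko
        simpa [competitor] using this
      · have h := tendsto_excess (Ko := Ko) (m := C + m) (w := fun _ => v) (w₀ := v) (p := p)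
          (ξ := ξ) ht1 tendsto_const_nhds (by rw [hc1]; exact hvt)
          (fun a b => tendsto_const_nhds)
          (fun a b => by
            rw [hc1]
            exact (continuousOn_hessian hv2 a b ξ hξ).tendsto.comp hct)
          (by rw [hN1, max_self]; exact hD)
        have e1 : excess Ko (C + m) p 1 v ξ = 0 := by
          rw [excess, hN1, hcomp1, max_self, div_self hD]
          ring
        rwa [e1] at h
  rw [integral_zero] at hlim1
  have hevt : ∀ᶠ t : ℝ in 𝓝[<] 1, t₀ < t := nhdsWithin_le_nhds (lt_mem_nhds ht₀)
  obtain ⟨t, ⟨ht, htη⟩, ht0, ht1⟩ := ((hevt.and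
    (hlim1.eventually_lt_const hη)).and (hev0.and self_mem_nhdsWithin)).exists
  refine ⟨t, ht, ht0.le, ht1, ?_⟩
  have ht1' : t < 1 := ht1
  refine Tendsto.eventually_lt_const htη ?_
  refine tendsto_integral_of_dominated_convergence (fun _ => B)
    (fun k => hmeas (u k) (hu2 k) (fun ξ hξ => ((hu k).1.2 ξ hξ).posSemidef) t ht0.le ht1') hBi
    (fun k => (ae_restrict_mem P.measurableSet_interior).mono (hbd (u k) (convexOn_potential (hu k))
      (fun ξ hξ η hη => hosc k ξ (hsub hξ) η (hsub hη))
      (fun ξ hξ => ((hu k).1.2 ξ hξ).posSemidef) t ht0.le ht1'))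
    ((ae_restrict_mem P.measurableSet_interior).mono fun ξ hξ => ?_)
  have hc := hin t ht0.le ht1' ξ hξ
  have hN := (det_sq_smul_add_pos (hpos _ hc) ht1').det_pos
  exact tendsto_excess tendsto_const_nhds (hlim ξ hξ).1 (hlim _ hc).1 (hlim ξ hξ).2 (hlim _ hc).2
    (hN.trans_le (le_max_left _ _)).ne'

theorem tendstoLocallyUniformlyOn_of_locallyUniformCm {u : ℕ → Plane → ℝ} {v : Plane → ℝ} {m : ℕ}
    {S : Set Plane} (h : LocallyUniformCm m u v S) : TendstoLocallyUniformlyOn u v atTop S := by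
  have h0 := h.2.2 0 (Nat.zero_le _)
  rw [Metric.tendstoLocallyUniformlyOn_iff] at h0 ⊢
  simpa only [iteratedFDeriv_zero_eq_comp, Function.comp, LinearIsometryEquiv.dist_map] using h0

/-- A convex function of bounded oscillation varies little over a small part of a segment. -/
theorem le_add_of_convexOn {S : Set Plane} {w : Plane → ℝ} (hw : ConvexOn ℝ S w) {C : ℝ}
    (hC : ∀ ξ ∈ S, ∀ η ∈ S, |w ξ - w η| ≤ C) {q v : Plane} {s : ℝ} (hs : 0 < s)
    (h1 : q + v ∈ S) (h2 : q - s • v ∈ S) : w q ≤ w (q + v) + C / s := by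
  have hs1 : 0 < 1 + s := by positivity
  have hC0 : 0 ≤ C := (abs_nonneg _).trans (hC _ h1 _ h1)
  have h := hw.2 h1 h2 (div_pos hs hs1).le (div_pos one_pos hs1).le (by field_simp; ring)
  have e : (s / (1 + s)) • (q + v) + (1 / (1 + s)) • (q - s • v) = q := by
    have e1 : s / (1 + s) = 1 - 1 / (1 + s) := by field_simp; ring
    have e2 : (1 / (1 + s)) * s = 1 - 1 / (1 + s) := by field_simp; ring
    rw [smul_sub, smul_smul, e2, e1]
    module
  rw [e, smul_eq_mul, smul_eq_mul] at h
  have h3 := (abs_le.1 (hC _ h2 _ h1)).2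
  have h4 : 1 / (1 + s) * (w (q - s • v) - w (q + v)) ≤ 1 / (1 + s) * C :=
    mul_le_mul_of_nonneg_left h3 (div_pos one_pos hs1).le
  have h5 : 1 / (1 + s) * C ≤ C / s := by
    rw [one_div_mul_eq_div]
    exact div_le_div_of_nonneg_left hC0 hs (by linarith)
  have e1 : s / (1 + s) = 1 - 1 / (1 + s) := by field_simp; ring
  rw [e1] at h
  linarith

end Polygon

/-! ### Convergence on the edges -/

namespace Polygon

variable {d : ℕ} {P : Polygon d}

theorem edgeChart_add (i : Fin d) (q : Plane) (y a : ℝ) :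
    P.edgeChart i q (0, y + a) = P.edgeChart i q (0, y) + a • P.tangent i := by
  simp only [edgeChart]
  module

theorem edgeChart_zero (i : Fin d) (q : Plane) : P.edgeChart i q (0, 0) = q := by
  simp [edgeChart]

theorem IsDelzant.exists_edgeChart_mem (hP : P.IsDelzant) {i : Fin d} {q : Plane}
    (hq : q ∈ P.openEdge i) :
    ∃ ρ : ℝ, 0 < ρ ∧ ∀ y ∈ Icc (-ρ) ρ, P.edgeChart i q (0, y) ∈ P.openEdge i := by
  have hc : ∀ j, Continuous fun y : ℝ => P.l j (P.edgeChart i q (0, y)) := fun j =>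
    (P.continuous_l j).comp ((hP.continuous_edgeChart i q).comp (by fun_prop))
  have h : ∀ᶠ y : ℝ in 𝓝 0, ∀ j, j ≠ i → 0 < P.l j (P.edgeChart i q (0, y)) := by
    refine eventually_all.2 fun j => ?_
    by_cases hj : j = i
    · exact Eventually.of_forall fun y h => absurd hj h
    · refine ((hc j).continuousAt.eventually_const_lt ?_).mono fun y hy _ => hy
      beta_reduce
      rw [edgeChart_zero]
      exact (hP.mem_openEdge_iff.1 hq).2 j hj
  obtain ⟨ρ, hρ, hball⟩ := Metric.eventually_nhds_iff.1 h
  refine ⟨ρ / 2, half_pos hρ, fun y hy => hP.mem_openEdge_iff.2 ⟨?_, hball ?_⟩⟩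
  · rw [hP.l_edgeChart, (hP.mem_openEdge_iff.1 hq).1, add_zero]
  · rw [Real.dist_eq, sub_zero]
    exact (abs_le.2 hy).trans_lt (half_lt_self hρ)

theorem openEdge_subset_closed (i : Fin d) :
    P.openEdge i ⊆ P.closed := fun _ h => h.1.1

/-- Convex functions on the polygon of bounded oscillation are equicontinuous in the interior of
an edge. -/
theorem IsDelzant.exists_equicontinuous (hP : P.IsDelzant) {i : Fin d} {q : Plane}
    (hq : q ∈ P.openEdge i) (C : ℝ) {ε : ℝ} (hε : 0 < ε) :
    ∃ r : ℝ, 0 < r ∧ (∀ y ∈ Icc (-r) r, P.edgeChart i q (0, y) ∈ P.openEdge i) ∧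
      ∀ w : Plane → ℝ, ConvexOn ℝ P.closed w →
        (∀ ξ ∈ P.closed, ∀ η ∈ P.closed, |w ξ - w η| ≤ C) → ∀ y ∈ Icc (-r) r,
          |w (P.edgeChart i q (0, y)) - w q| ≤ ε := by
  obtain ⟨ρ, hρ, hmem⟩ := hP.exists_edgeChart_mem hq
  -- a factor `s` with `C / s ≤ ε`
  set s := |C| / ε + 1 with hs
  have hs0 : 0 < s := by positivity
  have hCs : C / s ≤ ε := by
    rw [div_le_iff₀ hs0]
    have : ε * s = |C| + ε := by rw [hs]; field_simp
    linarith [le_abs_self C]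
  refine ⟨ρ / (1 + s), by positivity, fun y hy => ?_, fun w hw hC y hy => ?_⟩
  · refine hmem y (abs_le.1 ((abs_le.2 hy).trans ?_))
    exact div_le_self hρ.le (by linarith)
  · have hy' : |y| * (1 + s) ≤ ρ := (le_div_iff₀ (by positivity)).1 (abs_le.2 hy)
    have hin : ∀ a : ℝ, |a| ≤ |y| * (1 + s) → P.edgeChart i q (0, a) ∈ P.closed := fun a ha =>
      P.openEdge_subset_closed i (hmem a (abs_le.1 (ha.trans hy')))
    have hy0 := abs_nonneg y
    have b1 : |y| ≤ |y| * (1 + s) := le_mul_of_one_le_right hy0 (by linarith)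
    have b2 : |(-(s * y))| ≤ |y| * (1 + s) := by
      rw [abs_neg, abs_mul, abs_of_pos hs0]; nlinarith
    have b3 : |y + s * y| ≤ |y| * (1 + s) := by
      rw [show y + s * y = y * (1 + s) by ring, abs_mul, abs_of_pos (by linarith : 0 < 1 + s)]
    set τ := P.tangent i
    have e : ∀ a : ℝ, P.edgeChart i q (0, a) = q + a • τ := fun a => by
      have := edgeChart_add (P := P) i q 0 a
      rwa [zero_add, edgeChart_zero] at this
    have h1 := le_add_of_convexOn hw hC (q := q) (v := y • τ) hs0 (by rw [← e]; exact hin y b1)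
      (by
        have : q - s • y • τ = q + (-(s * y)) • τ := by module
        rw [this, ← e]; exact hin _ b2)
    have h2 := le_add_of_convexOn hw hC (q := q + y • τ) (v := (-y) • τ) hs0
      (by
        have : q + y • τ + (-y) • τ = q := by module
        rw [this, ← edgeChart_zero (P := P) i q]
        exact hin 0 (by rw [abs_zero]; positivity))
      (by
        have : q + y • τ - s • (-y) • τ = q + (y + s * y) • τ := by module
        rw [this, ← e]; exact hin _ b3)
    rw [show q + y • τ + (-y) • τ = q by module] at h2
    rw [e, abs_le]
    constructor <;> linarith

section

variable {Ko C : ℝ} {u : ℕ → Plane → ℝ} {v U : Plane → ℝ}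

/-- The values on an edge do not jump upwards in the limit: this is where the bound on the scalar
curvature enters. -/
theorem IsDelzant.eventually_lt_of_openEdge (hP : P.IsDelzant)
    (hu : ∀ k, u k ∈ P.potentialsBdd Ko)
    (hosc : ∀ k, ∀ ξ ∈ P.closed, ∀ η ∈ P.closed, |u k ξ - u k η| ≤ C)
    (hconv : LocallyUniformCm 6 u v P.interior) (hU : ContinuousOn U P.closed)
    (hUv : EqOn U v P.interior) {i : Fin d} {q : Plane} (hq : q ∈ P.openEdge i) {ε : ℝ}
    (hε : 0 < ε) : ∀ᶠ k in atTop, u k q < U q + ε := by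
  obtain ⟨p, hp⟩ := hP.nonempty
  have hε8 : 0 < ε / 8 := by positivity
  obtain ⟨c, hc0, hc⟩ := hP.exists_le_integral_excess i
  obtain ⟨r₁, hr₁, hmem, hequi⟩ := hP.exists_equicontinuous hq C hε8
  obtain ⟨ρ, hρ, hunif⟩ := Metric.uniformContinuousOn_iff.1
    (hP.isCompact_closed.uniformContinuousOn_of_continuous hU) _ hε8
  have hqc := P.openEdge_subset_closed i hq
  have hcoord : ∀ a, Continuous fun η : Plane => η a := fun a =>
    (EuclideanSpace.proj a : Plane →L[ℝ] ℝ).continuous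
  obtain ⟨m, hm⟩ : ∃ m, ∀ ξ ∈ P.closed, ξ 0 ^ 2 + ξ 1 ^ 2 ≤ m := by
    obtain ⟨m, hm⟩ := hP.isCompact_closed.exists_bound_of_continuousOn
      (((hcoord 0).pow 2).add ((hcoord 1).pow 2)).continuousOn
    exact ⟨m, fun ξ hξ => (le_abs_self _).trans (hm ξ hξ)⟩
  have hec : Continuous fun y : ℝ => P.edgeChart i q (0, y) :=
    (hP.continuous_edgeChart i q).comp (by fun_prop)
  -- a segment of the edge around `q` on which `U` is almost constant
  obtain ⟨r₂, hr₂, hUr⟩ : ∃ r₂ : ℝ, 0 < r₂ ∧ ∀ y ∈ Icc (-r₂) r₂,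
      dist (P.edgeChart i q (0, y)) q < ρ := by
    have h : ∀ᶠ y : ℝ in 𝓝 0, dist (P.edgeChart i q (0, y)) q < ρ := by
      refine (hec.dist continuous_const).continuousAt.eventually_lt_const ?_
      beta_reduce
      rw [edgeChart_zero, dist_self]
      exact hρ
    obtain ⟨σ, hσ, hball⟩ := Metric.eventually_nhds_iff.1 h
    refine ⟨σ / 2, half_pos hσ, fun y hy => hball ?_⟩
    rw [Real.dist_eq, sub_zero]
    exact (abs_le.2 hy).trans_lt (half_lt_self hσ)
  set r := min r₁ r₂ with hr
  have hr0 : 0 < r := lt_min hr₁ hr₂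
  have hI₁ : ∀ y ∈ Icc (-r) r, y ∈ Icc (-r₁) r₁ := fun y hy =>
    abs_le.1 ((abs_le.2 hy).trans (min_le_left _ _))
  have hI₂ : ∀ y ∈ Icc (-r) r, y ∈ Icc (-r₂) r₂ := fun y hy =>
    abs_le.1 ((abs_le.2 hy).trans (min_le_right _ _))
  -- a contraction close to the identity
  obtain ⟨D, hD⟩ : ∃ D, ∀ ξ ∈ P.closed, ‖p - ξ‖ ≤ D :=
    hP.isCompact_closed.exists_bound_of_continuousOn (continuous_const.sub continuous_id).continuousOn
  have hD0 : 0 ≤ D := (norm_nonneg _).trans (hD p (P.interior_subset_closed hp))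
  obtain ⟨t, ht, ht0, ht1, hEt⟩ := hP.exists_eventually_integral_excess_lt hu hosc hm hconv hp
    (η := c * (ε / 4 * r)) (by positivity) (t₀ := 1 - ρ / (D + 1))
    (by have : 0 < ρ / (D + 1) := by positivity
        linarith)
  have hdist : ∀ ξ ∈ P.closed, dist (contract p t ξ) ξ < ρ := fun ξ hξ => by
    have e : contract p t ξ - ξ = (1 - t) • (p - ξ) := by
      simp only [contract]; module
    rw [dist_eq_norm, e, norm_smul, Real.norm_eq_abs, abs_of_pos (sub_pos.2 ht1)]
    have h1 : 1 - t < ρ / (D + 1) := by linarith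
    rw [lt_div_iff₀ (by positivity)] at h1
    have h2 := mul_le_mul_of_nonneg_left (hD ξ hξ) (sub_pos.2 ht1).le
    linarith
  -- uniform convergence on the contracted segment
  set Z := (fun y : ℝ => contract p t (P.edgeChart i q (0, y))) '' Icc (-r) r with hZ
  have hZc : IsCompact Z := isCompact_Icc.image ((continuous_contract p t).comp hec)
  have hcl : ∀ y ∈ Icc (-r) r, P.edgeChart i q (0, y) ∈ P.closed := fun y hy =>
    P.openEdge_subset_closed i (hmem y (hI₁ y hy))
  have hZΔ : Z ⊆ P.interior := by
    rintro _ ⟨y, hy, rfl⟩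
    exact hP.contract_mem_interior hp ht0 ht1 (hcl y hy)
  have hZu := Metric.tendstoUniformlyOn_iff.1
    ((tendstoLocallyUniformlyOn_iff_forall_isCompact P.isOpen_interior).1
      (tendstoLocallyUniformlyOn_of_locallyUniformCm hconv) Z hZΔ hZc) _ hε8
  filter_upwards [hEt, hZu] with k hk1 hk2
  -- If `u_k(q) ≥ U(q) + ε`, then near `q` the values of `u_k` on the edge exceed those at the
  -- contracted points, hence those of the competitor, by more than `ε / 4`: each of the four approximations
  -- made on the way costs `ε / 8`.
  by_contra hcon
  have hcon' := not_lt.1 hcon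
  have hconvk : ConvexOn ℝ P.closed (u k) :=
    hP.convexOn_closed (convexOn_potential (hu k)) (continuousOn_of_mem_potentialsBdd (hu k))
  refine absurd (hc (hu k) (hosc k) hm hp ht0 ht1 (ε := ε / 4) (r := r) (q := q) (by positivity)
    hr0.le fun y hy => ⟨hmem y (hI₁ y hy), ?_⟩) (not_le.2 hk1)
  set ξ := P.edgeChart i q (0, y) with hξ
  have hξc : ξ ∈ P.closed := hcl y hy
  have hσ : contract p t ξ ∈ P.interior := hP.contract_mem_interior hp ht0 ht1 hξc
  have f1 := (sub_competitor_bounds hconvk (hosc k) (P.interior_subset_closed hp) ht0 ht1.le hξc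
    (hm ξ hξc)).2.2
  have f2 := abs_le.1 (hequi (u k) hconvk (hosc k) y (hI₁ y hy))
  have f3 := abs_lt.1 (Real.dist_eq _ _ ▸ hunif ξ hξc q hqc (hUr y (hI₂ y hy)))
  have f4 := abs_lt.1 (Real.dist_eq _ _ ▸
    hunif _ (P.interior_subset_closed hσ) ξ hξc (hdist ξ hξc))
  have f5 := abs_lt.1 (Real.dist_eq _ _ ▸ hk2 (contract p t ξ) (mem_image_of_mem _ hy))
  rw [hUv hσ] at f4
  linarith [f2.1, f3.2, f4.2, f5.1]

/-- The values at a boundary point do not jump downwards in the limit: for convex functions of bounded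
oscillation, `u_k(q)` is at least the value at a nearby point of `Δ` up to a small error. -/
theorem IsDelzant.eventually_gt_of_closed (hP : P.IsDelzant)
    (hconvex : ∀ k, ConvexOn ℝ P.closed (u k))
    (hosc : ∀ k, ∀ ξ ∈ P.closed, ∀ η ∈ P.closed, |u k ξ - u k η| ≤ C)
    (hlim : ∀ ξ ∈ P.interior, Tendsto (fun k => u k ξ) atTop (𝓝 (v ξ)))
    (hU : ContinuousOn U P.closed) (hUv : EqOn U v P.interior) {q : Plane} (hq : q ∈ P.closed)
    {ε : ℝ} (hε : 0 < ε) : ∀ᶠ k in atTop, U q - ε < u k q := by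
  obtain ⟨p, hp⟩ := hP.nonempty
  have hpc := P.interior_subset_closed hp
  have h1 : Tendsto (fun t : ℝ => U ((1 - t) • p + t • q) - (1 - t) * C) (𝓝[<] 1) (𝓝 (U q)) := by
    have ht1 : Tendsto (fun t : ℝ => t) (𝓝[<] 1) (𝓝 1) := tendsto_id.mono_left nhdsWithin_le_nhds
    have := (((hU q hq).mono P.interior_subset_closed).tendsto.comp
      (hP.tendsto_contract hp hq)).sub ((ht1.const_sub 1).mul_const C)
    simpa using this
  have h0 : ∀ᶠ t : ℝ in 𝓝[<] 1, 0 < t := nhdsWithin_le_nhds (lt_mem_nhds one_pos)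
  obtain ⟨t, ht, ht0, ht1⟩ := ((h1.eventually_const_lt (sub_lt_self (U q) hε)).and
    (h0.and self_mem_nhdsWithin)).exists
  have ht1' : t < 1 := ht1
  have hσ := hP.contract_mem hp hq ht0.le ht1'
  rw [hUv hσ] at ht
  have h2 := (hlim _ hσ).sub_const ((1 - t) * C)
  filter_upwards [h2.eventually_const_lt ht] with k hk
  have h3 := (hconvex k).2 hpc hq (sub_pos.2 ht1').le ht0.le (by ring)
  rw [smul_eq_mul, smul_eq_mul] at h3
  have h4 := mul_le_mul_of_nonneg_left (abs_le.1 (hosc k p hpc q hq)).2 (sub_pos.2 ht1').le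
  linarith

/-- Pointwise convergence in the interior of an edge is locally uniform, since the `u_k` are
equicontinuous there. -/
theorem IsDelzant.tendstoLocallyUniformlyOn_openEdge (hP : P.IsDelzant)
    (hu : ∀ k, u k ∈ P.potentialsBdd Ko)
    (hosc : ∀ k, ∀ ξ ∈ P.closed, ∀ η ∈ P.closed, |u k ξ - u k η| ≤ C)
    (hconv : LocallyUniformCm 6 u v P.interior) (hU : ContinuousOn U P.closed)
    (hUv : EqOn U v P.interior) (i : Fin d) :
    TendstoLocallyUniformlyOn u U atTop (P.openEdge i) := by
  have hconvex : ∀ k, ConvexOn ℝ P.closed (u k) := fun k =>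
    hP.convexOn_closed (convexOn_potential (hu k)) (continuousOn_of_mem_potentialsBdd (hu k))
  rw [Metric.tendstoLocallyUniformlyOn_iff]
  intro ε hε q hq
  have hε4 : 0 < ε / 4 := by positivity
  have hqc := P.openEdge_subset_closed i hq
  obtain ⟨r, hr, -, hequi⟩ := hP.exists_equicontinuous hq C hε4
  set e := (hP.edgeFrame i).toHomeomorph.trans (Homeomorph.addLeft q) with he
  have hsymm : ∀ ξ, P.edgeChart i q (e.symm ξ) = ξ := fun ξ => by
    rw [hP.edgeChart_eq]; exact e.apply_symm_apply ξ
  have h1 : ∀ᶠ ξ in 𝓝[P.openEdge i] q, |(e.symm ξ).2| < r := by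
    refine nhdsWithin_le_nhds ?_
    have hc : Continuous fun ξ => |(e.symm ξ).2| := (continuous_snd.comp e.symm.continuous).abs
    refine hc.continuousAt.eventually_lt_const ?_
    have : e.symm q = (0, 0) := by
      rw [Homeomorph.symm_apply_eq]
      exact ((congrFun (hP.edgeChart_eq i q) (0, 0)).symm.trans (edgeChart_zero i q)).symm
    beta_reduce
    rw [this, abs_zero]
    exact hr
  have h2 : ∀ᶠ ξ in 𝓝[P.openEdge i] q, dist (U ξ) (U q) < ε / 4 :=
    Metric.tendsto_nhds.1 ((hU q hqc).mono (P.openEdge_subset_closed i)).tendsto _ hε4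
  refine ⟨_, h1.and (h2.and self_mem_nhdsWithin), ?_⟩
  filter_upwards [hP.eventually_lt_of_openEdge hu hosc hconv hU hUv hq hε4,
    hP.eventually_gt_of_closed hconvex hosc
      (fun ξ hξ => (tendsto_of_locallyUniformCm (by norm_num) hconv hξ).1) hU hUv hqc hε4]
    with k hk1 hk2 ξ hξ
  obtain ⟨hξ1, hξ2, hξ3⟩ := hξ
  have e1 : (e.symm ξ).1 = 0 := by
    have := hP.l_edgeChart i q (e.symm ξ)
    rw [hsymm, (hP.mem_openEdge_iff.1 hξ3).1, (hP.mem_openEdge_iff.1 hq).1, zero_add] at this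
    exact this.symm
  have e2 : P.edgeChart i q (0, (e.symm ξ).2) = ξ := by
    rw [← e1]; exact hsymm ξ
  have h3 := hequi (u k) (hconvex k) (hosc k) (e.symm ξ).2 (abs_le.1 hξ1.le)
  rw [e2] at h3
  rw [Real.dist_eq] at hξ2 ⊢
  rw [abs_lt] at *
  have h3' := abs_le.1 h3
  constructor <;> linarith [h3'.1, h3'.2, hξ2.1, hξ2.2]

end

end Polygon

end ToricSurface

theorem proposition5p1p1 {d : ℕ} (P : ToricSurface.Polygon d) (hP : P.IsDelzant)
    (Ko C₁ : ℝ) (u : ℕ → ToricSurface.Plane → ℝ) (K : ℕ → ToricSurface.Plane → ℝ)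
    (Kinf uinf : ToricSurface.Plane → ℝ)
    (hu : ∀ k, u k ∈ P.potentialsBdd Ko)
    (hS : ∀ k, ∀ ξ ∈ P.interior, ToricSurface.scalarCurvature (u k) ξ = K k ξ)
    (hosc : ∀ k, ∀ ξ ∈ P.closed, ∀ η ∈ P.closed, |u k ξ - u k η| ≤ C₁)
    (hK : ToricSurface.UniformCm 3 K Kinf P.closed)
    (hconv : ToricSurface.LocallyUniformCm 6 u uinf P.interior)
    (hstrict : StrictConvexOn ℝ P.interior uinf) :
    ∃ U : ToricSurface.Plane → ℝ,
      ContinuousOn U P.closed ∧ EqOn U uinf P.interior ∧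
        ∀ i : Fin d, ∃ h : ToricSurface.Plane → ℝ,
          ConvexOn ℝ (P.openEdge i) h ∧
          TendstoLocallyUniformlyOn u h atTop (P.openEdge i) ∧
          ∀ q ∈ P.openEdge i, U q = h q := by
  have hsub := P.interior_subset_closed
  have hlim : ∀ ξ ∈ P.interior, Tendsto (fun k => u k ξ) atTop (𝓝 (uinf ξ)) := fun ξ hξ =>
    (ToricSurface.Polygon.tendsto_of_locallyUniformCm (by norm_num) hconv hξ).1
  have hconvex : ConvexOn ℝ P.interior uinf := ToricSurface.Polygon.convexOn_of_tendsto
    (fun k => ToricSurface.Polygon.convexOn_potential (hu k)) hlim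
  have hosc' : ∀ ξ ∈ P.interior, ∀ η ∈ P.interior, |uinf ξ - uinf η| ≤ C₁ := fun ξ hξ η hη =>
    le_of_tendsto' ((hlim ξ hξ).sub (hlim η hη)).abs fun k => hosc k ξ (hsub hξ) η (hsub hη)
  have hU : ContinuousOn (extendFrom P.interior uinf) P.closed :=
    continuousOn_extendFrom subset_rfl fun ξ hξ => hP.exists_tendsto_of_convexOn hconvex hosc' hξ
  have hUv : EqOn (extendFrom P.interior uinf) uinf P.interior :=
    extendFrom_extends (hconv.2.1.continuousOn)
  refine ⟨_, hU, hUv, fun i => ⟨_, ?_,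
    hP.tendstoLocallyUniformlyOn_openEdge hu hosc hconv hU hUv i, fun q _ => rfl⟩⟩
  have hUc := hP.convexOn_closed (hconvex.congr fun ξ hξ => (hUv hξ).symm) hU
  exact hUc.subset (P.openEdge_subset_closed i) (hP.convex_openEdge i)
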